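/- \textbf{Setting.} Let $X_A=T^*\mathbb R^n/T^*_{\mathbb Z}\mathbb R^n=\mathbb R^n\times(\mathbb R/\mathbb Z)^n$ with coordinates $(q,p)$, symplectic form $\sum_i dq_i\wedge dp_i$ and projection $\pi(q,p)=q$. For a rational polyhedral domain $e\subset\mathbb R^n$ let $L_e=N^*e/N^*_{\mathbb Z}e\subset X_A$ be its periodized conormal bundle. A tropical curve $V\subset\mathbb R^n$ is a finite collection of one-dimensional rational convex polyhedral domains (the edges) with positive integral weights, any two of which are disjoint or meet exactly in a common end point, and which is balanced at each end point (vertex). It is smooth if its edges at each vertex have weight one and $V$ is near each vertex $v$ the image of the standard tropical pair of pants $V_{\mathrm{pants}}=\mathbb R_{\ge0}(-1,0)\cup\mathbb R_{\ge0}(0,-1)\cup\mathbb R_{\ge0}(1,1)\subset\mathbb R^2$ under $x\mapsto v+x_0b_0+x_1b_1$, where $b_0,b_1$ are the first two vectors of a basis of $\mathbb Z^n$. It has genus zero if it is connected and the graph formed by its vertices and bounded edges has no cycles. A semi-infinite edge is an edge that is a ray. A Lagrangian lift $L_V\subset X_A$ of a smooth tropical curve $V$ is obtained as follows. Choose $\varepsilon>0$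 such that the balls $B_\varepsilon(v)$ around the vertices are pairwise disjoint and, for every vertex $v$, a basis $b_0,\dots,b_{n-1}$ of $\mathbb Z^n$ which identifies $V\cap B_\varepsilon(v)$ with $V_{\mathrm{pants}}$ as above, inside $B_\varepsilon(v)$. Choose also for every vertex $v$ a Lagrangian pair of pants $P_v\subset\mathbb R^2\times(\mathbb R/\mathbb Z)^2$, that is, a closed embedded Lagrangian submanifold homeomorphic to a sphere minus three points, which outside a closed ball around $0\in\mathbb R^2$ is the union of the periodized conormal bundles of the three rays of $V_{\mathrm{pants}}$; this closed ball is required to be mapped into $B_\varepsilon(v)$. Then $L_V$ is the union of the $L_e$ over all edges $e$ outside $\pi^{-1}\big(\bigcup_v B_\varepsilon(v)\big)$, and over each $B_\varepsilon(v)$ it is $P_v\times(\{0\}\times(\mathbb R/\mathbb Z)^{n-2})$ in the symplectic coordinates $(x,\,p\cdot b)$ given by $q=v+\sum_k x_kb_k$ and the pairings $p\cdot b_k$. For an edge $e$, $H^k(L_V)\to H^k(L_e)$ denotes the restriction to the part of $L_e$ outside $\pi^{-1}\big(\bigcup_v B_\varepsilon(v)\big)$, which is contained in $L_V$ and is homotopy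 equivalent to $L_e$. \textbf{Statement.} Let $V\subset\mathbb R^n$ be a smooth tropical curve of genus zero, let $L_V$ be a Lagrangian lift of $V$, and let $H^*$ be singular cohomology with coefficients in an arbitrary abelian group. Then for every semi-infinite edge $f$ of $V$: \begin{enumerate} \item[(i)] the restriction map $H^1(L_V)\to H^1(L_f)$ is surjective; \item[(ii)] the restriction map $H^2(L_V)\to\bigoplus_{g\ne f}H^2(L_g)$, where $g$ ranges over the semi-infinite edges of $V$ different from $f$, is injective. \end{enumerate} -/

import Mathlib

open CategoryTheory Opposite
open scoped ContDiff

noncomputable section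

/-! ### Singular cohomology -/

/-- Singular cohomology `H^k(-; A)` with coefficients in an abelian group `A`: the cohomology of
the complex `Hom(C_•(-; ℤ), A)` of singular cochains, as a contravariant functor. -/
def singularCohomology (k : ℕ) (A : Type) [AddCommGroup A] : TopCat.{0}ᵒᵖ ⥤ AddCommGrpCat.{0} :=
  ((AlgebraicTopology.singularChainComplexFunctor AddCommGrpCat.{0}).obj
      (AddCommGrpCat.of ℤ)).op ⋙
    HomologicalComplex.opFunctor AddCommGrpCat.{0} (ComplexShape.down ℕ) ⋙
    (preadditiveYoneda.obj (AddCommGrpCat.of A)).mapHomologicalComplex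
      (ComplexShape.down ℕ).symm ⋙
    HomologicalComplex.homologyFunctor AddCommGrpCat.{0} (ComplexShape.down ℕ).symm k

/-- The group `H^k(S; A)` of a subset `S` of a topological space, with the subspace topology. -/
abbrev cohomologyOf {X : Type} [TopologicalSpace X] (k : ℕ) (A : Type) [AddCommGroup A]
    (S : Set X) : AddCommGrpCat.{0} :=
  (singularCohomology k A).obj (op (TopCat.of S))

/-- The restriction map `H^k(T; A) → H^k(S; A)` for `S ⊆ T`. -/
def cohomologyRes {X : Type} [TopologicalSpace X] (k : ℕ) (A : Type) [AddCommGroup A]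
    {S T : Set X} (h : S ⊆ T) : cohomologyOf k A T →+ cohomologyOf k A S :=
  ((singularCohomology k A).map
    (TopCat.ofHom (X := S) (Y := T) ⟨Set.inclusion h, continuous_inclusion h⟩).op).hom

/-! ### The symplectic manifold `T^*ℝⁿ / T^*_ℤ ℝⁿ` and its Lagrangian submanifolds -/

/-- The base `Q = ℝⁿ`, with its Euclidean metric. -/
abbrev BaseSpace (n : ℕ) : Type := EuclideanSpace ℝ (Fin n)

/-- `X_A = T^*ℝⁿ / T^*_ℤ ℝⁿ = ℝⁿ × (ℝ/ℤ)ⁿ`, with coordinates `(q, p)`. The Lagrangian torus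
fibration `X_A → ℝⁿ` is the first projection. -/
abbrev TorusBundle (n : ℕ) : Type := BaseSpace n × (Fin n → UnitAddCircle)

/-- The quotient map `T^*ℝⁿ = ℝⁿ × ℝⁿ → X_A`. -/
def quotientMap (n : ℕ) (x : BaseSpace n × BaseSpace n) : TorusBundle n :=
  (x.1, fun i => ((x.2 i : ℝ) : UnitAddCircle))

/-- The canonical symplectic form `∑ dq_i ∧ dp_i` on `T^*ℝⁿ`. -/
def symplecticForm (n : ℕ) (a b : BaseSpace n × BaseSpace n) : ℝ :=
  ∑ i, (a.1 i * b.2 i - b.1 i * a.2 i)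

/-- `L ⊆ X_A` is an embedded Lagrangian submanifold: near each of its points it is the image of a
smooth embedding `γ` (written through a lift to `T^*ℝⁿ`) of an open subset of `ℝⁿ`, with
`γ^* ω = 0`. -/
def IsLagrangianSubmanifold {n : ℕ} (L : Set (TorusBundle n)) : Prop :=
  ∀ x ∈ L, ∃ (U : Set (BaseSpace n)) (γ : BaseSpace n → BaseSpace n × BaseSpace n)
    (W : Set (TorusBundle n)),
    IsOpen U ∧ IsOpen W ∧ x ∈ W ∧
    ContDiffOn ℝ ∞ γ U ∧
    (∀ u ∈ U, Function.Injective (fderiv ℝ γ u)) ∧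
    (∀ u ∈ U, ∀ a b, symplecticForm n (fderiv ℝ γ u a) (fderiv ℝ γ u b) = 0) ∧
    Topology.IsEmbedding (fun u : U => quotientMap n (γ u)) ∧
    (fun u => quotientMap n (γ u)) '' U = L ∩ W

/-- The periodized conormal bundle `N^*e / N^*_ℤ e ⊆ X_A` of a polyhedral domain `e ⊆ ℝⁿ`. -/
def periodizedConormal {n : ℕ} (e : Set (BaseSpace n)) : Set (TorusBundle n) :=
  {x | x.1 ∈ e ∧ ∃ p : Fin n → ℝ, (∀ y ∈ vectorSpan ℝ e, ∑ i, p i * y i = 0) ∧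
    x.2 = fun i => ((p i : ℝ) : UnitAddCircle)}

/-! ### Tropical curves -/

/-- A rational convex polyhedral domain `{q | ⟨q, v_i⟩ ≥ c_i for all i}`, with finitely many
`v_i ∈ ℤⁿ` and `c_i ∈ ℝ`. -/
def IsRationalPolyhedron {n : ℕ} (s : Set (BaseSpace n)) : Prop :=
  ∃ (m : ℕ) (v : Fin m → Fin n → ℤ) (c : Fin m → ℝ),
    s = {q | ∀ i, c i ≤ ∑ j, (v i j : ℝ) * q j}

/-- `u` is the primitive integral vector which points from the end point `v` of `e` into `e`. -/
def IsPrimitiveOutgoing {n : ℕ} (e : Set (BaseSpace n)) (v : BaseSpace n) (u : Fin n → ℤ) : Prop :=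
  (∀ k : ℤ, (∀ i, k ∣ u i) → IsUnit k) ∧
  ∃ t : ℝ, 0 < t ∧ ∃ q ∈ e, ∀ i, q i = v i + t * (u i : ℝ)

open scoped Classical in
/-- A (finite, weighted) tropical curve in `ℝⁿ`. The boundary facets (end points) of a
one-dimensional polyhedral domain are its extreme points. -/
structure TropicalCurve (n : ℕ) where
  /-- the one-dimensional polyhedral domains -/
  edges : Finset (Set (BaseSpace n))
  /-- their weights (the values on sets that are not edges are irrelevant) -/
  weight : Set (BaseSpace n) → ℕ
  weight_pos : ∀ e ∈ edges, 0 < weight e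
  rational : ∀ e ∈ edges, IsRationalPolyhedron e
  one_dimensional : ∀ e ∈ edges, Module.finrank ℝ (vectorSpan ℝ e) = 1
  polyhedral_complex : ∀ e ∈ edges, ∀ e' ∈ edges, e ≠ e' →
    e ∩ e' = ∅ ∨
      ∃ v, e ∩ e' = {v} ∧ v ∈ e.extremePoints ℝ ∧ v ∈ e'.extremePoints ℝ
  balanced : ∀ e₀ ∈ edges, ∀ v ∈ e₀.extremePoints ℝ,
    ∃ u : Set (BaseSpace n) → Fin n → ℤ,
      (∀ e ∈ edges, v ∈ e → IsPrimitiveOutgoing e v (u e)) ∧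
      ∑ e ∈ edges with v ∈ e, weight e • u e = 0

/-- The three rays of the standard tropical pair of pants in `ℝ²`, with directions
`(-1, 0)`, `(0, -1)` and `(1, 1)`. -/
def pantsRay (i : Fin 3) : Set (BaseSpace 2) :=
  {x | ∃ t : ℝ, 0 ≤ t ∧ x = t • (![!₂[-1, 0], !₂[0, -1], !₂[1, 1]] i : BaseSpace 2)}

/-- A splitting `ℤⁿ = ℤ² ⊕ ℤⁿ⁻²`, given by a basis of `ℤⁿ` (there is none if `n < 2`). -/
abbrev IntegralSplitting (n : ℕ) : Type :=
  Module.Basis (Fin 2 ⊕ Fin (n - 2)) ℤ (Fin n → ℤ)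

/-- The integral affine embedding `ℝ² → ℝⁿ`, `x ↦ v + x₀ b₀ + x₁ b₁`, where `b₀, b₁` are the
first two vectors of the splitting. -/
def planeEmbedding {n : ℕ} (v : BaseSpace n) (B : IntegralSplitting n) (x : BaseSpace 2) :
    BaseSpace n :=
  WithLp.toLp 2 fun j => v j + ∑ i : Fin 2, x i * (B (Sum.inl i) j : ℝ)

/-- In the integral symplectic coordinates of `X_A` given by the basis `B` and the origin `v`
(base coordinates `q = v + ∑ x_k b_k`, dual fibre coordinates `⟨p, b_k⟩`), this is the product of
`P ⊆ ℝ² × (ℝ/ℤ)²` and `{0} × (ℝ/ℤ)ⁿ⁻²`. -/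
def productModel {n : ℕ} (v : BaseSpace n) (B : IntegralSplitting n) (P : Set (TorusBundle 2)) :
    Set (TorusBundle n) :=
  {y | ∃ x : BaseSpace 2, y.1 = planeEmbedding v B x ∧
    ((x, fun i => ∑ j, B (Sum.inl i) j • y.2 j) : TorusBundle 2) ∈ P}

namespace TropicalCurve

variable {n : ℕ}

/-- The underlying subset of `ℝⁿ`. -/
def support (V : TropicalCurve n) : Set (BaseSpace n) := {q | ∃ e ∈ V.edges, q ∈ e}

/-- The vertices (zero-dimensional strata): the end points of the edges. -/
def vertices (V : TropicalCurve n) : Set (BaseSpace n) :=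
  {v | ∃ e ∈ V.edges, v ∈ e.extremePoints ℝ}

/-- Inside `U`, the curve is the image of the standard tropical pair of pants in `ℝ² × 0` under
the integral affine map given by `v` and `B`. -/
def ModelledOnPants (V : TropicalCurve n) (v : BaseSpace n) (B : IntegralSplitting n)
    (U : Set (BaseSpace n)) : Prop :=
  ∀ q ∈ U, q ∈ V.support ↔ ∃ i, ∃ x ∈ pantsRay i, q = planeEmbedding v B x

/-- `V` is smooth: each vertex is locally modelled on the tropical pair of pants, whose rays have
weight one. -/
def IsSmooth (V : TropicalCurve n) : Prop :=
  ∀ v ∈ V.vertices, (∀ e ∈ V.edges, v ∈ e → V.weight e = 1) ∧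
    ∃ B : IntegralSplitting n, ∃ r > 0, V.ModelledOnPants v B (Metric.ball v r)

/-- The graph formed by the vertices and the bounded edges. An edge, being a segment, is
determined by its two end points. -/
def graph (V : TropicalCurve n) : SimpleGraph V.vertices where
  Adj v w := v ≠ w ∧ ∃ e ∈ V.edges, (v : BaseSpace n) ∈ e ∧ (w : BaseSpace n) ∈ e
  symm := ⟨fun _ _ h => ⟨h.1.symm, let ⟨e, he, hv, hw⟩ := h.2; ⟨e, he, hw, hv⟩⟩⟩
  loopless := ⟨fun _ h => h.1 rfl⟩

/-- `V` has genus zero: it is connected and its graph has no cycles. -/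
def IsGenusZero (V : TropicalCurve n) : Prop :=
  IsConnected V.support ∧ V.graph.IsAcyclic

/-- A semi-infinite edge is an edge that is a ray: it is unbounded and has an end point. -/
def IsSemiInfinite (V : TropicalCurve n) (e : Set (BaseSpace n)) : Prop :=
  e ∈ V.edges ∧ ¬ Bornology.IsBounded e ∧ (e.extremePoints ℝ).Nonempty

end TropicalCurve

/-! ### The Lagrangian lift -/

/-- `P ⊆ X_A` (for `n = 2`) is a Lagrangian pair of pants which is conormal outside the closed ball
of radius `r`: a properly embedded Lagrangian submanifold, homeomorphic to a sphere minus three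
points, which lies outside this ball over the standard tropical pair of pants and is there equal to
the periodized conormal bundles of its rays. -/
structure IsLagrangianPants (r : ℝ) (P : Set (TorusBundle 2)) : Prop where
  isClosed : IsClosed P
  lagrangian : IsLagrangianSubmanifold P
  pants : Nonempty (P ≃ₜ {z : ℂ // z ≠ 0 ∧ z ≠ 1})
  conormal : ∀ x : TorusBundle 2, x.1 ∉ Metric.closedBall 0 r →
    (x ∈ P ↔ ∃ i, x ∈ periodizedConormal (pantsRay i))

namespace TropicalCurve

variable {n : ℕ}

/-- The choices in the construction of the Lagrangian lift of a smooth tropical curve: a scale `ε`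
and, for each vertex, an integral splitting identifying the curve over the `ε`-ball of this vertex
with the tropical pair of pants, and a Lagrangian pair of pants whose non-conormal part lies over
this ball. -/
structure LiftData (V : TropicalCurve n) where
  ε : ℝ
  ε_pos : 0 < ε
  splitting : V.vertices → IntegralSplitting n
  pants : V.vertices → Set (TorusBundle 2)
  modelled : ∀ v : V.vertices, V.ModelledOnPants v (splitting v) (Metric.ball v ε)
  disjoint : ∀ v w : V.vertices, v ≠ w →
    Disjoint (Metric.ball (v : BaseSpace n) ε) (Metric.ball (w : BaseSpace n) ε)
  lagrangianPants : ∀ v : V.vertices, ∃ r : ℝ, IsLagrangianPants r (pants v) ∧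
    ∀ x ∈ Metric.closedBall (0 : BaseSpace 2) r,
      planeEmbedding v (splitting v) x ∈ Metric.ball (v : BaseSpace n) ε

namespace LiftData

variable {V : TropicalCurve n}

/-- The part of `L_e` away from the `ε`-balls around the vertices. -/
def edgeLift (D : V.LiftData) (e : Set (BaseSpace n)) : Set (TorusBundle n) :=
  {y | y ∈ periodizedConormal e ∧ ∀ v : V.vertices, y.1 ∉ Metric.ball (v : BaseSpace n) D.ε}

/-- The Lagrangian lift `L_V ⊆ X_A`: away from the `ε`-balls around the vertices it is the union
of the `L_e`; over the ball around `v` it is the product of the Lagrangian pair of pants at `v`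
with a torus of dimension `n - 2`. -/
def lift (D : V.LiftData) : Set (TorusBundle n) :=
  {y | (∃ e ∈ V.edges, y ∈ D.edgeLift e) ∨
    ∃ v : V.vertices, y.1 ∈ Metric.ball (v : BaseSpace n) D.ε ∧
      y ∈ productModel (v : BaseSpace n) (D.splitting v) (D.pants v)}

theorem edgeLift_subset_lift (D : V.LiftData) {e : Set (BaseSpace n)} (he : e ∈ V.edges) :
    D.edgeLift e ⊆ D.lift :=
  fun _ hy => Or.inl ⟨e, he, hy⟩

/-- The restriction map `H^k(L_V; A) → H^k(L_e; A)`. -/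
def res (D : V.LiftData) (k : ℕ) (A : Type) [AddCommGroup A] {e : Set (BaseSpace n)}
    (he : e ∈ V.edges) : cohomologyOf k A D.lift →+ cohomologyOf k A (D.edgeLift e) :=
  cohomologyRes k A (D.edgeLift_subset_lift he)

/-- The restriction map `H^k(L_V; A) → ⨁_{g ≠ f} H^k(L_g; A)`, where `g` ranges over the (finitely
many) semi-infinite edges different from `f`. -/
def resOther (D : V.LiftData) (k : ℕ) (A : Type) [AddCommGroup A] (f : Set (BaseSpace n)) :
    cohomologyOf k A D.lift →+
      (∀ g : {g // V.IsSemiInfinite g ∧ g ≠ f}, cohomologyOf k A (D.edgeLift g)) where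
  toFun α g := D.res k A g.2.1.1 α
  map_zero' := funext fun g => map_zero (D.res k A g.2.1.1)
  map_add' α β := funext fun g => map_add (D.res k A g.2.1.1) α β

end LiftData

end TropicalCurve

end

/-!
The curve is a tree of stars, each of which has three edges, and the proof grows this tree from the
end point `v₀` of `f`, one vertex at a time, keeping both assertions true.

*One vertex.* Over the star of a vertex the Lagrangian lift is a pair of pants times a torus `Y`,
and the three edges correspond to its three ends. The pair of pants is homeomorphic to
`ℂ \ {0, 1}`; its ends have connected conormal neighbourhoods, which are therefore matched with the
punctures `0`, `1`, `∞` (`PuncturedPlane.exists_end_matching`). Radial projection shows that classes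
near a puncture extend to `(ℂ \ {0, 1}) × Y` (`PuncturedPlane.res_nbhd_surjective`). Two overlapping
half planes, which meet in a strip `I × Y` from which classes extend to either side, show that in
degree at least two a class which vanishes near two punctures is zero (`PuncturedPlane.detects`).
So for each star classes of degree one on any edge extend to the star, and a class of degree two is
zero if it vanishes on two of the three edges (`IsCoreRadius.res_star_surjective` and
`IsCoreRadius.eq_zero_of_res_star`).

*Attaching a vertex.* Let `W` be the set of vertices of a subtree and `w ∉ W` a neighbour. Since the
graph has no cycles, the part of the lift over the star of `w` meets the part over `W` only over one
edge `e`. By Mayer–Vietoris, a class on the part over `W` extends over the star of `w`, because its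
restriction to `e` does; and a class of degree two which vanishes on all edges leaving `W ∪ {w}`,
except `f`, vanishes on two edges at `w`, hence on the star of `w`, hence on `e`, hence over `W`, and
finally altogether, because `H¹` of the star maps onto `H¹` of the intersection
(`IsCoreRadius.isDetecting_insert`). When all vertices are used, the edges leaving `W` are the
semi-infinite ones.

Only the two consequences of Mayer–Vietoris just mentioned are needed
(`exists_cohomology_glue` and `cohomology_eq_zero_of_res`). They are proved for singular cochains,
regarded as functions on singular simplices, by iterated barycentric subdivision: a cochain
prescribed on the simplices in either of the two sets extends to the simplices of their union
compatibly with coboundaries (`SingCochain.reduce`). Subdivision is done on formal combinations of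
lists of points in a simplex, where the homotopy from subdivision to the identity is a recursion
over faces (`ListChain.td`).
-/

noncomputable section

section

open CategoryTheory Opposite AlgebraicTopology
open scoped ContDiff Simplicial

/-! ### Singular cochains -/

namespace SingCochain

/-- The singular cochain complex with coefficients in `A`, of which `singularCohomology` is the
cohomology. -/
def complex (A : Type) [AddCommGroup A] :
    TopCat.{0}ᵒᵖ ⥤ HomologicalComplex AddCommGrpCat.{0} (ComplexShape.down ℕ).symm :=
  ((AlgebraicTopology.singularChainComplexFunctor AddCommGrpCat.{0}).obj
      (AddCommGrpCat.of ℤ)).op ⋙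
    HomologicalComplex.opFunctor AddCommGrpCat.{0} (ComplexShape.down ℕ) ⋙
    (preadditiveYoneda.obj (AddCommGrpCat.of A)).mapHomologicalComplex
      (ComplexShape.down ℕ).symm

variable {A : Type} [AddCommGroup A]

/-- The `i`-th face inclusion `Δ^k → Δ^{k+1}`. -/
def face {k : ℕ} (i : Fin (k + 2)) :
    C(stdSimplex ℝ (Fin (k + 1)), stdSimplex ℝ (Fin (k + 2))) :=
  ⟨stdSimplex.map i.succAbove, stdSimplex.continuous_map _⟩

/-- The coboundary of a singular cochain, where a cochain with values in `A` is a function on the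
set of singular simplices. -/
def coboundary {X : Type} [TopologicalSpace X] {k : ℕ} (φ : C(stdSimplex ℝ (Fin (k + 1)), X) → A)
    (σ : C(stdSimplex ℝ (Fin (k + 2)), X)) : A :=
  ∑ i : Fin (k + 2), (-1 : ℤ) ^ (i : ℕ) • φ (σ.comp (face i))

variable (X : TopCat.{0})

/-- The `k`-simplices of the singular simplicial set are the singular `k`-simplices. -/
def simplexEquiv (k : ℕ) : (TopCat.toSSet.obj X) _⦋k⦌ ≃ C(stdSimplex ℝ (Fin (k + 1)), X) :=
  TopCat.toSSetObjEquiv X (op ⦋k⦌)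

open Limits

/-- The group `C_k(X; ℤ)` of singular chains. -/
abbrev chains (k : ℕ) : AddCommGrpCat.{0} :=
  ((TopCat.toSSet.obj X).chainComplex (AddCommGrpCat.of ℤ)).X k

/-- The values on singular simplices of a homomorphism on singular chains. -/
def toFn {k : ℕ} (u : chains X k ⟶ AddCommGrpCat.of A) :
    C(stdSimplex ℝ (Fin (k + 1)), X) → A := fun σ =>
  (((TopCat.toSSet.obj X).ιChainComplex (R := AddCommGrpCat.of ℤ)
    ((simplexEquiv X k).symm σ)) ≫ u).hom (1 : ℤ)

/-- The homomorphism on singular chains with given values on singular simplices. -/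
def ofFn {k : ℕ} (φ : C(stdSimplex ℝ (Fin (k + 1)), X) → A) :
    chains X k ⟶ AddCommGrpCat.of A :=
  ((TopCat.toSSet.obj X).isColimitChainComplexXCofan (AddCommGrpCat.of ℤ) k).desc
    (Cofan.mk _ fun x => AddCommGrpCat.ofHom (zmultiplesHom A (φ (simplexEquiv X k x))))

theorem toFn_ofFn {k : ℕ} (φ : C(stdSimplex ℝ (Fin (k + 1)), X) → A) :
    toFn X (ofFn X φ) = φ := by
  funext σ
  have := ((TopCat.toSSet.obj X).isColimitChainComplexXCofan (AddCommGrpCat.of ℤ) k).fac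
    (Cofan.mk _ fun x => AddCommGrpCat.ofHom (zmultiplesHom A (φ (simplexEquiv X k x))))
    ⟨(simplexEquiv X k).symm σ⟩
  have h2 := congrArg (fun f => f.hom (1 : ℤ)) this
  unfold toFn
  refine h2.trans ?_
  simp

theorem toFn_injective {k : ℕ} : Function.Injective (toFn (A := A) X (k := k)) := by
  intro u v h
  apply SSet.chainComplex_hom_ext
  intro x
  ext
  have := congrFun h (simplexEquiv X k x)
  simpa [toFn] using this

theorem toFn_add {k : ℕ} (u v : chains X k ⟶ AddCommGrpCat.of A) :
    toFn X (u + v) = toFn X u + toFn X v := by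
  funext σ
  simp [toFn]

theorem toFn_d {k : ℕ} (u : chains X k ⟶ AddCommGrpCat.of A) :
    toFn X (((TopCat.toSSet.obj X).chainComplex (AddCommGrpCat.of ℤ)).d (k + 1) k ≫ u) =
      coboundary (toFn X u) := by
  funext σ
  unfold toFn coboundary
  rw [← Category.assoc, SSet.ιChainComplex_d]
  rw [Preadditive.sum_comp]
  have : ∀ (n : ℕ) (g : Fin n → (AddCommGrpCat.of ℤ ⟶ AddCommGrpCat.of A)) (z : ℤ),
      (∑ i, g i).hom z = ∑ i, (g i).hom z := by
    intro n g z
    let F : (AddCommGrpCat.of ℤ ⟶ AddCommGrpCat.of A) →+ A :=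
      ⟨⟨fun g => g.hom z, rfl⟩, fun _ _ => rfl⟩
    exact map_sum F g _
  rw [this]
  refine Finset.sum_congr rfl fun i _ => ?_
  rw [Preadditive.zsmul_comp]
  simp
  rfl

theorem toFn_map {Y : TopCat.{0}} (f : X ⟶ Y) {k : ℕ} (u : chains Y k ⟶ AddCommGrpCat.of A) (σ) :
    toFn X ((SSet.chainComplexMap (TopCat.toSSet.map f) (AddCommGrpCat.of ℤ)).f k ≫ u) σ =
      toFn Y u (f.hom.comp σ) := by
  unfold toFn
  rw [← Category.assoc, SSet.ι_chainComplexMap_f]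
  rfl

theorem exists_cycles {ι : Type} {c : ComplexShape ι} (K : HomologicalComplex AddCommGrpCat.{0} c)
    {i j : ι} (hj : c.next i = j) (x : K.X i) (hx : K.d i j x = 0) : ∃ z : K.cycles i, K.iCycles i z = x := by
  subst hj
  exact ⟨(K.sc i).abCyclesIso.inv ⟨x, hx⟩, (K.sc i).abCyclesIso_inv_apply_iCycles ⟨x, hx⟩⟩

theorem homologyπ_eq_zero {ι : Type} {c : ComplexShape ι}
    (K : HomologicalComplex AddCommGrpCat.{0} c) {i j : ι} (hi : c.prev j = i) (z : K.cycles j) :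
    K.homologyπ j z = 0 ↔ ∃ y : K.X i, K.d i j y = K.iCycles j z := by
  have inj : Function.Injective (K.iCycles j) := (AddCommGrpCat.mono_iff_injective _).1 inferInstance
  have hex := ShortComplex.exact_of_g_is_cokernel
    (ShortComplex.mk _ _ (K.toCycles_comp_homologyπ i j)) (K.homologyIsCokernel i j hi)
  rw [ShortComplex.ab_exact_iff] at hex
  constructor
  · intro h
    obtain ⟨y, hy⟩ := hex z h
    refine ⟨y, ?_⟩
    rw [← hy, ← K.toCycles_i]
    rfl
  · rintro ⟨y, hy⟩
    have : z = K.toCycles i j y := by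
      apply inj
      rw [← hy, ← K.toCycles_i]
      rfl
    rw [this, ← ConcreteCategory.comp_apply, K.toCycles_comp_homologyπ]
    rfl

theorem exists_cls_complex (k : ℕ) (A : Type) [AddCommGroup A] :
    ∃ cls : ∀ X : TopCat.{0}, {φ : C(stdSimplex ℝ (Fin (k + 2)), X) → A // coboundary φ = 0} →
        ((complex A).obj (op X)).homology (k + 1),
      (∀ X, Function.Surjective (cls X)) ∧
      (∀ X φ ψ χ, φ.1 = ψ.1 + χ.1 → cls X φ = cls X ψ + cls X χ) ∧
      (∀ X φ, cls X φ = 0 ↔ ∃ ψ, coboundary ψ = φ.1) ∧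
      (∀ X Y (f : X ⟶ Y) φ ψ, (∀ σ, ψ.1 σ = φ.1 (f.hom.comp σ)) →
        HomologicalComplex.homologyMap ((complex A).map f.op) (k + 1) (cls Y φ) = cls X ψ) := by
  have hn : (ComplexShape.down ℕ).symm.next (k + 1) = k + 2 :=
    ComplexShape.next_eq' _ rfl
  have hp : (ComplexShape.down ℕ).symm.prev (k + 1) = k :=
    ComplexShape.prev_eq' _ rfl
  have hcyc : ∀ (X : TopCat.{0})
      (φ : {φ : C(stdSimplex ℝ (Fin (k + 2)), X) → A // coboundary φ = 0}),
      ∃ z : ((complex A).obj (op X)).cycles (k + 1),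
        ((complex A).obj (op X)).iCycles (k + 1) z = ofFn X φ.1 := fun X φ =>
    exists_cycles ((complex A).obj (op X)) hn (ofFn X φ.1) (by
      apply toFn_injective
      refine (toFn_d X (ofFn X φ.1)).trans ?_
      rw [toFn_ofFn, φ.2]
      funext σ
      rfl)
  choose cyc hcyc using hcyc
  have inj : ∀ X, Function.Injective (((complex A).obj (op X)).iCycles (k + 1)) := fun X =>
    (AddCommGrpCat.mono_iff_injective _).1 inferInstance
  have hof : ∀ (X : TopCat.{0}) (φ : C(stdSimplex ℝ (Fin (k + 2)), X) → A) u,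
      ofFn X φ = u ↔ φ = toFn X u := by
    intro X φ u
    constructor
    · rintro rfl; rw [toFn_ofFn]
    · rintro rfl; apply toFn_injective; rw [toFn_ofFn]
  refine ⟨fun X φ => ((complex A).obj (op X)).homologyπ (k + 1) (cyc X φ), ?_, ?_, ?_, ?_⟩
  · intro X y
    obtain ⟨z, rfl⟩ := (AddCommGrpCat.epi_iff_surjective
      (((complex A).obj (op X)).homologyπ (k + 1))).1 inferInstance y
    refine ⟨⟨toFn X (((complex A).obj (op X)).iCycles (k + 1) z), ?_⟩, ?_⟩
    · refine (toFn_d X _).symm.trans ?_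
      have : ((complex A).obj (op X)).d (k + 1) (k + 2)
          (((complex A).obj (op X)).iCycles (k + 1) z) = 0 := by
        rw [← ConcreteCategory.comp_apply, HomologicalComplex.iCycles_d]
        rfl
      refine (congrArg (toFn X) this).trans ?_
      funext σ; rfl
    · dsimp only
      congr 1
      apply inj
      exact (hcyc _ _).trans ((hof _ _ _).2 rfl)
  · rintro X φ ψ χ h
    dsimp only
    rw [← map_add]
    congr 1
    apply inj
    rw [map_add, hcyc, hcyc, hcyc]
    refine (hof _ _ _).2 ?_
    refine Eq.trans ?_ (toFn_add X _ _).symm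
    rw [toFn_ofFn, toFn_ofFn, h]
  · rintro X φ
    dsimp only
    rw [homologyπ_eq_zero _ hp]
    constructor
    · rintro ⟨y, hy⟩
      refine ⟨toFn X y, ?_⟩
      rw [hcyc] at hy
      refine (toFn_d X _).symm.trans ?_
      exact ((hof _ _ _).1 hy.symm).symm
    · rintro ⟨ψ, hψ⟩
      refine ⟨ofFn X ψ, ?_⟩
      rw [hcyc]
      symm
      refine (hof _ _ _).2 ?_
      rw [← hψ]
      refine Eq.trans ?_ (toFn_d X (ofFn X ψ)).symm
      rw [toFn_ofFn]
  · rintro X Y f φ ψ h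
    dsimp only
    rw [← ConcreteCategory.comp_apply, HomologicalComplex.homologyπ_naturality]
    rw [ConcreteCategory.comp_apply]
    congr 1
    apply inj
    rw [← ConcreteCategory.comp_apply, HomologicalComplex.cyclesMap_i, ConcreteCategory.comp_apply,
      hcyc, hcyc]
    symm
    refine (hof _ _ _).2 ?_
    funext σ
    rw [h]
    refine Eq.trans ?_ (toFn_map X f (ofFn Y φ.1) σ).symm
    rw [toFn_ofFn]

/-- Cohomology in positive degrees as cocycles modulo coboundaries: a map from cocycles to
cohomology which is surjective, additive, natural, and zero exactly on the coboundaries. -/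
theorem exists_cls (k : ℕ) (A : Type) [AddCommGroup A] :
    ∃ cls : ∀ X : TopCat.{0}, {φ : C(stdSimplex ℝ (Fin (k + 2)), X) → A // coboundary φ = 0} →
        (singularCohomology (k + 1) A).obj (op X),
      (∀ X, Function.Surjective (cls X)) ∧
      (∀ X φ ψ χ, φ.1 = ψ.1 + χ.1 → cls X φ = cls X ψ + cls X χ) ∧
      (∀ X φ, cls X φ = 0 ↔ ∃ ψ, coboundary ψ = φ.1) ∧
      (∀ X Y (f : X ⟶ Y) φ ψ, (∀ σ, ψ.1 σ = φ.1 (f.hom.comp σ)) →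
        (singularCohomology (k + 1) A).map f.op (cls Y φ) = cls X ψ) :=
  exists_cls_complex k A

end SingCochain

theorem singularCohomology_map_eq_of_homotopy (k : ℕ) (A : Type) [AddCommGroup A]
    {X Y : TopCat.{0}} {f g : X ⟶ Y} (h : ContinuousMap.Homotopy f.hom g.hom) :
    (singularCohomology k A).map f.op = (singularCohomology k A).map g.op :=
  ((preadditiveYoneda.obj (AddCommGrpCat.of A)).mapHomotopy
    (TopCat.Homotopy.singularChainComplexFunctorObjMap h (AddCommGrpCat.of ℤ)).op).homologyMap_eq k

end

/-! ### Subdivision of formal chains -/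

/-- Formal integral combinations of lists of points. A list of length `k + 1` stands for the affine
`k`-simplex with these vertices, and the empty list for an augmentation cell of dimension `-1`. -/
abbrev ListChain (P : Type) : Type := FreeAbelianGroup (List P)

namespace ListChain
open FreeAbelianGroup (of lift)

variable {P Q : Type}

/-- The cone with apex `v`, which puts `v` in front of each list. -/
def cone (v : P) : ListChain P →+ ListChain P := FreeAbelianGroup.map (v :: ·)

@[simp] theorem cone_of (v : P) (l : List P) : cone v (of l) = of (v :: l) :=
  FreeAbelianGroup.map_of_apply _

/-- The alternating sum of the faces of a list, defined recursively by `∂(v * l) = l - v * ∂l`. -/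
def bdList : List P → ListChain P
  | [] => 0
  | v :: l => of l - cone v (bdList l)

/-- The boundary map of the augmented complex. -/
def bd : ListChain P →+ ListChain P := lift bdList

@[simp] theorem bd_of (l : List P) : bd (of l) = bdList l := FreeAbelianGroup.lift_apply_of _ _

theorem bd_cone (v : P) (c : ListChain P) : bd (cone v c) = c - cone v (bd c) := by
  have : bd.comp (cone v) = AddMonoidHom.id _ - (cone v).comp bd := by
    ext l
    simp [bdList]
  exact DFunLike.congr_fun this c

theorem bdList_eq_sum (l : List P) :
    bdList l = ∑ i : Fin l.length, (-1 : ℤ) ^ (i : ℕ) • of (l.eraseIdx i) := by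
  induction l with
  | nil => simp [bdList]
  | cons v l ih =>
    rw [bdList, ih, map_sum]
    refine Eq.trans ?_ (Fin.sum_univ_succ (n := l.length) _).symm
    simp [pow_succ, sub_eq_add_neg]

theorem bd_bd (c : ListChain P) : bd (bd c) = 0 := by
  have : (bd (P := P)).comp bd = 0 := by
    ext l
    induction l with
    | nil => simp [bdList]
    | cons v l ih =>
      simp only [AddMonoidHom.coe_comp, Function.comp_apply, AddMonoidHom.zero_apply, bd_of] at ih ⊢
      rw [bdList, map_sub, bd_cone, ih]
      simp
  exact DFunLike.congr_fun this c

/-- The map induced by a map of points. -/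
def push (f : P → Q) : ListChain P →+ ListChain Q := FreeAbelianGroup.map (List.map f)

@[simp] theorem push_of (f : P → Q) (l : List P) : push f (of l) = of (l.map f) :=
  FreeAbelianGroup.map_of_apply _

theorem push_cone (f : P → Q) (v : P) (c : ListChain P) :
    push f (cone v c) = cone (f v) (push f c) := by
  have : (push f).comp (cone v) = (cone (f v)).comp (push f) := by ext l; simp
  exact DFunLike.congr_fun this c

theorem push_bd (f : P → Q) (c : ListChain P) : push f (bd c) = bd (push f c) := by
  have : (push f).comp bd = bd.comp (push f) := by
    ext l
    induction l with
    | nil => simp [bdList]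
    | cons v l ih =>
      simp only [AddMonoidHom.coe_comp, Function.comp_apply, bd_of, push_of, List.map_cons] at ih ⊢
      simp [bdList, push_cone, ih]
  exact DFunLike.congr_fun this c

/-- The homotopy between the identity and subdivision, for a choice `b` of an interior point of each
simplex: `T l = b(l) * (l - T ∂l)`. The recursion runs over the faces of `l`. -/
def tdList (b : List P → P) (l : List P) : ListChain P :=
  if l = [] then 0 else
    cone (b l) (of l - ∑ i : Fin l.length, (-1 : ℤ) ^ (i : ℕ) • tdList b (l.eraseIdx i))
termination_by l.length
decreasing_by
  rw [List.length_eraseIdx_of_lt i.2]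
  have := i.2
  omega

/-- The linear extension of `tdList`. -/
def td (b : List P → P) : ListChain P →+ ListChain P := lift (tdList b)

@[simp] theorem td_of (b : List P → P) (l : List P) : td b (of l) = tdList b l :=
  FreeAbelianGroup.lift_apply_of _ _

theorem tdList_nil (b : List P → P) : tdList b [] = 0 := by rw [tdList]; simp

theorem tdList_eq (b : List P → P) {l : List P} (hl : l ≠ []) :
    tdList b l = cone (b l) (of l - td b (bdList l)) := by
  rw [tdList, if_neg hl, bdList_eq_sum, map_sum]
  simp

/-- The subdivision operator, defined so that `td b` is a chain homotopy from it to the identity.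
By `sd_of` it sends `l` to the cone with apex `b l` over the subdivided boundary of `l`. -/
def sd (b : List P → P) : ListChain P →+ ListChain P :=
  AddMonoidHom.id _ - bd.comp (td b) - (td b).comp bd

theorem bd_td (b : List P → P) (c : ListChain P) :
    bd (td b c) = c - sd b c - td b (bd c) := by
  simp [sd]
  abel

theorem bd_sd (b : List P → P) (c : ListChain P) : bd (sd b c) = sd b (bd c) := by
  simp [sd, bd_bd]

theorem sd_of_nil (b : List P → P) : sd b (of []) = of [] := by
  simp [sd, tdList_nil, bdList]

theorem sd_of (b : List P → P) {l : List P} (hl : l ≠ []) :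
    sd b (of l) = cone (b l) (sd b (bdList l)) := by
  have h : sd b (of l) = of l - bd (tdList b l) - td b (bdList l) := by simp [sd]
  rw [h, tdList_eq b hl, bd_cone, map_sub bd, bd_td, ← bd_of, bd_bd]
  simp
  abel

theorem push_td (f : P → Q) (b : List P → P) (b' : List Q → Q)
    (h : ∀ l, l ≠ [] → b' (l.map f) = f (b l)) (c : ListChain P) :
    push f (td b c) = td b' (push f c) := by
  have : (push f).comp (td b) = (td b').comp (push f) := by
    ext l
    simp only [AddMonoidHom.coe_comp, Function.comp_apply, td_of, push_of]
    induction hn : l.length using Nat.strong_induction_on generalizing l with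
    | _ n ih =>
    subst hn
    by_cases hl : l = []
    · subst hl; simp [tdList_nil]
    · rw [tdList_eq b hl, tdList_eq b' (by simpa using hl), h l hl, push_cone, map_sub, push_of]
      congr 2
      rw [← bd_of (l.map f), ← push_of, ← push_bd, bd_of, bdList_eq_sum]
      simp only [map_sum, map_zsmul, td_of, push_of]
      refine Finset.sum_congr rfl fun i _ => ?_
      congr 1
      refine ih _ ?_ _ rfl
      rw [List.length_eraseIdx_of_lt i.2]
      have := i.2
      omega
  exact DFunLike.congr_fun this c

theorem push_sd (f : P → Q) (b : List P → P) (b' : List Q → Q)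
    (h : ∀ l, l ≠ [] → b' (l.map f) = f (b l)) (c : ListChain P) :
    push f (sd b c) = sd b' (push f c) := by
  simp [sd, push_bd, push_td f b b' h]

/-- The subgroup spanned by the lists in `s`. -/
def span (s : Set (List P)) : AddSubgroup (ListChain P) := AddSubgroup.closure (of '' s)

theorem of_mem_span {s : Set (List P)} {l : List P} (h : l ∈ s) : of l ∈ span s :=
  AddSubgroup.subset_closure ⟨l, h, rfl⟩

theorem span_mono {s t : Set (List P)} (h : s ⊆ t) : span s ≤ span t :=
  AddSubgroup.closure_mono (Set.image_mono h)

theorem map_mem_of_mem_span {G : Type} [AddCommGroup G] {s : Set (List P)} {H : AddSubgroup G}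
    (F : ListChain P →+ G) (h : ∀ l ∈ s, F (of l) ∈ H) {c : ListChain P} (hc : c ∈ span s) :
    F c ∈ H := by
  have : span s ≤ H.comap F := by
    rw [span, AddSubgroup.closure_le]
    rintro _ ⟨l, hl, rfl⟩
    exact h l hl
  exact this hc

/-- The homotopy between the identity and the `N`-fold subdivision. -/
def tdIter (b : List P → P) (N : ℕ) : ListChain P →+ ListChain P where
  toFun c := ∑ j ∈ Finset.range N, td b ((sd b)^[j] c)
  map_zero' := by simp [iterate_map_zero]
  map_add' c c' := by simp [iterate_map_add, Finset.sum_add_distrib]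

theorem tdIter_apply (b : List P → P) (N : ℕ) (c : ListChain P) :
    tdIter b N c = ∑ j ∈ Finset.range N, td b ((sd b)^[j] c) := rfl

theorem push_sd_iterate (f : P → Q) (b : List P → P) (b' : List Q → Q)
    (h : ∀ l, l ≠ [] → b' (l.map f) = f (b l)) (j : ℕ) (c : ListChain P) :
    push f ((sd b)^[j] c) = (sd b')^[j] (push f c) := by
  induction j generalizing c with
  | zero => rfl
  | succ j ih => rw [Function.iterate_succ_apply, Function.iterate_succ_apply, ih, push_sd f b b' h]

theorem push_tdIter (f : P → Q) (b : List P → P) (b' : List Q → Q)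
    (h : ∀ l, l ≠ [] → b' (l.map f) = f (b l)) (N : ℕ) (c : ListChain P) :
    push f (tdIter b N c) = tdIter b' N (push f c) := by
  simp [tdIter_apply, push_td f b b' h, push_sd_iterate f b b' h]

theorem bd_sd_iterate (b : List P → P) (N : ℕ) (c : ListChain P) :
    bd ((sd b)^[N] c) = (sd b)^[N] (bd c) := by
  induction N generalizing c with
  | zero => rfl
  | succ N ih => rw [Function.iterate_succ_apply, Function.iterate_succ_apply, ih, bd_sd]

theorem bd_tdIter (b : List P → P) (N : ℕ) (c : ListChain P) :
    bd (tdIter b N c) = c - (sd b)^[N] c - tdIter b N (bd c) := by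
  induction N with
  | zero => simp [tdIter_apply]
  | succ N ih =>
    simp only [tdIter_apply] at ih ⊢
    rw [Finset.sum_range_succ, map_add, ih, bd_td, bd_sd_iterate, Finset.sum_range_succ,
      Function.iterate_succ_apply']
    abel

end ListChain

/-! ### Barycentric subdivision -/

namespace ListChain
open FreeAbelianGroup (of lift)

/-- The standard `n`-simplex. -/
abbrev Simplex (n : ℕ) : Type := stdSimplex ℝ (Fin (n + 1))

variable {n k m : ℕ}

/-- The affine map from the standard simplex with the given images of the vertices. -/
def aff (w : Fin (k + 1) → Simplex n) : C(Simplex k, Simplex n) where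
  toFun t := ⟨∑ i, t.1 i • (w i).1,
    (convex_stdSimplex ℝ _).sum_mem (fun i _ => t.2.1 i) t.2.2 fun i _ => (w i).2⟩
  continuous_toFun := by
    refine Continuous.subtype_mk ?_ _
    refine continuous_finsetSum _ fun i _ => ?_
    exact ((continuous_apply i).comp continuous_subtype_val).smul continuous_const

/-- The convex hull of the points of a list. -/
def hull (l : List (Simplex n)) : Set (Simplex n) :=
  {p | p.1 ∈ convexHull ℝ (Subtype.val '' {x | x ∈ l})}

theorem mem_hull {l : List (Simplex n)} {x : Simplex n} (h : x ∈ l) : x ∈ hull l :=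
  subset_convexHull ℝ _ ⟨x, h, rfl⟩

theorem hull_subset {l l' : List (Simplex n)} (h : ∀ x ∈ l', x ∈ hull l) : hull l' ⊆ hull l := by
  intro p hp
  refine convexHull_min ?_ (convex_convexHull ℝ _) hp
  rintro _ ⟨x, hx, rfl⟩
  exact h x hx

theorem aff_mem_hull {l : List (Simplex n)} (w : Fin (k + 1) → Simplex n) (h : ∀ i, w i ∈ l)
    (t : Simplex k) : aff w t ∈ hull l :=
  (convex_convexHull ℝ _).sum_mem (fun i _ => t.2.1 i) t.2.2 fun i _ => mem_hull (h i)

theorem aff_apply (w : Fin (k + 1) → Simplex n) (t : Simplex k) (j : Fin (n + 1)) :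
    (aff w t).1 j = ∑ i, t.1 i * (w i).1 j := by
  simp [aff]

theorem aff_comp (w : Fin (k + 1) → Simplex n) (u : Fin (m + 1) → Simplex k) :
    (aff w).comp (aff u) = aff (fun i => aff w (u i)) := by
  refine ContinuousMap.ext fun t => Subtype.ext (funext fun j => ?_)
  rw [ContinuousMap.comp_apply]
  simp only [aff_apply, Finset.sum_mul, Finset.mul_sum]
  rw [Finset.sum_comm]
  simp only [mul_assoc]

/-- The `i`-th vertex of the standard simplex. -/
def vertex (i : Fin (n + 1)) : Simplex n := ⟨Pi.single i 1, single_mem_stdSimplex ℝ i⟩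

theorem aff_vertex (w : Fin (k + 1) → Simplex n) (i : Fin (k + 1)) : aff w (vertex i) = w i := by
  refine Subtype.ext (funext fun j => ?_)
  simp [aff_apply, vertex, Pi.single_apply]

theorem aff_vertex_eq_id : aff (vertex (n := n)) = ContinuousMap.id _ := by
  refine ContinuousMap.ext fun t => Subtype.ext (funext fun j => ?_)
  simp [aff_apply, vertex, Pi.single_apply]

theorem face_eq_aff (i : Fin (k + 2)) :
    SingCochain.face i = aff (fun j => vertex (i.succAbove j)) := by
  refine ContinuousMap.ext fun t => Subtype.ext (funext fun j => ?_)
  rw [aff_apply]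
  change FunOnFinite.linearMap ℝ ℝ i.succAbove t.1 j = _
  simp [vertex, Pi.single_apply, FunOnFinite.linearMap_apply_apply, Finset.sum_filter, eq_comm]

theorem dist_face_le (i : Fin (k + 2)) (p q : Simplex k) :
    dist (SingCochain.face i p) (SingCochain.face i q) ≤ dist p q := by
  rw [face_eq_aff, Subtype.dist_eq, dist_pi_le_iff dist_nonneg]
  intro j
  rw [aff_apply, aff_apply]
  rcases eq_or_ne j i with rfl | hj
  · simp [vertex, (Fin.succAbove_ne j _).symm]
  · obtain ⟨j, rfl⟩ := Fin.exists_succAbove_eq hj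
    simpa [vertex, Pi.single_apply, Subtype.dist_eq] using dist_le_pi_dist p.1 q.1 j

theorem sum_inv_length {l : List (Simplex n)} (h : l ≠ []) :
    ∑ _i : Fin l.length, (l.length : ℝ)⁻¹ = 1 := by
  have : (l.length : ℝ) ≠ 0 := by simpa using h
  simp [this]

/-- The barycentre of a list of points. The value at the empty list is irrelevant. -/
def bary (l : List (Simplex n)) : Simplex n :=
  if h : l ≠ [] then
    ⟨∑ i : Fin l.length, (l.length : ℝ)⁻¹ • (l.get i).1,
      (convex_stdSimplex ℝ _).sum_mem (fun _ _ => by positivity) (sum_inv_length h)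
        fun i _ => (l.get i).2⟩
  else vertex 0

theorem bary_val {l : List (Simplex n)} (h : l ≠ []) :
    (bary l).1 = ∑ i : Fin l.length, (l.length : ℝ)⁻¹ • (l.get i).1 := by
  rw [bary, dif_pos h]

theorem bary_mem_hull {l : List (Simplex n)} (h : l ≠ []) : bary l ∈ hull l := by
  change (bary l).1 ∈ convexHull ℝ _
  rw [bary_val h]
  exact (convex_convexHull ℝ _).sum_mem (fun _ _ => by positivity) (sum_inv_length h)
    fun i _ => mem_hull (List.get_mem l i)

theorem bary_map_aff (w : Fin (k + 1) → Simplex n) (l : List (Simplex k)) (h : l ≠ []) :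
    bary (l.map (aff w)) = aff w (bary l) := by
  refine Subtype.ext (funext fun j => ?_)
  rw [aff_apply, bary_val h, bary_val (by simpa using h)]
  simp only [Finset.sum_apply, Pi.smul_apply, smul_eq_mul, Finset.sum_mul]
  rw [Finset.sum_comm]
  refine Fintype.sum_equiv (finCongr (List.length_map _)) _ _ fun i => ?_
  simp [aff_apply, Finset.mul_sum, mul_assoc]

/-- The barycentre of a simplex of dimension at most `N` and diameter at most `r` is at distance at
most `N / (N + 1) * r` from every point of the simplex. -/
theorem dist_bary_le {l : List (Simplex n)} (h : l ≠ []) {r : ℝ}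
    (hr : ∀ x ∈ l, ∀ y ∈ l, dist x y ≤ r) {N : ℕ} (hN : l.length ≤ N + 1) {p : Simplex n}
    (hp : p ∈ hull l) : dist p (bary l) ≤ N / (N + 1) * r := by
  have hr0 : 0 ≤ r := by
    obtain ⟨x, hx⟩ := List.exists_mem_of_ne_nil l h
    simpa using hr x hx x hx
  have hlen : 0 < l.length := List.length_pos_iff.2 h
  have key : ∀ x ∈ l, dist x (bary l) ≤ N / (N + 1) * r := by
    intro x hx
    obtain ⟨j, rfl⟩ := List.get_of_mem hx
    have hlen' : (0 : ℝ) < l.length := by exact_mod_cast hlen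
    have e : (bary l).1 - (l.get j).1 =
        ∑ i : Fin l.length, (l.length : ℝ)⁻¹ • ((l.get i).1 - (l.get j).1) := by
      simp only [smul_sub, Finset.sum_sub_distrib]
      rw [← Finset.sum_smul, sum_inv_length h, one_smul, bary_val h]
    rw [dist_comm, Subtype.dist_eq, dist_eq_norm, e]
    calc ‖∑ i : Fin l.length, (l.length : ℝ)⁻¹ • ((l.get i).1 - (l.get j).1)‖
        ≤ ∑ i : Fin l.length, ‖(l.length : ℝ)⁻¹ • ((l.get i).1 - (l.get j).1)‖ :=
          norm_sum_le _ _
      _ ≤ ∑ i : Fin l.length, (if i = j then 0 else (l.length : ℝ)⁻¹ * r) := by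
          refine Finset.sum_le_sum fun i _ => ?_
          split_ifs with hij
          · simp [hij]
          · rw [norm_smul, Real.norm_of_nonneg (by positivity), ← dist_eq_norm]
            exact mul_le_mul_of_nonneg_left (hr _ (List.get_mem l i) _ (List.get_mem l j))
              (by positivity)
      _ = ((l.length : ℝ) - 1) * ((l.length : ℝ)⁻¹ * r) := by
          rw [Finset.sum_ite, Finset.sum_const_zero, zero_add, Finset.sum_const, nsmul_eq_mul,
            Finset.filter_not, Finset.card_sdiff_of_subset (Finset.filter_subset _ _),
            Finset.filter_eq' Finset.univ j]
          simp only [Finset.card_univ, Fintype.card_fin, Finset.mem_univ, if_true,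
            Finset.card_singleton]
          rw [Nat.cast_sub hlen, Nat.cast_one]
      _ = ((l.length : ℝ) - 1) / l.length * r := by ring
      _ ≤ N / (N + 1) * r := by
          refine mul_le_mul_of_nonneg_right ?_ hr0
          rw [div_le_div_iff₀ hlen' (by positivity)]
          have : (l.length : ℝ) ≤ N + 1 := by exact_mod_cast hN
          nlinarith
  have : convexHull ℝ (Subtype.val '' {x | x ∈ l}) ⊆
      Metric.closedBall (bary l).1 (N / (N + 1) * r) := by
    refine convexHull_min ?_ (convex_closedBall _ _)
    rintro _ ⟨x, hx, rfl⟩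
    exact key x hx
  exact this hp

theorem td_mem_span_hull (l : List (Simplex n)) :
    td bary (of l) ∈ span {l' | ∀ x ∈ l', x ∈ hull l} := by
  induction hn : l.length using Nat.strong_induction_on generalizing l with
  | _ n ih =>
  subst hn
  rw [td_of]
  by_cases hl : l = []
  · subst hl; rw [tdList_nil]; exact zero_mem _
  rw [tdList_eq bary hl]
  refine map_mem_of_mem_span (s := {l' | ∀ x ∈ l', x ∈ hull l}) _ ?_ ?_
  · intro l' hl'
    rw [cone_of]
    refine of_mem_span ?_
    rintro x hx
    rcases List.mem_cons.1 hx with rfl | hx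
    · exact bary_mem_hull hl
    · exact hl' x hx
  · refine sub_mem (of_mem_span fun x hx => mem_hull hx) ?_
    rw [bdList_eq_sum, map_sum]
    refine sum_mem fun i _ => ?_
    rw [map_zsmul]
    refine zsmul_mem (span_mono ?_ (ih _ ?_ _ rfl)) _
    · intro l' hl' x hx
      exact hull_subset (fun y hy => mem_hull (List.mem_of_mem_eraseIdx hy)) (hl' x hx)
    · rw [List.length_eraseIdx_of_lt i.2]
      have := i.2
      omega

theorem td_mem_span {s : Set (List (Simplex n))}
    (hs : ∀ l ∈ s, ∀ l', (∀ x ∈ l', x ∈ hull l) → l' ∈ s) {c : ListChain (Simplex n)}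
    (hc : c ∈ span s) : td bary c ∈ span s :=
  map_mem_of_mem_span _ (fun l hl => span_mono (hs l hl) (td_mem_span_hull l)) hc

/-- Lists of at most `N + 1` points that are pairwise at distance at most `r`. -/
def meshLE (N : ℕ) (r : ℝ) : Set (List (Simplex n)) :=
  {l | l.length ≤ N + 1 ∧ ∀ x ∈ l, ∀ y ∈ l, dist x y ≤ r}

/-- Subdivision shrinks the diameters of simplices of dimension at most `N` by `N / (N + 1)`. -/
theorem sd_of_mem_span_mesh (N : ℕ) {r : ℝ} (hr : 0 ≤ r) (l : List (Simplex n))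
    (hl : l ∈ meshLE N r) :
    sd bary (of l) ∈ span {l' | l'.length ≤ l.length ∧ (∀ x ∈ l', x ∈ hull l) ∧
      ∀ x ∈ l', ∀ y ∈ l', dist x y ≤ N / (N + 1) * r} := by
  induction hn : l.length using Nat.strong_induction_on generalizing l with
  | _ n ih =>
  subst hn
  by_cases hne : l = []
  · subst hne
    rw [sd_of_nil]
    exact of_mem_span ⟨le_rfl, by simp, by simp⟩
  rw [sd_of bary hne]
  refine map_mem_of_mem_span (s := {l' | l'.length + 1 ≤ l.length ∧ (∀ x ∈ l', x ∈ hull l) ∧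
      ∀ x ∈ l', ∀ y ∈ l', dist x y ≤ N / (N + 1) * r}) _ ?_ ?_
  · rintro l' ⟨h1, h2, h3⟩
    rw [cone_of]
    have hb : ∀ x ∈ l', dist x (bary l) ≤ N / (N + 1) * r := fun x hx =>
      dist_bary_le hne hl.2 hl.1 (h2 x hx)
    refine of_mem_span ⟨by simpa using h1, ?_, ?_⟩
    · rintro x hx
      rcases List.mem_cons.1 hx with rfl | hx
      · exact bary_mem_hull hne
      · exact h2 x hx
    · intro x hx y hy
      rcases List.mem_cons.1 hx with rfl | hx <;> rcases List.mem_cons.1 hy with rfl | hy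
      · rw [dist_self]; positivity
      · rw [dist_comm]; exact hb y hy
      · exact hb x hx
      · exact h3 x hx y hy
  · rw [bdList_eq_sum, map_sum]
    refine sum_mem fun i _ => ?_
    rw [map_zsmul]
    have hlen : (l.eraseIdx i).length + 1 = l.length := by
      rw [List.length_eraseIdx_of_lt i.2]
      have := i.2
      omega
    have hmem : ∀ x ∈ l.eraseIdx i, x ∈ l := fun x hx => List.mem_of_mem_eraseIdx hx
    refine zsmul_mem (span_mono ?_ (ih _ (by omega) (l.eraseIdx i)
      ⟨by have := hl.1; omega, fun x hx y hy => hl.2 x (hmem x hx) y (hmem y hy)⟩ rfl)) _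
    rintro l' ⟨h1, h2, h3⟩
    exact ⟨by omega, fun x hx => hull_subset (fun y hy => mem_hull (hmem y hy)) (h2 x hx), h3⟩

theorem sd_iterate_mem_span_mesh (N j : ℕ) {r : ℝ} (hr : 0 ≤ r) {c : ListChain (Simplex n)}
    (hc : c ∈ span (meshLE N r)) :
    (sd bary)^[j] c ∈ span (meshLE N ((N / (N + 1)) ^ j * r)) := by
  induction j with
  | zero => simpa using hc
  | succ j ih =>
    rw [Function.iterate_succ_apply']
    refine map_mem_of_mem_span (sd bary) (fun l hl => ?_) ih
    refine span_mono ?_ (sd_of_mem_span_mesh N (by positivity) l hl)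
    rintro l' ⟨h1, -, h3⟩
    refine ⟨h1.trans hl.1, fun x hx y hy => (h3 x hx y hy).trans_eq (by ring)⟩

end ListChain

/-! ### Gluing cochains along relatively open sets -/

namespace SingCochain
open FreeAbelianGroup (of lift)
open ListChain

variable {X : Type} [TopologicalSpace X] {A : Type} [AddCommGroup A] {k n : ℕ}

/-- Singular `k`-cochains, as functions on singular simplices. -/
abbrev Cochain (k : ℕ) (X : Type) [TopologicalSpace X] (A : Type) : Type := C(Simplex k, X) → A

/-- The value of a cochain on the affine simplex with vertices `l`, composed with `σ`; it is zero if
`l` does not span a simplex of the right dimension. -/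
def evList (φ : Cochain k X A) (σ : C(Simplex n, X)) (l : List (Simplex n)) : A :=
  if h : l.length = k + 1 then φ (σ.comp (aff fun i => l.get (i.cast h.symm))) else 0

/-- The linear extension of `evList`. -/
def ev (φ : Cochain k X A) (σ : C(Simplex n, X)) : ListChain (Simplex n) →+ A :=
  lift (evList φ σ)

@[simp] theorem ev_of (φ : Cochain k X A) (σ : C(Simplex n, X)) (l : List (Simplex n)) :
    ev φ σ (of l) = evList φ σ l := FreeAbelianGroup.lift_apply_of _ _

theorem ev_push (φ : Cochain k X A) (σ : C(Simplex n, X)) {m : ℕ} (w : Fin (m + 1) → Simplex n)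
    (c : ListChain (Simplex m)) : ev φ (σ.comp (aff w)) c = ev φ σ (push (aff w) c) := by
  have : ev φ (σ.comp (aff w)) = (ev φ σ).comp (push (aff w)) := by
    ext l
    simp only [AddMonoidHom.coe_comp, Function.comp_apply, ev_of, push_of, evList,
      List.length_map]
    split_ifs with h
    · rw [ContinuousMap.comp_assoc, aff_comp]
      simp
    · rfl
  exact DFunLike.congr_fun this c

theorem ev_coboundary (φ : Cochain k X A) (σ : C(Simplex n, X)) (c : ListChain (Simplex n)) :
    ev (coboundary φ) σ c = ev φ σ (bd c) := by
  have : ev (coboundary φ) σ = (ev φ σ).comp bd := by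
    ext l
    simp only [AddMonoidHom.coe_comp, Function.comp_apply, ev_of, bd_of]
    rw [bdList_eq_sum, map_sum]
    simp only [map_zsmul, ev_of]
    by_cases h : l.length = k + 2
    · rw [evList, dif_pos h, coboundary]
      refine Fintype.sum_equiv (finCongr h.symm) _ _ fun i => ?_
      have h' : (l.eraseIdx i).length = k + 1 := by
        rw [List.length_eraseIdx_of_lt (by have := i.2; omega)]; omega
      simp only [finCongr_apply, Fin.val_cast]
      congr 1
      rw [evList, dif_pos h', face_eq_aff, ContinuousMap.comp_assoc, aff_comp]
      congr 3
      funext j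
      rw [aff_vertex]
      simp only [List.get_eq_getElem, List.getElem_eraseIdx, Fin.val_cast, Fin.succAbove,
        Fin.lt_def, Fin.val_castSucc]
      split_ifs <;> simp
    · rw [evList, dif_neg h]
      symm
      refine Finset.sum_eq_zero fun i _ => ?_
      rw [evList, dif_neg, smul_zero]
      rw [List.length_eraseIdx_of_lt i.2]
      have := i.2
      omega
  exact DFunLike.congr_fun this c

/-- The list of the vertices of the standard simplex; its chain is the fundamental chain. -/
def vertices (n : ℕ) : List (Simplex n) := List.ofFn vertex

theorem ev_vertices (φ : Cochain k X A) (σ : C(Simplex k, X)) :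
    ev φ σ (of (vertices k)) = φ σ := by
  rw [ev_of, evList, dif_pos (by simp [vertices])]
  have : (aff fun i : Fin (k + 1) => (vertices k).get (i.cast (by simp [vertices]))) =
      ContinuousMap.id _ := by
    rw [← aff_vertex_eq_id]
    congr 1
    funext i
    simp only [vertices, List.get_eq_getElem, List.getElem_ofFn]
    rfl
  rw [this]
  rfl

theorem vertices_map_face (i : Fin (k + 2)) :
    (vertices k).map (face i) = (vertices (k + 1)).eraseIdx i := by
  refine List.ext_getElem ?_ fun j h1 h2 => ?_
  · rw [List.length_eraseIdx_of_lt (by simp [vertices]; omega)]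
    simp [vertices]
  · simp only [vertices, List.getElem_map, List.getElem_ofFn, List.getElem_eraseIdx, face_eq_aff,
      aff_vertex, Fin.succAbove, Fin.lt_def]
    split_ifs with h h' h'
    · rfl
    · exact absurd h h'
    · exact absurd h' h
    · rfl

theorem coboundary_coboundary (φ : Cochain k X A) : coboundary (coboundary φ) = 0 := by
  funext σ
  rw [← ev_vertices (coboundary (coboundary φ)), ev_coboundary, ev_coboundary, bd_bd, map_zero]
  rfl

variable (S T : Set X)

/-- The affine simplices whose image under `σ` lies in `S` or in `T`. -/
def smallLists (σ : C(Simplex n, X)) : Set (List (Simplex n)) :=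
  {l | (∀ p ∈ hull l, σ p ∈ S) ∨ ∀ p ∈ hull l, σ p ∈ T}

/-- The singular simplices in `S` or in `T`. -/
def IsSmall (σ : C(Simplex n, X)) : Prop := (∀ p, σ p ∈ S) ∨ ∀ p, σ p ∈ T

open scoped Classical in
/-- The least `N` such that all simplices as small as those of the `N`-th subdivision are mapped by
`σ` into `S` or into `T` (zero if there is none). -/
def level (σ : C(Simplex n, X)) : ℕ :=
  if h : ∃ N : ℕ, meshLE n ((n / (n + 1) : ℝ) ^ N) ⊆ smallLists S T σ then Nat.find h else 0

variable {S T}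

theorem hull_map {m : ℕ} (w : Fin (m + 1) → Simplex n) {l : List (Simplex m)} {p : Simplex m}
    (hp : p ∈ hull l) : aff w p ∈ hull (l.map (aff w)) := by
  have : convexHull ℝ (Subtype.val '' {x | x ∈ l}) ⊆
      (Fintype.linearCombination ℝ (fun i => (w i).1)) ⁻¹'
        convexHull ℝ (Subtype.val '' {x | x ∈ l.map (aff w)}) := by
    refine convexHull_min ?_ ((convex_convexHull ℝ _).linear_preimage _)
    rintro _ ⟨x, hx, rfl⟩
    exact subset_convexHull ℝ _ ⟨aff w x, List.mem_map_of_mem hx, rfl⟩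
  exact this hp

theorem level_eq_zero {σ : C(Simplex n, X)} (h : IsSmall S T σ) : level S T σ = 0 := by
  have h0 : meshLE n ((n / (n + 1) : ℝ) ^ 0) ⊆ smallLists S T σ := fun l _ =>
    h.imp (fun h p _ => h p) fun h p _ => h p
  rw [level, dif_pos ⟨0, h0⟩]
  simpa using h0

/-- `S` and `T` are relatively open in their union. -/
def RelOpen (S T : Set X) : Prop :=
  ∃ G G' : Set X, IsOpen G ∧ IsOpen G' ∧ S = (S ∪ T) ∩ G ∧ T = (S ∪ T) ∩ G'

theorem meshLE_mono {N : ℕ} {r r' : ℝ} (h : r ≤ r') :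
    (meshLE N r : Set (List (Simplex n))) ⊆ meshLE N r' :=
  fun _ hl => ⟨hl.1, fun x hx y hy => (hl.2 x hx y hy).trans h⟩

theorem ratio_pow_anti (n : ℕ) {N j : ℕ} (h : N ≤ j) :
    (n / (n + 1) : ℝ) ^ j ≤ (n / (n + 1) : ℝ) ^ N :=
  pow_le_pow_of_le_one (by positivity)
    ((div_le_one (by positivity)).2 (by linarith)) h

/-- The Lebesgue number lemma for the cover by `S` and `T`. -/
theorem exists_level (hST : RelOpen S T) {σ : C(Simplex n, X)} (hσ : ∀ p, σ p ∈ S ∪ T) :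
    ∃ N : ℕ, meshLE n ((n / (n + 1) : ℝ) ^ N) ⊆ smallLists S T σ := by
  obtain ⟨G, G', hG, hG', hS, hT⟩ := hST
  obtain ⟨δ, hδ, H⟩ := lebesgue_number_lemma_of_metric (s := (Set.univ : Set (Simplex n)))
    (c := fun b : Bool => σ ⁻¹' (if b then G else G')) isCompact_univ
    (fun b => by
      cases b
      · exact hG'.preimage σ.continuous
      · exact hG.preimage σ.continuous)
    (fun p _ => by
      rw [Set.mem_iUnion]
      rcases hσ p with h | h
      · rw [hS] at h; exact ⟨true, h.2⟩
      · rw [hT] at h; exact ⟨false, h.2⟩)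
  obtain ⟨N, hN⟩ := exists_pow_lt_of_lt_one hδ
    ((div_lt_one (by positivity)).2 (by linarith) : (n / (n + 1) : ℝ) < 1)
  refine ⟨N, fun l hl => ?_⟩
  rcases l with _ | ⟨x, l⟩
  · left
    intro p hp
    simp [hull] at hp
  have hsub : ∀ p ∈ hull (x :: l), p ∈ Metric.ball x δ := by
    intro p hp
    have : convexHull ℝ (Subtype.val '' {y | y ∈ x :: l}) ⊆ Metric.ball x.1 δ := by
      refine convexHull_min ?_ (convex_ball _ _)
      rintro _ ⟨y, hy, rfl⟩
      exact (hl.2 y hy x List.mem_cons_self).trans_lt hN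
    exact this hp
  obtain ⟨b, hb⟩ := H x (Set.mem_univ _)
  cases b
  · right
    intro p hp
    rw [hT]
    exact ⟨hσ p, hb (hsub p hp)⟩
  · left
    intro p hp
    rw [hS]
    exact ⟨hσ p, hb (hsub p hp)⟩

theorem level_spec (hST : RelOpen S T) {σ : C(Simplex n, X)} (hσ : ∀ p, σ p ∈ S ∪ T) {j : ℕ}
    (hj : level S T σ ≤ j) : meshLE n ((n / (n + 1) : ℝ) ^ j) ⊆ smallLists S T σ := by
  classical
  have h := exists_level hST hσ
  rw [level, dif_pos h] at hj
  exact (meshLE_mono (ratio_pow_anti n hj)).trans (Nat.find_spec h)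

theorem level_face_le (hST : RelOpen S T) {σ : C(Simplex (n + 1), X)} (hσ : ∀ p, σ p ∈ S ∪ T)
    (i : Fin (n + 2)) : level S T (σ.comp (face i)) ≤ level S T σ := by
  classical
  have h := exists_level hST (σ := σ.comp (face i)) fun p => hσ _
  rw [level, dif_pos h]
  refine Nat.find_min' h fun l hl => ?_
  have hl' : l.map (face i) ∈ smallLists S T σ := by
    refine level_spec hST hσ le_rfl ⟨?_, ?_⟩
    · rw [List.length_map]; exact hl.1.trans (by omega)
    · intro x hx y hy
      obtain ⟨x, hx', rfl⟩ := List.mem_map.1 hx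
      obtain ⟨y, hy', rfl⟩ := List.mem_map.1 hy
      refine (dist_face_le i x y).trans ((hl.2 x hx' y hy').trans ?_)
      refine pow_le_pow_left₀ (by positivity) ?_ _
      rw [div_le_div_iff₀ (by positivity) (by positivity)]
      push_cast
      nlinarith
  have hh : ∀ p ∈ hull l, face i p ∈ hull (l.map (face i)) := fun p hp => by
    rw [face_eq_aff]; exact hull_map _ hp
  exact hl'.imp (fun h p hp => h _ (hh p hp)) fun h p hp => h _ (hh p hp)

theorem vertices_mem_meshLE (n : ℕ) : vertices n ∈ meshLE n (1 : ℝ) := by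
  refine ⟨by simp [vertices], fun x _ y _ => ?_⟩
  exact (Metric.dist_le_diam_of_mem (bounded_stdSimplex (Fin (n + 1))) x.2 y.2).trans
    diam_stdSimplex_le

theorem smallLists_of_hull {σ : C(Simplex n, X)} : ∀ l ∈ smallLists S T σ,
    ∀ l', (∀ x ∈ l', x ∈ hull l) → l' ∈ smallLists S T σ := fun _ hl _ h =>
  hl.imp (fun hl p hp => hl p (hull_subset h hp)) fun hl p hp => hl p (hull_subset h hp)

theorem ev_eq_zero {φ : Cochain k X A} (hφ : ∀ σ, IsSmall S T σ → φ σ = 0) {σ : C(Simplex n, X)}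
    {c : ListChain (Simplex n)} (hc : c ∈ span (smallLists S T σ)) : ev φ σ c = 0 := by
  have := map_mem_of_mem_span (H := ⊥) (ev φ σ) (fun l hl => ?_) hc
  · simpa using this
  rw [ev_of, evList, AddSubgroup.mem_bot]
  split_ifs with h
  · refine hφ _ ?_
    have hm : ∀ t, aff (fun i => l.get (i.cast h.symm)) t ∈ hull l := fun t =>
      aff_mem_hull _ (fun i => List.get_mem _ _) t
    exact hl.imp (fun hl t => hl _ (hm t)) fun hl t => hl _ (hm t)
  · rfl

variable (S T)

/-- The homotopy that subdivides each simplex as often as its level requires. -/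
def homotopyOp (φ : Cochain (k + 1) X A) : Cochain k X A := fun σ =>
  ev φ σ (tdIter bary (level S T σ) (of (vertices k)))

/-- The cochain map that is dual to subdividing each simplex into simplices in `S` or in `T`, defined
as the map homotopic to the identity via `homotopyOp`. -/
def reduce (φ : Cochain (k + 1) X A) : Cochain (k + 1) X A :=
  φ - coboundary (homotopyOp S T φ) - homotopyOp S T (coboundary φ)

variable {S T}

theorem IsSmall.face {σ : C(Simplex (k + 1), X)} (h : IsSmall S T σ) (i : Fin (k + 2)) :
    IsSmall S T (σ.comp (face i)) :=
  h.imp (fun h _ => h _) fun h _ => h _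

theorem homotopyOp_of_isSmall (φ : Cochain (k + 1) X A) {σ : C(Simplex k, X)}
    (h : IsSmall S T σ) : homotopyOp S T φ σ = 0 := by
  simp [homotopyOp, level_eq_zero h, tdIter_apply]

theorem reduce_of_isSmall (φ : Cochain (k + 1) X A) {σ : C(Simplex (k + 1), X)}
    (h : IsSmall S T σ) : reduce S T φ σ = φ σ := by
  simp [reduce, coboundary, homotopyOp_of_isSmall _ h, homotopyOp_of_isSmall _ (h.face _)]

/-- The values of `reduce S T φ` on simplices in `S ∪ T` depend only on the values of `φ` on
simplices in `S` or in `T`. -/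
theorem reduce_eq_zero (hST : RelOpen S T) {φ : Cochain (k + 1) X A}
    (hφ : ∀ σ, IsSmall S T σ → φ σ = 0) {σ : C(Simplex (k + 1), X)} (hσ : ∀ p, σ p ∈ S ∪ T) :
    reduce S T φ σ = 0 := by
  have deep : ∀ {m : ℕ} (τ : C(Simplex m, X)), (∀ p, τ p ∈ S ∪ T) → ∀ j ≥ level S T τ,
      (sd bary)^[j] (of (vertices m)) ∈ span (smallLists S T τ) := by
    intro m τ hτ j hj
    have := sd_iterate_mem_span_mesh m j zero_le_one (of_mem_span (vertices_mem_meshLE m))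
    rw [mul_one] at this
    exact span_mono (level_spec hST hτ hj) this
  -- a face may have a smaller level, but the difference consists of subdivided small simplices
  have hface : ∀ i : Fin (k + 2), ev φ (σ.comp (face i))
      (tdIter bary (level S T (σ.comp (face i))) (of (vertices k))) =
      ev φ σ (tdIter bary (level S T σ) (of ((vertices (k + 1)).eraseIdx i))) := by
    intro i
    rw [← vertices_map_face, ← push_of, face_eq_aff,
      ← push_tdIter _ bary bary (fun l hl => bary_map_aff _ l hl), ← ev_push, ← face_eq_aff]
    have hle := level_face_le hST hσ i
    symm
    rw [← sub_eq_zero, ← map_sub]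
    refine ev_eq_zero hφ ?_
    rw [tdIter_apply, tdIter_apply, ← Finset.sum_Ico_eq_sub _ hle]
    refine sum_mem fun j hj => td_mem_span smallLists_of_hull ?_
    exact deep (σ.comp (face i)) (fun p => hσ _) j (Finset.mem_Ico.1 hj).1
  have h1 : coboundary (homotopyOp S T φ) σ =
      ev φ σ (tdIter bary (level S T σ) (bd (of (vertices (k + 1))))) := by
    rw [bd_of, bdList_eq_sum, map_sum, map_sum, coboundary]
    have hlen : k + 2 = (vertices (k + 1)).length := by simp [vertices]
    refine Fintype.sum_equiv (finCongr hlen) _ _ fun i => ?_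
    rw [map_zsmul, map_zsmul]
    exact congrArg _ (hface i)
  have h2 : homotopyOp S T (coboundary φ) σ = ev φ σ (of (vertices (k + 1))) -
      ev φ σ ((sd bary)^[level S T σ] (of (vertices (k + 1)))) -
      ev φ σ (tdIter bary (level S T σ) (bd (of (vertices (k + 1))))) := by
    rw [homotopyOp, ev_coboundary, bd_tdIter, map_sub, map_sub]
  have h3 := ev_eq_zero hφ (deep σ hσ _ le_rfl)
  simp only [reduce, Pi.sub_apply]
  rw [h1, h2, h3, ev_vertices]
  abel

theorem coboundary_add (φ ψ : Cochain k X A) :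
    coboundary (φ + ψ) = coboundary φ + coboundary ψ := by
  funext σ
  simp [coboundary, Finset.sum_add_distrib]

theorem coboundary_sub (φ ψ : Cochain k X A) :
    coboundary (φ - ψ) = coboundary φ - coboundary ψ := by
  funext σ
  simp [coboundary, Finset.sum_sub_distrib, smul_sub]

theorem homotopyOp_sub (φ ψ : Cochain (k + 1) X A) :
    homotopyOp S T (φ - ψ) = homotopyOp S T φ - homotopyOp S T ψ := by
  funext σ
  have : ∀ c : ListChain (Simplex k), ev (φ - ψ) σ c = ev φ σ c - ev ψ σ c := by
    intro c
    have : ev (φ - ψ) σ = ev φ σ - ev ψ σ := by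
      ext l
      simp only [ev_of, AddMonoidHom.sub_apply, evList]
      split_ifs <;> simp
    exact DFunLike.congr_fun this c
  exact this _

theorem reduce_sub (φ ψ : Cochain (k + 1) X A) :
    reduce S T (φ - ψ) = reduce S T φ - reduce S T ψ := by
  simp only [reduce, coboundary_sub, homotopyOp_sub]
  abel

theorem coboundary_reduce (φ : Cochain (k + 1) X A) :
    coboundary (reduce S T φ) = reduce S T (coboundary φ) := by
  simp only [reduce, coboundary_sub, coboundary_coboundary, sub_zero]
  have : homotopyOp S T (0 : Cochain (k + 3) X A) = 0 := by
    simpa using homotopyOp_sub (S := S) (T := T) (0 : Cochain (k + 3) X A) 0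
  rw [this, sub_zero]

/-- `φ` and `ψ` agree on the singular simplices in `S`. -/
def EqOn (S : Set X) (φ ψ : Cochain k X A) : Prop := ∀ σ, (∀ p, σ p ∈ S) → φ σ = ψ σ

theorem EqOn.coboundary {S : Set X} {φ ψ : Cochain k X A} (h : EqOn S φ ψ) :
    EqOn S (coboundary φ) (coboundary ψ) := fun σ hσ => by
  simp only [SingCochain.coboundary]
  exact Finset.sum_congr rfl fun i _ => by rw [h _ fun p => hσ _]

/-- Cocycles on `S` and on `T` which agree on `S ∩ T` extend to a cocycle on `S ∪ T`. -/
theorem exists_glue (hST : RelOpen S T) {φ ψ : Cochain (k + 1) X A}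
    (hφ : EqOn S (coboundary φ) 0) (hψ : EqOn T (coboundary ψ) 0) (h : EqOn (S ∩ T) φ ψ) :
    ∃ χ : Cochain (k + 1) X A, EqOn (S ∪ T) (coboundary χ) 0 ∧ EqOn S χ φ ∧ EqOn T χ ψ := by
  classical
  -- any cochain with the right values on small simplices; `reduce` repairs it on the others
  let β : Cochain (k + 1) X A := fun σ => if ∀ p, σ p ∈ S then φ σ else ψ σ
  have hβS : EqOn S β φ := fun σ hσ => if_pos hσ
  have hβT : EqOn T β ψ := fun σ hσ => by
    by_cases hS : ∀ p, σ p ∈ S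
    · exact (if_pos hS).trans (h σ fun p => ⟨hS p, hσ p⟩)
    · exact if_neg hS
  refine ⟨reduce S T β, ?_, ?_, ?_⟩
  · intro σ hσ
    rw [coboundary_reduce]
    refine reduce_eq_zero hST ?_ hσ
    rintro τ (hτ | hτ)
    · rw [hβS.coboundary τ hτ, hφ τ hτ]; rfl
    · rw [hβT.coboundary τ hτ, hψ τ hτ]; rfl
  · intro σ hσ
    rw [reduce_of_isSmall _ (Or.inl hσ), hβS σ hσ]
  · intro σ hσ
    rw [reduce_of_isSmall _ (Or.inr hσ), hβT σ hσ]

/-- If a cocycle on `S ∪ T` has primitives on `S` and on `T` which agree on `S ∩ T`, it has a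
primitive on `S ∪ T`. -/
theorem exists_primitive (hST : RelOpen S T) {α : Cochain (k + 2) X A} {φ ψ : Cochain (k + 1) X A}
    (hα : EqOn (S ∪ T) (coboundary α) 0)
    (hφ : EqOn S (coboundary φ) α) (hψ : EqOn T (coboundary ψ) α) (h : EqOn (S ∩ T) φ ψ) :
    ∃ χ : Cochain (k + 1) X A, EqOn (S ∪ T) (coboundary χ) α := by
  classical
  let β : Cochain (k + 1) X A := fun σ => if ∀ p, σ p ∈ S then φ σ else ψ σ
  have hβS : EqOn S β φ := fun σ hσ => if_pos hσ
  have hβT : EqOn T β ψ := fun σ hσ => by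
    by_cases hS : ∀ p, σ p ∈ S
    · exact (if_pos hS).trans (h σ fun p => ⟨hS p, hσ p⟩)
    · exact if_neg hS
  refine ⟨reduce S T β + homotopyOp S T α, fun σ hσ => ?_⟩
  have h0 : reduce S T (α - coboundary β) σ = 0 := by
    refine reduce_eq_zero hST ?_ hσ
    rintro τ (hτ | hτ)
    · simp [hβS.coboundary τ hτ, hφ τ hτ]
    · simp [hβT.coboundary τ hτ, hψ τ hτ]
  have h1 : homotopyOp S T (coboundary α) σ = 0 := by
    rw [homotopyOp]
    have : ev (coboundary α) σ = 0 := by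
      ext l
      rw [ev_of, evList]
      split_ifs
      · exact hα _ fun p => hσ _
      · rfl
    rw [this]
    rfl
  have h2 : reduce S T α σ = α σ - coboundary (homotopyOp S T α) σ := by
    simp [reduce, h1]
  rw [reduce_sub, Pi.sub_apply, h2, ← coboundary_reduce, sub_eq_zero] at h0
  rw [coboundary_add, Pi.add_apply, ← h0]
  abel

end SingCochain

/-! ### Mayer–Vietoris arguments -/

/-- The map induced on singular cohomology by a continuous map. -/
def cohomologyMap (k : ℕ) (A : Type) [AddCommGroup A] {Y Z : Type} [TopologicalSpace Y]
    [TopologicalSpace Z] (f : C(Y, Z)) :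
    (singularCohomology k A).obj (op (TopCat.of Z)) →+
      (singularCohomology k A).obj (op (TopCat.of Y)) :=
  ((singularCohomology k A).map (TopCat.ofHom f).op).hom

section
variable {k : ℕ} {A : Type} [AddCommGroup A] {X Y Z : Type} [TopologicalSpace X]
  [TopologicalSpace Y] [TopologicalSpace Z]

theorem cohomologyMap_comp (f : C(X, Y)) (g : C(Y, Z)) (a) :
    cohomologyMap k A f (cohomologyMap k A g a) = cohomologyMap k A (g.comp f) a := by
  have : (singularCohomology k A).map (TopCat.ofHom (g.comp f)).op =
    (singularCohomology k A).map (TopCat.ofHom g).op ≫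
      (singularCohomology k A).map (TopCat.ofHom f).op := by
    rw [← Functor.map_comp]; rfl
  rw [cohomologyMap, cohomologyMap, cohomologyMap, this]
  rfl

theorem cohomologyMap_id (a) : cohomologyMap k A (ContinuousMap.id X) a = a := by
  have : (singularCohomology k A).map (TopCat.ofHom (ContinuousMap.id X)).op = 𝟙 _ :=
    (singularCohomology k A).map_id _
  rw [cohomologyMap, this]
  rfl

theorem cohomologyMap_eq_of_homotopic {f g : C(X, Y)} (h : f.Homotopic g) :
    cohomologyMap k A f = cohomologyMap k A g := by
  obtain ⟨h⟩ := h
  rw [cohomologyMap, cohomologyMap, singularCohomology_map_eq_of_homotopy k A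
    (f := TopCat.ofHom f) (g := TopCat.ofHom g) h]

variable {S T U : Set X}

theorem cohomologyRes_eq_map (h : S ⊆ T) : cohomologyRes k A h =
    cohomologyMap k A (⟨Set.inclusion h, continuous_inclusion h⟩ : C(S, T)) := rfl

theorem cohomologyRes_res (h : S ⊆ T) (h' : T ⊆ U) (a) :
    cohomologyRes k A h (cohomologyRes k A h' a) = cohomologyRes k A (h.trans h') a := by
  rw [cohomologyRes_eq_map, cohomologyRes_eq_map, cohomologyMap_comp]
  rfl

open SingCochain in
/-- Cohomology of a subset `S` of `X` through cochains on `X` that are cocycles on `S`, so that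
restriction to a smaller subset does not change the cochain. -/
theorem exists_classOn (k : ℕ) (A : Type) [AddCommGroup A] (X : Type) [TopologicalSpace X] :
    ∃ cls : ∀ S : Set X, {φ : Cochain (k + 1) X A // EqOn S (coboundary φ) 0} →
        cohomologyOf (k + 1) A S,
      (∀ S, Function.Surjective (cls S)) ∧
      (∀ S φ ψ χ, φ.1 = ψ.1 + χ.1 → cls S φ = cls S ψ + cls S χ) ∧
      (∀ S φ, cls S φ = 0 ↔ ∃ ψ, EqOn S (coboundary ψ) φ.1) ∧
      (∀ S T (h : S ⊆ T) φ ψ, ψ.1 = φ.1 → cohomologyRes (k + 1) A h (cls T φ) = cls S ψ) := by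
  classical
  obtain ⟨cls, hsurj, hadd, hzero, hmap⟩ := exists_cls k A
  let ι : ∀ S : Set X, C(S, X) := fun S => ⟨Subtype.val, continuous_subtype_val⟩
  let r : ∀ (S : Set X) {m : ℕ}, Cochain m X A → Cochain m S A := fun S m φ σ => φ ((ι S).comp σ)
  have hext : ∀ (S : Set X) {m : ℕ} (φ : Cochain m S A), ∃ ψ : Cochain m X A, r S ψ = φ := by
    intro S m φ
    refine ⟨fun σ => if h : ∀ p, σ p ∈ S then φ ⟨fun p => ⟨σ p, h p⟩, by fun_prop⟩ else 0, ?_⟩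
    funext σ
    exact (dif_pos fun p => (σ p).2).trans rfl
  have hEq : ∀ (S : Set X) {m : ℕ} (φ ψ : Cochain m X A), EqOn S φ ψ ↔ r S φ = r S ψ := by
    intro S m φ ψ
    constructor
    · intro h
      funext σ
      exact h _ fun p => (σ p).2
    · intro h σ hσ
      exact congrFun h ⟨fun p => ⟨σ p, hσ p⟩, by fun_prop⟩
  have hco : ∀ (S : Set X) {m : ℕ} (φ : Cochain m X A), coboundary (r S φ) = r S (coboundary φ) :=
    fun S m φ => rfl
  refine ⟨fun S φ => cls (TopCat.of S) ⟨r S φ.1, by rw [hco]; exact (hEq S _ _).1 φ.2⟩,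
    ?_, ?_, ?_, ?_⟩
  · intro S y
    obtain ⟨⟨φ, hφ⟩, rfl⟩ := hsurj _ y
    obtain ⟨ψ, rfl⟩ := hext S φ
    exact ⟨⟨ψ, (hEq S _ _).2 hφ⟩, rfl⟩
  · intro S φ ψ χ h
    refine hadd _ _ _ _ ?_
    dsimp only
    rw [h]
    rfl
  · intro S φ
    rw [hzero]
    constructor
    · rintro ⟨ψ, hψ⟩
      obtain ⟨ψ, rfl⟩ := hext S ψ
      exact ⟨ψ, (hEq S _ _).2 hψ⟩
    · rintro ⟨ψ, hψ⟩
      exact ⟨r S ψ, (hEq S _ _).1 hψ⟩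
  · intro S T h φ ψ e
    refine hmap _ _ _ _ _ fun σ => ?_
    dsimp only
    rw [e]
    rfl

open SingCochain in
/-- Mayer–Vietoris: classes on `S` and `T` with the same restriction to `S ∩ T` come from a class on
`S ∪ T`. The cover need only be relatively open. -/
theorem exists_cohomology_glue (hST : RelOpen S T) (hU : S ∪ T = U) (hSU : S ⊆ U) (hTU : T ⊆ U)
    (a : cohomologyOf (k + 1) A S)
    (b : cohomologyOf (k + 1) A T)
    (hab : cohomologyRes (k + 1) A Set.inter_subset_left a =
      cohomologyRes (k + 1) A (Set.inter_subset_right (s := S)) b) :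
    ∃ c : cohomologyOf (k + 1) A U,
      cohomologyRes (k + 1) A hSU c = a ∧ cohomologyRes (k + 1) A hTU c = b := by
  subst hU
  obtain ⟨cls, hsurj, hadd, hzero, hres⟩ := exists_classOn k A X
  have hcob : ∀ (S : Set X) (η : Cochain k X A), EqOn S (coboundary (coboundary η)) 0 := by
    intro S η σ _
    rw [coboundary_coboundary]
  have hrestr : ∀ {S T : Set X} (_ : S ⊆ T) {m : ℕ} {φ ψ : Cochain m X A}, EqOn T φ ψ →
      EqOn S φ ψ := fun h _ _ _ h' σ hσ => h' σ fun p => h (hσ p)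
  have hcls : ∀ (S : Set X) (φ ψ), EqOn S φ.1 ψ.1 → cls S φ = cls S ψ := by
    intro S φ ψ h
    have h0 : EqOn S (coboundary (φ.1 - ψ.1)) 0 := by
      rw [coboundary_sub]
      intro σ hσ
      simp [h.coboundary σ hσ]
    have h1 := hadd S φ ⟨φ.1 - ψ.1, h0⟩ ψ (by simp)
    rw [h1, (hzero S ⟨φ.1 - ψ.1, h0⟩).2 ⟨0, ?_⟩, zero_add]
    intro σ hσ
    simp [coboundary, h σ hσ]
  obtain ⟨φ, rfl⟩ := hsurj S a
  obtain ⟨ψ, rfl⟩ := hsurj T b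
  rw [hres _ _ _ φ ⟨φ.1, hrestr Set.inter_subset_left φ.2⟩ rfl,
    hres _ _ _ ψ ⟨ψ.1, hrestr Set.inter_subset_right ψ.2⟩ rfl] at hab
  have hd : EqOn (S ∩ T) (coboundary (φ.1 - ψ.1)) 0 := by
    rw [coboundary_sub]
    intro σ hσ
    have h1 := φ.2 σ fun p => (hσ p).1
    have h2 := ψ.2 σ fun p => (hσ p).2
    simp only [Pi.sub_apply, h1, h2, Pi.zero_apply, sub_zero]
  obtain ⟨η, hη⟩ := (hzero (S ∩ T) ⟨φ.1 - ψ.1, hd⟩).1 (by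
    have := hadd (S ∩ T) ⟨φ.1, hrestr Set.inter_subset_left φ.2⟩ ⟨φ.1 - ψ.1, hd⟩
      ⟨ψ.1, hrestr Set.inter_subset_right ψ.2⟩ (by simp)
    rw [hab] at this
    simpa using this)
  have hψ' : EqOn T (coboundary (coboundary η + ψ.1)) 0 := by
    rw [coboundary_add, coboundary_coboundary, zero_add]
    exact ψ.2
  obtain ⟨χ, hχ, hS, hT⟩ := exists_glue hST φ.2 hψ' (by
    intro σ hσ
    have := hη σ hσ
    simp only [Pi.sub_apply, Pi.add_apply] at this ⊢
    rw [this]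
    abel)
  refine ⟨cls _ ⟨χ, hχ⟩, ?_, ?_⟩
  · rw [hres S (S ∪ T) Set.subset_union_left ⟨χ, hχ⟩ ⟨χ, hrestr Set.subset_union_left hχ⟩ rfl]
    exact hcls _ _ _ hS
  · rw [hres T (S ∪ T) Set.subset_union_right ⟨χ, hχ⟩ ⟨χ, hrestr Set.subset_union_right hχ⟩ rfl,
      hcls T ⟨χ, hrestr Set.subset_union_right hχ⟩ ⟨_, hψ'⟩ hT,
      hadd T ⟨_, hψ'⟩ ⟨coboundary η, hcob T η⟩ ψ rfl,
      (hzero T ⟨coboundary η, hcob T η⟩).2 ⟨η, fun _ _ => rfl⟩, zero_add]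

open SingCochain in
/-- Mayer–Vietoris: if all classes on `S ∩ T` extend to `S`, then a class on `S ∪ T` of the next
degree is determined by its restrictions to `S` and `T`. -/
theorem cohomology_eq_zero_of_res (hST : RelOpen S T) (hU : S ∪ T = U) (hSU : S ⊆ U) (hTU : T ⊆ U)
    (hsurj' : Function.Surjective
      (cohomologyRes (k + 1) A (Set.inter_subset_left : S ∩ T ⊆ S)))
    (a : cohomologyOf (k + 2) A U)
    (hS : cohomologyRes (k + 2) A hSU a = 0)
    (hT : cohomologyRes (k + 2) A hTU a = 0) : a = 0 := by
  subst hU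
  obtain ⟨cls, hsurj, hadd, hzero, hres⟩ := exists_classOn (k + 1) A X
  obtain ⟨cls', hsurj₁, hadd', hzero', hres'⟩ := exists_classOn k A X
  have hrestr : ∀ {S T : Set X} (_ : S ⊆ T) {m : ℕ} {φ ψ : Cochain m X A}, EqOn T φ ψ →
      EqOn S φ ψ := fun h _ _ _ h' σ hσ => h' σ fun p => h (hσ p)
  obtain ⟨α, rfl⟩ := hsurj _ a
  rw [hres _ _ _ α ⟨α.1, hrestr Set.subset_union_left α.2⟩ rfl, hzero] at hS
  rw [hres _ _ _ α ⟨α.1, hrestr Set.subset_union_right α.2⟩ rfl, hzero] at hT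
  obtain ⟨φ, hφ⟩ := hS
  obtain ⟨ψ, hψ⟩ := hT
  have hd : EqOn (S ∩ T) (coboundary (φ - ψ)) 0 := by
    rw [coboundary_sub]
    intro σ hσ
    have h1 := hφ σ fun p => (hσ p).1
    have h2 := hψ σ fun p => (hσ p).2
    simp [h1, h2]
  -- the primitives differ on `S ∩ T` by a cocycle, which is removed by a cocycle on `S`
  obtain ⟨c, hc⟩ := hsurj' (cls' _ ⟨φ - ψ, hd⟩)
  obtain ⟨γ, rfl⟩ := hsurj₁ _ c
  rw [hres' _ _ _ γ ⟨γ.1, hrestr Set.inter_subset_left γ.2⟩ rfl] at hc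
  have hd2 : EqOn (S ∩ T) (coboundary (φ - ψ - γ.1)) 0 := by
    rw [coboundary_sub]
    intro σ hσ
    have h1 := hd σ hσ
    have h2 := γ.2 σ fun p => (hσ p).1
    simp only [Pi.sub_apply, h1, h2, Pi.zero_apply, sub_zero]
  obtain ⟨η, hη⟩ := (hzero' (S ∩ T) ⟨φ - ψ - γ.1, hd2⟩).1 (by
    have := hadd' (S ∩ T) ⟨φ - ψ, hd⟩ ⟨φ - ψ - γ.1, hd2⟩
      ⟨γ.1, hrestr Set.inter_subset_left γ.2⟩ (by simp)
    rw [hc] at this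
    simpa using this)
  rw [hzero]
  refine exists_primitive hST α.2 (φ := φ - γ.1 - coboundary η) (ψ := ψ) ?_ hψ ?_
  · intro σ hσ
    have h1 := γ.2 σ hσ
    rw [coboundary_sub, coboundary_sub, coboundary_coboundary]
    simp [h1, hφ σ hσ]
  · intro σ hσ
    have h1 := hη σ hσ
    simp only [Pi.sub_apply] at h1 ⊢
    rw [h1]
    abel

end

/-! ### Restriction maps and homotopies -/

section

variable {k : ℕ} {A : Type} [AddCommGroup A] {X Y : Type} [TopologicalSpace X]
  [TopologicalSpace Y] {S T : Set X}

theorem cohomologyRes_surjective_of_retract (h : S ⊆ T) (r : C(T, S))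
    (hr : (r.comp ⟨Set.inclusion h, continuous_inclusion h⟩).Homotopic (ContinuousMap.id S)) :
    Function.Surjective (cohomologyRes k A h) := by
  intro a
  refine ⟨cohomologyMap k A r a, ?_⟩
  rw [cohomologyRes_eq_map, cohomologyMap_comp, cohomologyMap_eq_of_homotopic hr,
    cohomologyMap_id]

/-- Classes on `S` extend to `T` if some map `r : T → S` restricts on `S` to a map homotopic to the
identity. -/
theorem cohomologyRes_surjective_of_homotopy (h : S ⊆ T) (r : X → X) (hr : ContinuousOn r T)
    (hrS : Set.MapsTo r T S) (F : ℝ → X → X)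
    (hF : ContinuousOn (fun p : ℝ × X => F p.1 p.2) (Set.Icc 0 1 ×ˢ S))
    (hFS : ∀ s ∈ Set.Icc (0 : ℝ) 1, ∀ x ∈ S, F s x ∈ S) (h0 : ∀ x ∈ S, F 0 x = r x)
    (h1 : ∀ x ∈ S, F 1 x = x) : Function.Surjective (cohomologyRes k A h) := by
  refine cohomologyRes_surjective_of_retract h
    ⟨fun x => ⟨r x, hrS x.2⟩, (continuousOn_iff_continuous_domRestrict.1 hr).subtype_mk _⟩
    ⟨⟨⟨fun p => ⟨F p.1 p.2, hFS _ p.1.2 _ p.2.2⟩, ?_⟩, ?_, ?_⟩⟩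
  · refine Continuous.subtype_mk ?_ _
    exact hF.comp_continuous (f := fun p : unitInterval × S => ((p.1 : ℝ), (p.2 : X)))
      (by fun_prop) fun p => ⟨p.1.2, p.2.2⟩
  · intro x
    exact Subtype.ext (h0 _ x.2)
  · intro x
    exact Subtype.ext (h1 _ x.2)

theorem cohomologyRes_bijective_of_homotopy (h : S ⊆ T) (F : ℝ → X → X)
    (hF : ContinuousOn (fun p : ℝ × X => F p.1 p.2) (Set.Icc 0 1 ×ˢ T))
    (hFT : ∀ s ∈ Set.Icc (0 : ℝ) 1, ∀ x ∈ T, F s x ∈ T)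
    (hFS : ∀ s ∈ Set.Icc (0 : ℝ) 1, ∀ x ∈ S, F s x ∈ S) (h0 : ∀ x ∈ T, F 0 x ∈ S)
    (h1 : ∀ x ∈ T, F 1 x = x) : Function.Bijective (cohomologyRes k A h) := by
  have hr : ContinuousOn (F 0) T :=
    hF.comp (f := fun x => ((0 : ℝ), x)) (by fun_prop) fun x hx => ⟨by simp, hx⟩
  refine ⟨?_, cohomologyRes_surjective_of_homotopy h (F 0) hr h0 F
    (hF.mono (Set.prod_mono le_rfl h)) hFS (fun _ _ => rfl) fun x hx => h1 x (h hx)⟩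
  let r : C(T, S) :=
    ⟨fun x => ⟨F 0 x, h0 _ x.2⟩, (continuousOn_iff_continuous_domRestrict.1 hr).subtype_mk _⟩
  have hom : ((⟨Set.inclusion h, continuous_inclusion h⟩ : C(S, T)).comp r).Homotopic
      (ContinuousMap.id T) := by
    refine ⟨⟨⟨fun p => ⟨F p.1 p.2, hFT _ p.1.2 _ p.2.2⟩, ?_⟩, ?_, ?_⟩⟩
    · refine Continuous.subtype_mk ?_ _
      exact hF.comp_continuous (f := fun p : unitInterval × T => ((p.1 : ℝ), (p.2 : X)))
        (by fun_prop) fun p => ⟨p.1.2, p.2.2⟩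
    · intro x
      rfl
    · intro x
      exact Subtype.ext (h1 _ x.2)
  refine Function.LeftInverse.injective (g := cohomologyMap k A r) fun a => ?_
  rw [cohomologyRes_eq_map, cohomologyMap_comp, cohomologyMap_eq_of_homotopic hom,
    cohomologyMap_id]

/-- A homeomorphism identifies the cohomology of corresponding subsets, compatibly with
restriction. -/
theorem exists_cohomology_transfer {T' : Set Y} (g : T ≃ₜ T') :
    ∃ e : cohomologyOf k A T' ≃+ cohomologyOf k A T, ∀ (S : Set X) (S' : Set Y) (h : S ⊆ T)
      (h' : S' ⊆ T'), (∀ x : T, (x : X) ∈ S ↔ (g x : Y) ∈ S') →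
      ∃ e' : cohomologyOf k A S' ≃+ cohomologyOf k A S,
        ∀ a, cohomologyRes k A h (e a) = e' (cohomologyRes k A h' a) := by
  have mkEquiv : ∀ {X Y : Type} [TopologicalSpace X] [TopologicalSpace Y] (T : Set X) (T' : Set Y)
      (u : C(T, T')) (v : C(T', T)) (_ : v.comp u = ContinuousMap.id _)
      (_ : u.comp v = ContinuousMap.id _),
      ∃ e : cohomologyOf k A T' ≃+ cohomologyOf k A T, ∀ a, e a = cohomologyMap k A u a := by
    intro X Y _ _ T T' u v huv hvu
    refine ⟨⟨⟨cohomologyMap k A u, cohomologyMap k A v, fun a => ?_, fun a => ?_⟩,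
      map_add (cohomologyMap k A u)⟩, fun a => rfl⟩
    · rw [cohomologyMap_comp, hvu, cohomologyMap_id]
    · rw [cohomologyMap_comp, huv, cohomologyMap_id]
  obtain ⟨e, he⟩ := mkEquiv T T' ⟨g, g.continuous⟩ ⟨g.symm, g.symm.continuous⟩
    (by ext x; simp) (by ext x; simp)
  refine ⟨e, fun S S' h h' hS => ?_⟩
  have hS' : ∀ y : T', (y : Y) ∈ S' ↔ (g.symm y : X) ∈ S := fun y => by
    rw [hS, g.apply_symm_apply]
  obtain ⟨e', he'⟩ := mkEquiv S S'
    ⟨fun x => ⟨g ⟨x, h x.2⟩, (hS _).1 x.2⟩, by fun_prop⟩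
    ⟨fun y => ⟨g.symm ⟨y, h' y.2⟩, (hS' _).1 y.2⟩, by fun_prop⟩
    (by ext x; simp) (by ext x; simp)
  refine ⟨e', fun a => ?_⟩
  rw [he, he', cohomologyRes_eq_map, cohomologyRes_eq_map, cohomologyMap_comp,
    cohomologyMap_comp]
  rfl

variable {E F : Type} [NormedAddCommGroup E] [NormedSpace ℝ E] [TopologicalSpace F]

theorem cohomologyRes_bijective_of_convex {C C' : Set E} (hC : Convex ℝ C) (hC' : Convex ℝ C')
    (hne : C.Nonempty) (hCC' : C ⊆ C') (Φ : Set F) (h : C ×ˢ Φ ⊆ C' ×ˢ Φ) :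
    Function.Bijective (cohomologyRes k A h) := by
  obtain ⟨c, hc⟩ := hne
  refine cohomologyRes_bijective_of_homotopy h
    (fun s y => ((1 - s) • c + s • y.1, y.2)) (by fun_prop) ?_ ?_ ?_ ?_
  · rintro s ⟨h0, h1⟩ y hy
    exact ⟨hC' (hCC' hc) hy.1 (by linarith) h0 (by ring), hy.2⟩
  · rintro s ⟨h0, h1⟩ y hy
    exact ⟨hC hc hy.1 (by linarith) h0 (by ring), hy.2⟩
  · intro y hy
    simpa using ⟨hc, hy.2⟩
  · intro y hy
    simp

/-- If outside the ball of radius `m` around `v` the set `T` is invariant under moving radially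
towards `v`, it has the same cohomology as its part inside any larger ball. -/
theorem cohomologyRes_bijective_of_radial {T : Set (E × F)} (v : E) {m ε : ℝ} (hm : 0 < m)
    (hmε : m < ε)
    (hT : ∀ y ∈ T, ∀ c ∈ Set.Icc (0 : ℝ) 1, m ≤ c * ‖y.1 - v‖ → (v + c • (y.1 - v), y.2) ∈ T)
    (h : {y | y ∈ T ∧ dist y.1 v < ε} ⊆ T) : Function.Bijective (cohomologyRes k A h) := by
  -- at time zero, points are moved radially into the closed ball of radius `m`
  let ρ : ℝ → E → ℝ := fun s q => s + (1 - s) * (m / max m ‖q - v‖)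
  have hmax : ∀ q : E, 0 < max m ‖q - v‖ := fun q => lt_max_of_lt_left hm
  have hρ : ∀ s ∈ Set.Icc (0 : ℝ) 1, ∀ q, ρ s q ∈ Set.Icc (0 : ℝ) 1 := by
    rintro s ⟨h0, h1⟩ q
    have h2 : 0 ≤ m / max m ‖q - v‖ := div_nonneg hm.le (hmax q).le
    have h3 : m / max m ‖q - v‖ ≤ 1 := (div_le_one (hmax q)).2 (le_max_left _ _)
    constructor
    · have := mul_nonneg (sub_nonneg.2 h1) h2
      simp only [ρ]; linarith
    · have := mul_le_mul_of_nonneg_left h3 (sub_nonneg.2 h1)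
      simp only [ρ]; linarith
  have key : ∀ s ∈ Set.Icc (0 : ℝ) 1, ∀ y ∈ T, (v + ρ s y.1 • (y.1 - v), y.2) ∈ T := by
    rintro s hs y hy
    rcases le_total ‖y.1 - v‖ m with hle | hle
    · have : ρ s y.1 = 1 := by
        simp only [ρ]
        rw [max_eq_left hle, div_self hm.ne']
        ring
      rw [this]
      simpa using hy
    · refine hT y hy _ (hρ s hs _) ?_
      have hpos : 0 < ‖y.1 - v‖ := hm.trans_le hle
      simp only [ρ]
      rw [max_eq_right hle, add_mul, mul_assoc, div_mul_cancel₀ _ hpos.ne']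
      nlinarith [hs.1, mul_le_mul_of_nonneg_left hle hs.1]
  have hnorm : ∀ s ∈ Set.Icc (0 : ℝ) 1, ∀ q : E,
      dist (v + ρ s q • (q - v)) v = ρ s q * dist q v := by
    intro s hs q
    rw [dist_eq_norm, add_sub_cancel_left, norm_smul, Real.norm_of_nonneg (hρ s hs q).1,
      dist_eq_norm]
  refine cohomologyRes_bijective_of_homotopy h (fun s y => (v + ρ s y.1 • (y.1 - v), y.2))
    ?_ key ?_ ?_ ?_
  · refine Continuous.continuousOn ?_
    have : Continuous fun p : ℝ × (E × F) => ρ p.1 p.2.1 := by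
      refine continuous_fst.add ((continuous_const.sub continuous_fst).mul
        (continuous_const.div ?_ fun p => (hmax _).ne'))
      fun_prop
    exact (continuous_const.add (this.smul (by fun_prop))).prodMk (by fun_prop)
  · intro s hs y hy
    refine ⟨key s hs y hy.1, ?_⟩
    simp only
    rw [hnorm s hs]
    exact (mul_le_of_le_one_left dist_nonneg (hρ s hs _).2).trans_lt hy.2
  · intro y hy
    refine ⟨key 0 (by simp) y hy, ?_⟩
    simp only
    rw [hnorm 0 (by simp)]
    refine lt_of_le_of_lt ?_ hmε
    simp only [ρ]
    rw [zero_add, sub_zero, one_mul, dist_eq_norm, div_mul_eq_mul_div, div_le_iff₀ (hmax _)]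
    exact mul_le_mul_of_nonneg_left (le_max_right _ _) hm.le
  · intro y hy
    simp [ρ]

end

/-! ### The plane minus two points -/

namespace PuncturedPlane

/-- The plane minus two points. -/
def plane : Set ℂ := {z | z ≠ 0 ∧ z ≠ 1}

/-- Punctured neighbourhoods of the three punctures `0`, `1` and `∞`. -/
def nbhd (c : Fin 3) (δ : ℝ) : Set ℂ :=
  ![{z | 0 < ‖z‖ ∧ ‖z‖ < δ}, {z | 0 < ‖z - 1‖ ∧ ‖z - 1‖ < δ}, {z | δ⁻¹ < ‖z‖}] c

variable {δ : ℝ}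

theorem nbhd_subset (hδ : 0 < δ) (h1 : δ ≤ 1 / 2) (c : Fin 3) : nbhd c δ ⊆ plane := by
  have h2 : 1 < δ⁻¹ := (one_lt_inv₀ hδ).2 (by linarith)
  intro z hz
  fin_cases c
  · have hz : 0 < ‖z‖ ∧ ‖z‖ < δ := hz
    refine ⟨norm_pos_iff.1 hz.1, ?_⟩
    rintro rfl
    simp at hz
    linarith
  · have hz : 0 < ‖z - 1‖ ∧ ‖z - 1‖ < δ := hz
    refine ⟨?_, fun h => by simp [h] at hz⟩
    rintro rfl
    simp at hz
    linarith
  · have hz : δ⁻¹ < ‖z‖ := hz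
    constructor
    · rintro rfl
      simp at hz
      linarith
    · rintro rfl
      simp at hz
      linarith

variable {k : ℕ} {A : Type} [AddCommGroup A] {Y : Type} [TopologicalSpace Y]

omit [TopologicalSpace Y] in
theorem prod_subset {C C' : Set ℂ} (h : C ⊆ C') :
    (C ×ˢ Set.univ : Set (ℂ × Y)) ⊆ C' ×ˢ Set.univ := Set.prod_mono h le_rfl

/-- Let `C` be an annulus around the puncture `a`. Classes on `C`, times `Y`, extend to the plane
minus two points: pull them back under the radial projection to the circle of radius `t` in `C`. -/
theorem circle_retract {a : ℂ} {C : Set ℂ} {t : ℝ} (ht : 0 < t) (hC : C ⊆ plane)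
    (ha : a ∉ plane) (hCt : ∀ z : ℂ, ‖z - a‖ = t → z ∈ C)
    (hconv : ∀ s ∈ Set.Icc (0 : ℝ) 1, ∀ z ∈ C,
      ∀ r : ℝ, r = (1 - s) * t + s * ‖z - a‖ → ∀ w : ℂ, ‖w - a‖ = r → w ∈ C)  :
    Function.Surjective (cohomologyRes k A (prod_subset hC (Y := Y))) := by
  have hne : ∀ z ∈ plane, 0 < ‖z - a‖ := by
    intro z hz
    rw [norm_pos_iff, sub_ne_zero]
    rintro rfl
    exact ha hz
  have hcont : ContinuousOn (fun y : ℂ × Y => t / ‖y.1 - a‖) (plane ×ˢ Set.univ) :=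
    continuousOn_const.div (by fun_prop) fun y hy => (hne y.1 hy.1).ne'
  have hnorm : ∀ z ∈ plane, ∀ b : ℝ, 0 ≤ b →
      ‖a + ((b * t / ‖z - a‖ : ℝ) : ℂ) * (z - a) - a‖ = b * t := by
    intro z hz b hb
    rw [add_sub_cancel_left, norm_mul, Complex.norm_real, Real.norm_of_nonneg (by positivity),
      div_mul_cancel₀ _ (hne z hz).ne']
  refine cohomologyRes_surjective_of_homotopy _
    (fun y => (a + ((t / ‖y.1 - a‖ : ℝ) : ℂ) * (y.1 - a), y.2)) ?_ ?_
    (fun s y => (a + (((1 - s) * (t / ‖y.1 - a‖) + s : ℝ) : ℂ) * (y.1 - a), y.2)) ?_ ?_ ?_ ?_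
  · refine ContinuousOn.prodMk ?_ (by fun_prop)
    exact continuousOn_const.add
      ((Complex.continuous_ofReal.comp_continuousOn hcont).mul (by fun_prop))
  · intro y hy
    refine ⟨hCt _ ?_, trivial⟩
    simpa using hnorm y.1 hy.1 1 zero_le_one
  · refine ContinuousOn.prodMk ?_ (by fun_prop)
    have h2 : ContinuousOn (fun p : ℝ × (ℂ × Y) => t / ‖p.2.1 - a‖)
        (Set.Icc 0 1 ×ˢ (C ×ˢ Set.univ)) :=
      hcont.comp (f := fun p : ℝ × (ℂ × Y) => p.2) (by fun_prop) fun p hp =>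
        ⟨hC hp.2.1, trivial⟩
    refine continuousOn_const.add ((Complex.continuous_ofReal.comp_continuousOn ?_).mul
      (by fun_prop))
    exact ((by fun_prop : ContinuousOn (fun p : ℝ × (ℂ × Y) => 1 - p.1) _).mul h2).add
      (by fun_prop)
  · rintro s hs y hy
    refine ⟨hconv s hs y.1 hy.1 _ rfl _ ?_, trivial⟩
    have hp := hne y.1 (hC hy.1)
    have h1 : 0 ≤ 1 - s := sub_nonneg.2 hs.2
    rw [add_sub_cancel_left, norm_mul, Complex.norm_real, Real.norm_of_nonneg
      (add_nonneg (by positivity) hs.1), add_mul, mul_assoc, div_mul_cancel₀ _ hp.ne']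
  · intro y hy
    simp
  · intro y hy
    simp

/-- Classes near a puncture extend to the whole plane minus two points. -/
theorem res_nbhd_surjective (hδ : 0 < δ) (h1 : δ ≤ 1 / 2) (c : Fin 3) :
    Function.Surjective (cohomologyRes k A (prod_subset (nbhd_subset hδ h1 c) (Y := Y))) := by
  have hδ' : 0 < δ⁻¹ := inv_pos.2 hδ
  fin_cases c
  · refine circle_retract (a := 0) (t := δ / 2) (by linarith) (nbhd_subset hδ h1 0)
      (by simp [plane]) ?_ ?_
    · intro z hz
      rw [sub_zero] at hz
      exact ⟨by linarith, by linarith⟩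
    · rintro s ⟨hs0, hs1⟩ z ⟨hz, hz'⟩ r rfl w hw
      rw [sub_zero] at hw
      rw [sub_zero] at hw
      constructor
      · rw [hw]; rcases hs0.eq_or_lt with rfl | hs0
        · linarith
        · nlinarith
      · rw [hw]; nlinarith
  · refine circle_retract (a := 1) (t := δ / 2) (by linarith) (nbhd_subset hδ h1 1)
      (by simp [plane]) ?_ ?_
    · intro z hz
      exact ⟨by linarith, by linarith⟩
    · rintro s ⟨hs0, hs1⟩ z ⟨hz, hz'⟩ r rfl w hw
      constructor
      · rw [hw]; rcases hs0.eq_or_lt with rfl | hs0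
        · linarith
        · nlinarith
      · rw [hw]; nlinarith
  · refine circle_retract (a := 0) (t := δ⁻¹ + 1) (by linarith) (nbhd_subset hδ h1 2)
      (by simp [plane]) ?_ ?_
    · intro z hz
      rw [sub_zero] at hz
      change δ⁻¹ < ‖z‖
      linarith
    · rintro s ⟨hs0, hs1⟩ z hz r rfl w hw
      have hz : δ⁻¹ < ‖z‖ := hz
      rw [sub_zero] at hw
      rw [sub_zero] at hw
      change δ⁻¹ < ‖w‖
      rw [hw]
      rcases hs0.eq_or_lt with rfl | hs0
      · linarith
      · nlinarith

/-- Overlapping half planes, each without the puncture it contains. -/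
def half (b : Bool) : Set ℂ :=
  if b then {z | z.re < 2 / 3 ∧ z ≠ 0} else {z | 1 / 3 < z.re ∧ z ≠ 1}

omit [TopologicalSpace Y] in
theorem half_union : (half true ×ˢ Set.univ ∪ half false ×ˢ Set.univ : Set (ℂ × Y)) =
    plane ×ˢ Set.univ := by
  rw [← Set.union_prod]
  congr 1
  ext z
  simp only [half, plane, if_true, Set.mem_union, Set.mem_ofPred_eq, Bool.false_eq_true, if_false]
  constructor
  · rintro (⟨h, h'⟩ | ⟨h, h'⟩)
    · refine ⟨h', ?_⟩
      rintro rfl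
      norm_num at h
    · refine ⟨?_, h'⟩
      rintro rfl
      norm_num at h
  · rintro ⟨h, h'⟩
    rcases lt_or_ge z.re (2 / 3) with h2 | h2
    · exact Or.inl ⟨h2, h⟩
    · exact Or.inr ⟨by linarith, h'⟩

/-- A class on the product of the plane minus two points with `Y` which vanishes near the punctures
`c` and `c'` is zero. -/
def Detects (k : ℕ) (A : Type) [AddCommGroup A] (Y : Type) [TopologicalSpace Y] (c c' : Fin 3) :
    Prop :=
  ∀ δ : ℝ, ∀ (h0 : 0 < δ) (h1 : δ ≤ 1 / 2),
    ∀ a : cohomologyOf k A (plane ×ˢ Set.univ : Set (ℂ × Y)),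
      cohomologyRes k A (prod_subset (nbhd_subset h0 h1 c)) a = 0 →
      cohomologyRes k A (prod_subset (nbhd_subset h0 h1 c')) a = 0 → a = 0

theorem eq_zero_of_radial {T : Set ℂ} {v : ℂ} (h0 : 0 < δ)
    (hT : ∀ z ∈ T, ∀ c ∈ Set.Icc (0 : ℝ) 1, δ / 2 ≤ c * ‖z - v‖ → v + c • (z - v) ∈ T)
    {N : Set ℂ} (hN : N ⊆ T) (hTN : ∀ z ∈ T, dist z v < δ → z ∈ N)
    (a : cohomologyOf k A (T ×ˢ Set.univ : Set (ℂ × Y)))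
    (ha : cohomologyRes k A (prod_subset hN) a = 0) : a = 0 := by
  have hinj := (cohomologyRes_bijective_of_radial (k := k) (A := A)
    (T := (T ×ˢ Set.univ : Set (ℂ × Y))) v (m := δ / 2) (ε := δ) (by linarith) (by linarith)
    (fun y hy c hc hm => ⟨hT y.1 hy.1 c hc hm, trivial⟩) (fun y hy => hy.1)).1
  refine hinj ?_
  have hsub : {y : ℂ × Y | y ∈ (T ×ˢ Set.univ : Set (ℂ × Y)) ∧ dist y.1 v < δ} ⊆
      N ×ˢ Set.univ := fun y hy => ⟨hTN y.1 hy.1.1 hy.2, trivial⟩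
  rw [map_zero, ← cohomologyRes_res hsub (prod_subset hN), ha, map_zero]

/-- The two half planes deformation retract onto neighbourhoods of `0` and `1`, and their
intersection is a contractible strip, all times `Y`. -/
theorem detects_zero_one : Detects (k + 2) A Y 0 1 := by
  intro δ h0 h1 a ha0 ha1
  have hST : SingCochain.RelOpen (half true ×ˢ Set.univ : Set (ℂ × Y))
      (half false ×ˢ Set.univ) := by
    refine ⟨{y | y.1.re < 2 / 3}, {y | 1 / 3 < y.1.re},
      isOpen_lt (by fun_prop) continuous_const, isOpen_lt continuous_const (by fun_prop), ?_, ?_⟩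
    · rw [half_union]
      ext y
      simp only [half, plane, if_true, Set.mem_prod, Set.mem_ofPred_eq, Set.mem_univ, and_true,
        Set.mem_inter_iff]
      refine ⟨fun h => ⟨⟨h.2, fun h' => ?_⟩, h.1⟩, fun h => ⟨h.2, h.1.1⟩⟩
      rw [h'] at h
      norm_num at h
    · rw [half_union]
      ext y
      simp only [half, plane, Bool.false_eq_true, if_false, Set.mem_prod, Set.mem_ofPred_eq,
        Set.mem_univ, and_true, Set.mem_inter_iff]
      refine ⟨fun h => ⟨⟨fun h' => ?_, h.2⟩, h.1⟩, fun h => ⟨h.2, h.1.2⟩⟩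
      rw [h'] at h
      norm_num at h
  have hN0 : nbhd 0 δ ⊆ half true := by
    rintro z ⟨hz, hz'⟩
    refine ⟨?_, norm_pos_iff.1 hz⟩
    have := Complex.re_le_norm z
    linarith
  have hN1 : nbhd 1 δ ⊆ half false := by
    rintro z ⟨hz, hz'⟩
    refine ⟨?_, fun h => by simp [h] at hz⟩
    have := Complex.abs_re_le_norm (z - 1)
    have := abs_le.1 this
    simp at this
    linarith
  have hsurj : Function.Surjective (cohomologyRes (k + 1) A (Set.inter_subset_left :
      (half true ×ˢ Set.univ ∩ half false ×ˢ Set.univ : Set (ℂ × Y)) ⊆ _)) := by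
    refine cohomologyRes_surjective_of_homotopy _ (fun y => (1 / 2, y.2)) (by fun_prop) ?_
      (fun s y => ((1 - s) • (1 / 2 : ℂ) + s • y.1, y.2)) (by fun_prop) ?_ ?_ ?_
    · intro y _
      refine ⟨⟨⟨?_, ?_⟩, trivial⟩, ⟨⟨?_, ?_⟩, trivial⟩⟩ <;> norm_num
    · rintro s ⟨hs0, hs1⟩ y ⟨⟨⟨h1, -⟩, -⟩, ⟨⟨h2, -⟩, -⟩⟩
      have e : ((1 - s) • (1 / 2 : ℂ) + s • y.1).re = (1 - s) * (1 / 2) + s * y.1.re := by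
        simp
      have h3 : ((1 - s) • (1 / 2 : ℂ) + s • y.1).re < 2 / 3 := by rw [e]; nlinarith
      have h4 : 1 / 3 < ((1 - s) • (1 / 2 : ℂ) + s • y.1).re := by rw [e]; nlinarith
      refine ⟨⟨⟨h3, fun h => ?_⟩, trivial⟩, ⟨⟨h4, fun h => ?_⟩, trivial⟩⟩
      · dsimp only at h
        rw [h] at h4
        norm_num at h4
      · dsimp only at h
        rw [h] at h3
        norm_num at h3
    · intro y _
      simp
    · intro y _
      simp
  refine cohomology_eq_zero_of_res hST half_union (half_union.subset.trans' Set.subset_union_left)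
    (half_union.subset.trans' Set.subset_union_right) hsurj a ?_ ?_
  · refine eq_zero_of_radial (v := 0) h0 ?_ hN0 ?_ _ ?_
    · rintro z ⟨hz, hz'⟩ c ⟨hc0, hc1⟩ hm
      rw [zero_add, sub_zero]
      rw [sub_zero] at hm
      refine ⟨?_, ?_⟩
      · rw [Complex.smul_re, smul_eq_mul]
        rcases hc0.eq_or_lt with rfl | hc
        · norm_num
        · nlinarith [mul_lt_mul_of_pos_left hz hc]
      · rw [← norm_pos_iff, norm_smul, Real.norm_of_nonneg hc0]
        linarith
    · rintro z ⟨hz, hz'⟩ hd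
      rw [dist_zero_right] at hd
      exact ⟨norm_pos_iff.2 hz', hd⟩
    · rw [cohomologyRes_res]
      exact ha0
  · refine eq_zero_of_radial (v := 1) h0 ?_ hN1 ?_ _ ?_
    · rintro z ⟨hz, hz'⟩ c ⟨hc0, hc1⟩ hm
      refine ⟨?_, ?_⟩
      · rw [Complex.add_re, Complex.smul_re, smul_eq_mul, Complex.sub_re, Complex.one_re]
        rcases hc0.eq_or_lt with rfl | hc
        · norm_num
        · nlinarith [mul_lt_mul_of_pos_left hz hc]
      · intro h
        have h2 : c • (z - 1) = 0 := by linear_combination h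
        have h3 : c * ‖z - 1‖ = 0 := by
          rw [← Real.norm_of_nonneg hc0, ← norm_smul, h2, norm_zero]
        linarith
    · rintro z ⟨hz, hz'⟩ hd
      rw [dist_eq_norm] at hd
      exact ⟨norm_pos_iff.2 (sub_ne_zero.2 hz'), hd⟩
    · rw [cohomologyRes_res]
      exact ha1

/-- An involution of the plane minus two points transports `Detects`. -/
theorem detects_of_involution {c c' d d' : Fin 3} (h : Detects k A Y c c') (g : ℂ → ℂ)
    (hg : ContinuousOn g plane) (hgp : Set.MapsTo g plane plane)
    (hgg : ∀ z ∈ plane, g (g z) = z)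
    (hd : ∀ δ, 0 < δ → δ ≤ 1 / 2 → Set.MapsTo g (nbhd c (δ / 2)) (nbhd d δ))
    (hd' : ∀ δ, 0 < δ → δ ≤ 1 / 2 → Set.MapsTo g (nbhd c' (δ / 2)) (nbhd d' δ)) :
    Detects k A Y d d' := by
  intro δ h0 h1 a ha ha'
  let f : C((plane ×ˢ Set.univ : Set (ℂ × Y)), (plane ×ˢ Set.univ : Set (ℂ × Y))) :=
    ⟨fun y => ⟨(g y.1.1, y.1.2), hgp y.2.1, trivial⟩, by
      refine Continuous.subtype_mk (Continuous.prodMk ?_ (by fun_prop)) _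
      exact hg.comp_continuous (by fun_prop) fun y => y.2.1⟩
  let G : (plane ×ˢ Set.univ : Set (ℂ × Y)) ≃ₜ (plane ×ˢ Set.univ : Set (ℂ × Y)) :=
    { toFun := f
      invFun := f
      left_inv := fun y => Subtype.ext (Prod.ext (hgg _ y.2.1) rfl)
      right_inv := fun y => Subtype.ext (Prod.ext (hgg _ y.2.1) rfl)
      continuous_toFun := f.continuous
      continuous_invFun := f.continuous }
  obtain ⟨e, he⟩ := exists_cohomology_transfer (k := k) (A := A) G
  have hδ2 : 0 < δ / 2 := by linarith
  have hδ2' : δ / 2 ≤ 1 / 2 := by linarith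
  have key : ∀ b b' : Fin 3, (Set.MapsTo g (nbhd b (δ / 2)) (nbhd b' δ)) →
      cohomologyRes k A (prod_subset (nbhd_subset h0 h1 b')) a = 0 →
      cohomologyRes k A (prod_subset (nbhd_subset hδ2 hδ2' b)) (e a) = 0 := by
    intro b b' hm hz
    have hsub : (g ⁻¹' nbhd b (δ / 2) ∩ plane) ⊆ nbhd b' δ := by
      rintro z ⟨hz, hzp⟩
      have := hm hz
      rwa [hgg z hzp] at this
    obtain ⟨e', he'⟩ := he (nbhd b (δ / 2) ×ˢ Set.univ)
      ((g ⁻¹' nbhd b (δ / 2) ∩ plane) ×ˢ Set.univ)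
      (prod_subset (nbhd_subset hδ2 hδ2' b)) (prod_subset Set.inter_subset_right) (fun y => by
        constructor
        · rintro ⟨hy, -⟩
          refine ⟨⟨?_, hgp y.2.1⟩, trivial⟩
          change g (g y.1.1) ∈ nbhd b (δ / 2)
          rw [hgg _ y.2.1]
          exact hy
        · rintro ⟨⟨hy, -⟩, -⟩
          refine ⟨?_, trivial⟩
          change g (g y.1.1) ∈ nbhd b (δ / 2) at hy
          rwa [hgg _ y.2.1] at hy)
    rw [he', ← cohomologyRes_res (prod_subset hsub) (prod_subset (nbhd_subset h0 h1 b')), hz,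
      map_zero, map_zero]
  have := h (δ / 2) hδ2 hδ2' (e a) (key _ _ (hd δ h0 h1) ha) (key _ _ (hd' δ h0 h1) ha')
  exact (map_eq_zero_iff e e.injective).1 this

theorem detects_zero_infty (h : Detects k A Y 0 1) : Detects k A Y 0 2 := by
  have hne : ∀ z ∈ plane, z - 1 ≠ 0 := fun z hz => sub_ne_zero.2 hz.2
  refine detects_of_involution h (fun z => z / (z - 1)) ?_ ?_ ?_ ?_ ?_
  · exact continuousOn_id.div (by fun_prop) hne
  · intro z hz
    refine ⟨div_ne_zero hz.1 (hne z hz), fun h1 => ?_⟩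
    rw [div_eq_one_iff_eq (hne z hz)] at h1
    have : (0 : ℂ) = 1 := by linear_combination -h1
    exact zero_ne_one this
  · intro z hz
    have h1 := hne z hz
    have h2 : z / (z - 1) - 1 = 1 / (z - 1) := by field_simp; ring
    rw [h2]
    field_simp
  · rintro δ h0 h1 z ⟨hz, hz'⟩
    have h2 : 1 / 2 < ‖z - 1‖ := by
      have := norm_sub_norm_le (1 : ℂ) z
      rw [norm_one, norm_sub_rev] at this
      linarith
    change 0 < ‖z / (z - 1)‖ ∧ ‖z / (z - 1)‖ < δ
    rw [norm_div]
    refine ⟨by positivity, ?_⟩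
    rw [div_lt_iff₀ (by linarith)]
    nlinarith
  · rintro δ h0 h1 z ⟨hz, hz'⟩
    have h2 : 1 / 2 < ‖z‖ := by
      have := norm_sub_norm_le (1 : ℂ) (1 - z)
      rw [norm_one, sub_sub_cancel, norm_sub_rev] at this
      linarith
    change δ⁻¹ < ‖z / (z - 1)‖
    rw [norm_div, lt_div_iff₀ hz, inv_mul_lt_iff₀ h0]
    nlinarith

theorem detects_one_infty (h : Detects k A Y 0 2) : Detects k A Y 1 2 := by
  refine detects_of_involution h (fun z => 1 - z) (by fun_prop) ?_ ?_ ?_ ?_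
  · rintro z ⟨hz, hz'⟩
    exact ⟨sub_ne_zero.2 hz'.symm, fun h => hz (by linear_combination -h)⟩
  · intro z _
    simp
  · rintro δ h0 h1 z ⟨hz, hz'⟩
    change 0 < ‖1 - z - 1‖ ∧ ‖1 - z - 1‖ < δ
    rw [show 1 - z - 1 = -z by ring, norm_neg]
    exact ⟨hz, by linarith⟩
  · rintro δ h0 h1 z hz
    have hz : (δ / 2)⁻¹ < ‖z‖ := hz
    change δ⁻¹ < ‖1 - z‖
    have h2 := norm_sub_norm_le z 1
    rw [norm_one, norm_sub_rev] at h2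
    rw [inv_div, div_eq_mul_inv] at hz
    have : 1 < δ⁻¹ := (one_lt_inv₀ h0).2 (by linarith)
    linarith

theorem detects {c c' : Fin 3} (hc : c ≠ c') : Detects (k + 2) A Y c c' := by
  have h01 := detects_zero_one (k := k) (A := A) (Y := Y)
  have h02 := detects_zero_infty h01
  have h12 := detects_one_infty h02
  have hsymm : ∀ {c c' : Fin 3}, Detects (k + 2) A Y c c' → Detects (k + 2) A Y c' c :=
    fun h δ h0 h1 a ha ha' => h δ h0 h1 a ha' ha
  fin_cases c <;> fin_cases c' <;>
    first | exact absurd rfl hc | assumption | (apply hsymm; assumption)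

end PuncturedPlane

/-! ### Ends of the plane minus two points -/

theorem IsPreconnected.exists_subset_of_subset_iUnion {Z ι : Type} [TopologicalSpace Z]
    {S : Set Z} (hS : IsPreconnected S) (hne : S.Nonempty) {U : ι → Set Z}
    (hU : ∀ i, IsOpen (U i)) (hd : ∀ i j, i ≠ j → Disjoint (U i) (U j)) (h : S ⊆ ⋃ i, U i) :
    ∃ i, S ⊆ U i := by
  obtain ⟨x, hx⟩ := hne
  obtain ⟨i, hi⟩ := Set.mem_iUnion.1 (h hx)
  refine ⟨i, hS.subset_left_of_subset_union (hU i)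
    (isOpen_iUnion fun j => isOpen_iUnion fun _ : j ≠ i => hU j) ?_ ?_ ⟨x, hx, hi⟩⟩
  · rw [Set.disjoint_iUnion_right]
    intro j
    rw [Set.disjoint_iUnion_right]
    intro hj
    exact hd i j hj.symm
  · intro y hy
    obtain ⟨j, hj⟩ := Set.mem_iUnion.1 (h hy)
    by_cases hij : j = i
    · subst hij; exact Or.inl hj
    · exact Or.inr (Set.mem_iUnion.2 ⟨j, Set.mem_iUnion.2 ⟨hij, hj⟩⟩)

namespace PuncturedPlane

theorem isPreconnected_annulus (a : ℂ) {I : Set ℝ} (hI : I.OrdConnected) (h0 : ∀ r ∈ I, 0 ≤ r) :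
    IsPreconnected {z : ℂ | ‖z - a‖ ∈ I} := by
  have : {z : ℂ | ‖z - a‖ ∈ I} =
      (fun p : ℝ × ℝ => a + (p.1 : ℂ) * Complex.exp (p.2 * Complex.I)) '' (I ×ˢ Set.univ) := by
    ext z
    constructor
    · intro hz
      refine ⟨(‖z - a‖, Complex.arg (z - a)), ⟨hz, trivial⟩, ?_⟩
      simp only [Complex.norm_mul_exp_arg_mul_I]
      ring
    · rintro ⟨⟨r, t⟩, ⟨hr, -⟩, rfl⟩
      have : ‖a + (r : ℂ) * Complex.exp (t * Complex.I) - a‖ = r := by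
        rw [add_sub_cancel_left, norm_mul, Complex.norm_exp_ofReal_mul_I, mul_one,
          Complex.norm_real, Real.norm_of_nonneg (h0 r hr)]
      change ‖_‖ ∈ I
      rw [this]
      exact hr
  rw [this]
  exact (hI.isPreconnected.prod isPreconnected_univ).image _ (by fun_prop)

variable {δ : ℝ}

theorem isPreconnected_nbhd (hδ : 0 < δ) (c : Fin 3) : IsPreconnected (nbhd c δ) := by
  fin_cases c
  · have := isPreconnected_annulus 0 (I := Set.Ioo 0 δ) Set.ordConnected_Ioo fun r hr => hr.1.le
    simpa [nbhd] using this
  · exact isPreconnected_annulus 1 (I := Set.Ioo 0 δ) Set.ordConnected_Ioo fun r hr => hr.1.le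
  · have := isPreconnected_annulus 0 (I := Set.Ioi δ⁻¹) Set.ordConnected_Ioi
      fun r hr => (inv_pos.2 hδ).le.trans (le_of_lt hr)
    simpa [nbhd] using this

theorem isOpen_nbhd (c : Fin 3) : IsOpen (nbhd c δ) := by
  fin_cases c
  · exact (isOpen_lt continuous_const continuous_norm).inter
      (isOpen_lt continuous_norm continuous_const)
  · exact (isOpen_lt continuous_const (continuous_id.sub continuous_const).norm).inter
      (isOpen_lt (continuous_id.sub continuous_const).norm continuous_const)
  · exact isOpen_lt continuous_const continuous_norm

theorem nbhd_nonempty (hδ : 0 < δ) (c : Fin 3) : (nbhd c δ).Nonempty := by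
  fin_cases c
  · refine ⟨((δ / 2 : ℝ) : ℂ), ?_⟩
    change 0 < ‖((δ / 2 : ℝ) : ℂ)‖ ∧ ‖((δ / 2 : ℝ) : ℂ)‖ < δ
    rw [Complex.norm_real, Real.norm_of_nonneg (by linarith)]
    constructor <;> linarith
  · refine ⟨1 + ((δ / 2 : ℝ) : ℂ), ?_⟩
    change 0 < ‖1 + ((δ / 2 : ℝ) : ℂ) - 1‖ ∧ ‖1 + ((δ / 2 : ℝ) : ℂ) - 1‖ < δ
    rw [add_sub_cancel_left, Complex.norm_real, Real.norm_of_nonneg (by linarith)]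
    constructor <;> linarith
  · refine ⟨((δ⁻¹ + 1 : ℝ) : ℂ), ?_⟩
    have : 0 < δ⁻¹ := inv_pos.2 hδ
    change δ⁻¹ < ‖((δ⁻¹ + 1 : ℝ) : ℂ)‖
    rw [Complex.norm_real, Real.norm_of_nonneg (by linarith)]
    linarith

theorem nbhd_disjoint (hδ : 0 < δ) (h1 : δ ≤ 1 / 2) {c c' : Fin 3} (hc : c ≠ c') :
    Disjoint (nbhd c δ) (nbhd c' δ) := by
  have h01 : Disjoint (nbhd 0 δ) (nbhd 1 δ) := by
    rw [Set.disjoint_left]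
    rintro z ⟨-, hz⟩ ⟨-, hz'⟩
    have := norm_sub_norm_le (1 : ℂ) (1 - z)
    rw [norm_one, sub_sub_cancel, norm_sub_rev] at this
    linarith
  have h2 : 2 ≤ δ⁻¹ := by
    rw [le_inv_comm₀ (by norm_num) hδ]
    linarith
  have h02 : Disjoint (nbhd 0 δ) (nbhd 2 δ) := by
    rw [Set.disjoint_left]
    rintro z ⟨-, hz⟩ hz'
    have hz' : δ⁻¹ < ‖z‖ := hz'
    linarith
  have h12 : Disjoint (nbhd 1 δ) (nbhd 2 δ) := by
    rw [Set.disjoint_left]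
    rintro z ⟨-, hz⟩ hz'
    have hz' : δ⁻¹ < ‖z‖ := hz'
    have := norm_sub_norm_le z 1
    rw [norm_one] at this
    linarith
  fin_cases c <;> fin_cases c' <;>
    first | exact absurd rfl hc | assumption | (apply Disjoint.symm; assumption)

theorem exists_nbhd_disjoint {K : Set ℂ} (hK : IsCompact K) (hKp : K ⊆ plane) :
    ∃ δ, 0 < δ ∧ δ ≤ 1 / 2 ∧ ∀ c, Disjoint (nbhd c δ) K := by
  obtain ⟨C, hC⟩ := hK.isBounded.exists_norm_le
  have hpos : ∀ a : ℂ, a ∉ K → ∃ δ > 0, ∀ z ∈ K, δ ≤ ‖z - a‖ := by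
    intro a ha
    obtain ⟨δ, hδ, h⟩ := Metric.isOpen_iff.1 hK.isClosed.isOpen_compl a ha
    refine ⟨δ, hδ, fun z hz => ?_⟩
    by_contra hlt
    refine h (show z ∈ Metric.ball a δ from ?_) hz
    rw [Metric.mem_ball, dist_eq_norm]
    exact not_le.1 hlt
  obtain ⟨d0, hd0, h0⟩ := hpos 0 fun h => (hKp h).1 rfl
  obtain ⟨d1, hd1, h1⟩ := hpos 1 fun h => (hKp h).2 rfl
  have hC' : 0 < (|C| + 1)⁻¹ := by positivity
  have hm : 0 < min (min d0 d1) (min (|C| + 1)⁻¹ (1 / 2)) := by positivity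
  refine ⟨min (min d0 d1) (min (|C| + 1)⁻¹ (1 / 2)), hm,
    (min_le_right _ _).trans (min_le_right _ _), fun c => ?_⟩
  rw [Set.disjoint_left]
  intro z hz hzK
  fin_cases c
  · have := h0 z hzK
    rw [sub_zero] at this
    exact absurd (hz.2.trans_le ((min_le_left _ _).trans (min_le_left _ _))) (not_lt.2 this)
  · exact absurd (hz.2.trans_le ((min_le_left _ _).trans (min_le_right _ _)))
      (not_lt.2 (h1 z hzK))
  · have hz : (min (min d0 d1) (min (|C| + 1)⁻¹ (1 / 2)))⁻¹ < ‖z‖ := hz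
    have h2 : |C| + 1 ≤ (min (min d0 d1) (min (|C| + 1)⁻¹ (1 / 2)))⁻¹ := by
      rw [le_inv_comm₀ (by positivity) hm]
      exact (min_le_right _ _).trans (min_le_left _ _)
    have := hC z hzK
    have := le_abs_self C
    linarith

/-- The complement of the neighbourhoods of the punctures is compact. -/
theorem isCompact_core (hδ : 0 < δ) : IsCompact (plane \ ⋃ c, nbhd c δ) := by
  have : plane \ ⋃ c, nbhd c δ =
      Metric.closedBall 0 δ⁻¹ ∩ ({z | δ ≤ ‖z‖} ∩ {z | δ ≤ ‖z - 1‖}) := by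
    ext z
    simp only [Set.mem_sdiff, Set.mem_iUnion, not_exists, Fin.forall_fin_succ, Set.mem_inter_iff,
      mem_closedBall_zero_iff, Set.mem_ofPred_eq]
    simp only [plane, nbhd, Set.mem_ofPred_eq]
    constructor
    · rintro ⟨⟨h0, h1⟩, ha, hb, hc, -⟩
      have ha : ¬ (0 < ‖z‖ ∧ ‖z‖ < δ) := ha
      have hb : ¬ (0 < ‖z - 1‖ ∧ ‖z - 1‖ < δ) := hb
      have hc : ¬ (δ⁻¹ < ‖z‖) := hc
      exact ⟨not_lt.1 hc, not_lt.1 fun h => ha ⟨norm_pos_iff.2 h0, h⟩,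
        not_lt.1 fun h => hb ⟨norm_pos_iff.2 (sub_ne_zero.2 h1), h⟩⟩
    · rintro ⟨hc, ha, hb⟩
      refine ⟨⟨?_, ?_⟩, fun h => not_lt.2 ha h.2, fun h => not_lt.2 hb h.2, not_lt.2 hc,
        fun i => i.elim0⟩
      · rw [← norm_pos_iff]; linarith
      · rw [← sub_ne_zero, ← norm_pos_iff]; linarith
  rw [this]
  refine (isCompact_closedBall _ _).inter_right (IsClosed.inter ?_ ?_)
  · exact isClosed_le continuous_const continuous_norm
  · exact isClosed_le continuous_const (by fun_prop)

/-- Let `E i R`, for `i = 0, 1, 2`, be neighbourhoods of three ends of a space homeomorphic to the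
plane minus two points, shrinking to infinity as `R → ∞`. Then the homeomorphism matches them with
the three punctures: near a puncture it maps into some `E i m`, and conversely, because both kinds of
neighbourhoods are connected and have compact complements. -/
theorem exists_end_matching {Z : Type} [TopologicalSpace Z] (h : Z ≃ₜ plane) {m : ℝ}
    (E : Fin 3 → ℝ → Set Z) (hanti : ∀ i, ∀ R ≥ m, E i R ⊆ E i m)
    (hopen : ∀ i, ∀ R ≥ m, IsOpen (E i R)) (hdisj : ∀ i j, i ≠ j → Disjoint (E i m) (E j m))
    (hconn : ∀ i, ∀ R ≥ m, IsPreconnected (E i R)) (hne : ∀ i, ∀ R ≥ m, (E i R).Nonempty)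
    (hcompact : IsCompact (⋃ i, E i m)ᶜ)
    (hproper : ∀ K : Set Z, IsCompact K → ∃ R ≥ m, ∀ i, Disjoint (E i R) K) :
    ∃ c : Fin 3 → Fin 3, Function.Injective c ∧ ∃ δ, 0 < δ ∧ δ ≤ 1 / 2 ∧ ∃ R ≥ m, ∀ i,
      (∀ x, (h x : ℂ) ∈ nbhd (c i) δ → x ∈ E i m) ∧ ∀ x ∈ E i R, (h x : ℂ) ∈ nbhd (c i) δ := by
  have hcont : Continuous fun x => (h x : ℂ) := continuous_subtype_val.comp h.continuous
  obtain ⟨δ, hδ, hδ1, hK⟩ := exists_nbhd_disjoint (hcompact.image hcont) (by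
    rintro _ ⟨x, -, rfl⟩
    exact (h x).2)
  have hpre : ∀ c, ∃ i, ∀ x, (h x : ℂ) ∈ nbhd c δ → x ∈ E i m := by
    intro c
    have himg : (fun x => (h x : ℂ)) ⁻¹' nbhd c δ =
        h.symm '' (Subtype.val ⁻¹' nbhd c δ) := by
      ext x
      constructor
      · intro hx
        exact ⟨h x, hx, h.symm_apply_apply x⟩
      · rintro ⟨z, hz, rfl⟩
        change (h (h.symm z) : ℂ) ∈ nbhd c δ
        rw [h.apply_symm_apply]
        exact hz
    have hsub := nbhd_subset hδ hδ1 c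
    have h1 : IsPreconnected ((fun x => (h x : ℂ)) ⁻¹' nbhd c δ) := by
      rw [himg]
      refine IsPreconnected.image ?_ _ h.symm.continuous.continuousOn
      rw [← Topology.IsInducing.subtypeVal.isPreconnected_image, Subtype.image_preimage_coe,
        Set.inter_eq_right.2 hsub]
      exact isPreconnected_nbhd hδ c
    obtain ⟨z, hz⟩ := nbhd_nonempty hδ c
    obtain ⟨i, hi⟩ := h1.exists_subset_of_subset_iUnion
      ⟨h.symm ⟨z, hsub hz⟩, by simpa using hz⟩ (fun i => hopen i m le_rfl) hdisj (by
        intro x hx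
        by_contra hx'
        exact Set.disjoint_left.1 (hK c) hx ⟨x, hx', rfl⟩)
    exact ⟨i, fun x hx => hi hx⟩
  choose i hi using hpre
  obtain ⟨R, hR, hRd⟩ := hproper ((fun x => (h x : ℂ)) ⁻¹' (plane \ ⋃ c, nbhd c δ)) (by
    have := (isCompact_core hδ)
    have h2 : (fun x => (h x : ℂ)) ⁻¹' (plane \ ⋃ c, nbhd c δ) =
        h ⁻¹' (Subtype.val ⁻¹' (plane \ ⋃ c, nbhd c δ)) := rfl
    rw [h2, h.isCompact_preimage, Subtype.isCompact_iff, Subtype.image_preimage_coe,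
      Set.inter_eq_right.2 Set.sdiff_subset]
    exact this)
  have hpost : ∀ j, ∃ c, ∀ x ∈ E j R, (h x : ℂ) ∈ nbhd c δ := by
    intro j
    obtain ⟨c, hc⟩ := ((hconn j R hR).image (fun x => (h x : ℂ)) hcont.continuousOn
      ).exists_subset_of_subset_iUnion ((hne j R hR).image _) (fun c => isOpen_nbhd (δ := δ) c)
      (fun c c' h => nbhd_disjoint hδ hδ1 h) (by
        rintro _ ⟨x, hx, rfl⟩
        by_contra hx'
        exact Set.disjoint_left.1 (hRd j) hx ⟨(h x).2, hx'⟩)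
    exact ⟨c, fun x hx => hc ⟨x, hx, rfl⟩⟩
  choose c hc using hpost
  have hic : ∀ j, i (c j) = j := by
    intro j
    obtain ⟨x, hx⟩ := hne j R hR
    by_contra hne
    exact Set.disjoint_left.1 (hdisj _ _ hne) (hi _ x (hc j x hx)) (hanti j R hR hx)
  refine ⟨c, Function.LeftInverse.injective hic, δ, hδ, hδ1, R, hR, fun j => ⟨fun x hx => ?_, hc j⟩⟩
  have := hi (c j) x hx
  rwa [hic] at this

end PuncturedPlane

/-! ### One-dimensional convex sets -/

section Line

variable {E : Type} [NormedAddCommGroup E] [NormedSpace ℝ E]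

/-- `e` is contained in the ray from `v` in the direction of the unit vector `u`, and contains an
initial segment of this ray. -/
structure EmanatesFrom (e : Set E) (v u : E) : Prop where
  convex : Convex ℝ e
  norm_eq_one : ‖u‖ = 1
  mem : v ∈ e
  eq_add_smul : ∀ q ∈ e, q = v + dist q v • u
  exists_pos : ∃ t : ℝ, 0 < t ∧ v + t • u ∈ e

theorem dist_add_smul {u : E} (hu : ‖u‖ = 1) (v : E) {t : ℝ} (ht : 0 ≤ t) :
    dist (v + t • u) v = t := by
  rw [dist_eq_norm, add_sub_cancel_left, norm_smul, hu, mul_one, Real.norm_of_nonneg ht]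

theorem exists_emanatesFrom {e : Set E} (hc : Convex ℝ e)
    (h1 : Module.finrank ℝ (vectorSpan ℝ e) = 1) {v : E} (hv : v ∈ e.extremePoints ℝ) :
    ∃ u, EmanatesFrom e v u := by
  obtain ⟨q₀, hq₀, hne⟩ : ∃ q ∈ e, q ≠ v := by
    by_contra! h
    have : e ⊆ {v} := fun q hq => h q hq
    rw [vectorSpan_of_subsingleton ℝ (Set.subsingleton_singleton.anti this)] at h1
    simp at h1
  have hpos : 0 < ‖q₀ - v‖ := norm_pos_iff.2 (sub_ne_zero.2 hne)
  have hmem : ∀ q ∈ e, q - v ∈ vectorSpan ℝ e := fun q hq =>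
    vsub_mem_vectorSpan ℝ hq hv.1
  refine ⟨‖q₀ - v‖⁻¹ • (q₀ - v), hc, ?_, hv.1, fun q hq => ?_, ‖q₀ - v‖, hpos, ?_⟩
  · rw [norm_smul, norm_inv, norm_norm, inv_mul_cancel₀ hpos.ne']
  · obtain ⟨s, hs⟩ := (finrank_eq_one_iff_of_nonzero' (⟨q₀ - v, hmem _ hq₀⟩ : vectorSpan ℝ e) (by
      intro h
      exact hpos.ne' (norm_eq_zero.2 (congrArg Subtype.val h)))).1 h1 ⟨q - v, hmem q hq⟩
    have hs : s • (q₀ - v) = q - v := congrArg Subtype.val hs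
    have hs0 : 0 ≤ s := by
      by_contra! hlt
      refine hne (hv.2 hq₀ hq ?_)
      refine ⟨-s / (1 - s), 1 / (1 - s), div_pos (by linarith) (by linarith),
        div_pos one_pos (by linarith), ?_, ?_⟩
      · rw [← add_div, div_eq_one_iff_eq (by linarith)]
        ring
      · have hq' : q = v + s • (q₀ - v) := by rw [hs]; abel
        have hs1 : 1 - s ≠ 0 := by linarith
        rw [hq']
        match_scalars <;> field_simp <;> ring
    rw [dist_eq_norm, ← hs, norm_smul, Real.norm_of_nonneg hs0, smul_smul, mul_assoc,
      mul_inv_cancel₀ hpos.ne', mul_one, hs]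
    abel
  · rw [smul_smul, mul_inv_cancel₀ hpos.ne', one_smul, add_sub_cancel]
    exact hq₀

namespace EmanatesFrom

variable {e e' : Set E} {v u u' : E}

theorem add_smul_mem (h : EmanatesFrom e v u) {q : E} (hq : q ∈ e) {t : ℝ} (ht : 0 ≤ t)
    (htq : t ≤ dist q v) : v + t • u ∈ e := by
  rcases (dist_nonneg (x := q) (y := v)).eq_or_lt with h0 | h0
  · rw [le_antisymm (htq.trans_eq h0.symm) ht, zero_smul, add_zero]
    exact h.mem
  · have := h.convex.add_smul_sub_mem h.mem hq (t := t / dist q v)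
      ⟨by positivity, (div_le_one h0).2 htq⟩
    rwa [sub_eq_of_eq_add' (h.eq_add_smul q hq), smul_smul, div_mul_cancel₀ _ h0.ne'] at this

theorem vectorSpan_eq (h : EmanatesFrom e v u) : vectorSpan ℝ e = ℝ ∙ u := by
  rw [vectorSpan_eq_span_vsub_set_right ℝ h.mem]
  apply le_antisymm
  · rw [Submodule.span_le]
    rintro _ ⟨q, hq, rfl⟩
    rw [h.eq_add_smul q hq]
    simp only [vsub_eq_sub, add_sub_cancel_left]
    exact Submodule.smul_mem _ _ (Submodule.mem_span_singleton_self u)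
  · rw [Submodule.span_singleton_le_iff_mem]
    obtain ⟨t, ht, hm⟩ := h.exists_pos
    have : t • u ∈ Submodule.span ℝ ((· -ᵥ v) '' e) :=
      Submodule.subset_span ⟨_, hm, by simp⟩
    exact (Submodule.smul_mem_iff _ ht.ne').1 this

/-- Two such sets with the same direction overlap in more than the point `v`. -/
theorem exists_mem_inter (h : EmanatesFrom e v u) (h' : EmanatesFrom e' v u) :
    ∃ q ∈ e ∩ e', q ≠ v := by
  obtain ⟨t, ht, hm⟩ := h.exists_pos
  obtain ⟨t', ht', hm'⟩ := h'.exists_pos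
  have hp : 0 < min t t' := lt_min ht ht'
  refine ⟨v + min t t' • u, ⟨h.add_smul_mem hm hp.le ?_, h'.add_smul_mem hm' hp.le ?_⟩, ?_⟩
  · rw [dist_add_smul h.norm_eq_one _ ht.le]; exact min_le_left _ _
  · rw [dist_add_smul h.norm_eq_one _ ht'.le]; exact min_le_right _ _
  · rw [← dist_pos, dist_add_smul h.norm_eq_one _ hp.le]; exact hp

theorem mem_extremePoints (h : EmanatesFrom e v u) {q : E} (hq : q ∈ e)
    (hmax : ∀ q' ∈ e, dist q' v ≤ dist q v) : q ∈ e.extremePoints ℝ := by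
  refine ⟨hq, ?_⟩
  rintro x hx y hy ⟨a, b, ha, hb, hab, hxy⟩
  have h1 : dist q v = a * dist x v + b * dist y v := by
    rw [h.eq_add_smul x hx, h.eq_add_smul y hy] at hxy
    have : q = v + (a * dist x v + b * dist y v) • u := by
      rw [← hxy]
      have : a • v + b • v = v := by rw [← add_smul, hab, one_smul]
      generalize dist x v = s, dist y v = t
      rw [smul_add, smul_add, add_add_add_comm, this]
      module
    rw [this]
    exact dist_add_smul h.norm_eq_one _ (by positivity)
  have h2 : dist x v = dist q v := by
    have := hmax x hx
    have := hmax y hy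
    have h3 : b * dist y v ≤ b * dist q v := by gcongr
    have h4 : a * dist q v ≤ a * dist x v := by
      have : dist q v = a * dist q v + b * dist q v := by rw [← add_mul, hab, one_mul]
      linarith
    exact le_antisymm ‹_› (le_of_mul_le_mul_left h4 ha)
  rw [h.eq_add_smul x hx, h.eq_add_smul q hq, h2]

/-- The only extreme point apart from `v` is the point farthest from `v`. -/
theorem dist_le_of_mem_extremePoints (h : EmanatesFrom e v u) {w : E}
    (hw : w ∈ e.extremePoints ℝ) (hwv : w ≠ v) {q : E} (hq : q ∈ e) : dist q v ≤ dist w v := by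
  by_contra! hlt
  have hpos := dist_pos.2 hwv
  refine hwv (hw.2 h.mem hq ?_).symm
  refine ⟨1 - dist w v / dist q v, dist w v / dist q v, ?_, div_pos hpos (hpos.trans hlt),
    by ring, ?_⟩
  · rw [sub_pos, div_lt_one (hpos.trans hlt)]
    exact hlt
  · conv_lhs => rw [h.eq_add_smul q hq, dist_add_smul h.norm_eq_one _ dist_nonneg]
    conv_rhs => rw [h.eq_add_smul w hw.1]
    have := (hpos.trans hlt).ne'
    match_scalars
    · field_simp
      ring
    · field_simp

theorem convex_inter (h : EmanatesFrom e v u) {I : Set ℝ} (hI : I.OrdConnected) :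
    Convex ℝ {q | q ∈ e ∧ dist q v ∈ I} := by
  have : {q | q ∈ e ∧ dist q v ∈ I} =
      e ∩ (fun t : ℝ => v + t • u) '' (I ∩ Set.Ici 0) := by
    ext q
    constructor
    · rintro ⟨hq, hI⟩
      exact ⟨hq, dist q v, ⟨hI, dist_nonneg⟩, (h.eq_add_smul q hq).symm⟩
    · rintro ⟨hq, t, ⟨ht, ht0⟩, rfl⟩
      refine ⟨hq, ?_⟩
      rwa [dist_add_smul h.norm_eq_one _ ht0]
  rw [this]
  refine h.convex.inter ?_
  have hcI : Convex ℝ (I ∩ Set.Ici 0) := (hI.inter Set.ordConnected_Ici).convex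
  have h2 : (fun t : ℝ => v + t • u) '' (I ∩ Set.Ici 0) =
      (fun x => v + x) '' ((LinearMap.toSpanSingleton ℝ E u) '' (I ∩ Set.Ici 0)) := by
    rw [Set.image_image]
    rfl
  rw [h2]
  exact (hcI.linear_image _).translate v

end EmanatesFrom

theorem finite_extremePoints {e : Set E} (hc : Convex ℝ e)
    (h1 : Module.finrank ℝ (vectorSpan ℝ e) = 1) : (e.extremePoints ℝ).Finite := by
  rcases (e.extremePoints ℝ).eq_empty_or_nonempty with h | ⟨v, hv⟩
  · rw [h]; exact Set.finite_empty
  obtain ⟨u, hu⟩ := exists_emanatesFrom hc h1 hv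
  have : (e.extremePoints ℝ \ {v}).Subsingleton := by
    rintro w ⟨hw, hwv⟩ w' ⟨hw', hwv'⟩
    rw [hu.eq_add_smul w hw.1, hu.eq_add_smul w' hw'.1,
      le_antisymm (hu.dist_le_of_mem_extremePoints hw' hwv' hw.1)
        (hu.dist_le_of_mem_extremePoints hw hwv hw'.1)]
  exact (this.finite.union (Set.finite_singleton v)).subset fun w hw => by
    by_cases h : w = v
    · exact Or.inr h
    · exact Or.inl ⟨hw, h⟩

/-- A closed convex set `e` which near `v` lies in the union of finitely many rays from `v`, and
has no extreme points near `v` other than `v`, contains `v` if it comes near `v`: otherwise the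
point of `e` closest to `v` would be extreme. -/
theorem mem_of_subset_rays [ProperSpace E] {e : Set E} (hclosed : IsClosed e)
    {v : E} {ε : ℝ} {ι : Type} [Finite ι] (u : ι → E) (hu : ∀ i, ‖u i‖ = 1)
    (hui : Function.Injective u)
    (hsub : ∀ q ∈ e, dist q v < ε → ∃ i, q = v + dist q v • u i)
    (hext : ∀ q ∈ e.extremePoints ℝ, dist q v < ε → q = v) (hne : ∃ q ∈ e, dist q v < ε)
    (hc : Convex ℝ e) : v ∈ e := by
  by_contra hv
  obtain ⟨q₁, hq₁, hq₁ε⟩ := hne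
  obtain ⟨q, hq, hmin⟩ := hclosed.exists_infDist_eq_dist ⟨q₁, hq₁⟩ v
  have hmin : ∀ x ∈ e, dist q v ≤ dist x v := fun x hx => by
    rw [dist_comm q v, ← hmin, dist_comm x v]
    exact Metric.infDist_le_dist_of_mem hx
  have hqv : q ≠ v := fun h => hv (h ▸ hq)
  have hqε := (hmin q₁ hq₁).trans_lt hq₁ε
  refine hqv (hext q ⟨hq, ?_⟩ hqε)
  rintro x hx y hy hxy
  have hpos : 0 < dist q v := dist_pos.2 hqv
  obtain ⟨i, hi⟩ := hsub q hq hqε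
  -- points of `e` near `q` lie on the same ray as `q`
  have hnear : ∀ᶠ z in nhds q, z ∈ e → z = v + dist z v • u i := by
    have h1 : ∀ᶠ z in nhds q, dist z v < ε :=
      (continuous_id.dist continuous_const).continuousAt.eventually_lt continuousAt_const hqε
    have h2 : ∀ᶠ z in nhds q, ∀ j, z = v + dist z v • u j → j = i := by
      rw [Filter.eventually_all]
      intro j
      by_cases hj : j = i
      · exact Filter.Eventually.of_forall fun _ _ => hj
      · have : IsClosed {z : E | z = v + dist z v • u j} := isClosed_eq continuous_id (by fun_prop)
        filter_upwards [this.isOpen_compl.mem_nhds (x := q) (by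
          intro h
          have h : q = v + dist q v • u j := h
          rw [hi] at h
          have h := add_left_cancel h
          rw [← hi] at h
          exact hj (hui (smul_right_injective E hpos.ne' h)).symm)] with z hz h
        exact absurd h hz
    filter_upwards [h1, h2] with z hz1 hz2 hz
    obtain ⟨j, hj⟩ := hsub z hz hz1
    have := hz2 j hj
    rwa [this] at hj
  obtain ⟨a, b, ha, hb, hab, hxy⟩ := hxy
  have hcont : Continuous fun s : ℝ => q + s • (y - x) := by fun_prop
  have h0 : Filter.Tendsto (fun s : ℝ => q + s • (y - x)) (nhds 0) (nhds q) := by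
    have := hcont.tendsto 0
    simpa using this
  have h0' : Filter.Tendsto (fun s : ℝ => q + (-s) • (y - x)) (nhds 0) (nhds q) := by
    have h : Continuous fun s : ℝ => q + (-s) • (y - x) := by fun_prop
    have := h.tendsto 0
    rwa [neg_zero, zero_smul, add_zero] at this
  have hmem : ∀ᶠ s : ℝ in nhds 0, q + s • (y - x) ∈ e := by
    filter_upwards [Ioo_mem_nhds (neg_lt_zero.2 hb) ha] with s hs
    have := hc hx hy (a := a - s) (b := b + s) (by linarith [hs.2]) (by linarith [hs.1])
      (by linarith)
    convert this using 1
    rw [← hxy]; module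
  have hmem' : ∀ᶠ s : ℝ in nhds 0, q + (-s) • (y - x) ∈ e := by
    filter_upwards [Ioo_mem_nhds (neg_lt_zero.2 ha) hb] with s hs
    have := hc hx hy (a := a + s) (b := b - s) (by linarith [hs.1]) (by linarith [hs.2])
      (by linarith)
    convert this using 1
    rw [← hxy]; module
  have hev := ((h0.eventually hnear).and (h0'.eventually hnear)).and (hmem.and hmem')
  obtain ⟨s, ⟨⟨hs1, hs2⟩, hs3, hs4⟩, hs⟩ :=
    ((hev.filter_mono nhdsWithin_le_nhds).and (self_mem_nhdsWithin (s := Set.Ioi (0:ℝ)))).exists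
  have hs : 0 < s := hs
  have e1 := hs1 hs3
  have e2 := hs2 hs4
  have m1 := hmin _ hs3
  have m2 := hmin _ hs4
  generalize hd1 : dist (q + s • (y - x)) v = d1 at e1 m1
  generalize hd2 : dist (q + (-s) • (y - x)) v = d2 at e2 m2
  have hsum : (d1 + d2) • u i = (2 * dist q v) • u i := by
    have h3 : (q + s • (y - x)) + (q + (-s) • (y - x)) = 2 • q := by module
    rw [e1, e2] at h3
    have h4 : 2 • q = 2 • v + (2 * dist q v) • u i := by
      conv_lhs => rw [hi]
      module
    rw [h4] at h3
    have : (v + d1 • u i) + (v + d2 • u i) = 2 • v + (d1 + d2) • u i := by module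
    rw [this] at h3
    exact add_left_cancel h3
  have hu0 : u i ≠ 0 := by
    intro h
    have := hu i
    rw [h, norm_zero] at this
    exact zero_ne_one this
  have hsum := smul_left_injective ℝ hu0 hsum
  have : d1 = dist q v := by
    have hsum : d1 + d2 = 2 * dist q v := hsum
    linarith
  rw [this, ← hi] at e1
  have h5 : s • (y - x) = 0 := by simpa using e1
  have h6 : y = x := by
    rcases smul_eq_zero.1 h5 with h | h
    · exact absurd h hs.ne'
    · exact sub_eq_zero.1 h
  rw [← hxy, h6, ← add_smul, hab, one_smul]

end Line

/-! ### Integral affine coordinates -/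

/-- The direction vectors of the rays of the standard pair of pants. -/
def pantsDir (i : Fin 3) : BaseSpace 2 := ![!₂[-1, 0], !₂[0, -1], !₂[1, 1]] i

theorem mem_pantsRay {i : Fin 3} {x : BaseSpace 2} :
    x ∈ pantsRay i ↔ ∃ t : ℝ, 0 ≤ t ∧ x = t • pantsDir i := Iff.rfl

theorem pantsDir_coord (i : Fin 3) : pantsDir i 0 = ![-1, 0, 1] i ∧
    pantsDir i 1 = ![0, -1, 1] i := by
  fin_cases i <;> simp [pantsDir]

theorem pantsDir_ne_zero (i : Fin 3) : pantsDir i ≠ 0 := by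
  intro h
  have h0 : pantsDir i 0 = 0 := by rw [h]; rfl
  have h1 : pantsDir i 1 = 0 := by rw [h]; rfl
  rw [(pantsDir_coord i).1] at h0
  rw [(pantsDir_coord i).2] at h1
  fin_cases i <;> simp at h0 h1

theorem eq_of_smul_pantsDir {i j : Fin 3} {a b : ℝ} (ha : 0 < a) (hb : 0 < b)
    (h : a • pantsDir i = b • pantsDir j) : i = j := by
  have h0 : a * pantsDir i 0 = b * pantsDir j 0 := congrArg (fun x : BaseSpace 2 => x 0) h
  have h1 : a * pantsDir i 1 = b * pantsDir j 1 := congrArg (fun x : BaseSpace 2 => x 1) h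
  rw [(pantsDir_coord i).1, (pantsDir_coord j).1] at h0
  rw [(pantsDir_coord i).2, (pantsDir_coord j).2] at h1
  fin_cases i <;> fin_cases j <;> simp at h0 h1 ⊢ <;> linarith

namespace IntegralSplitting

variable {n : ℕ} (B : IntegralSplitting n)

/-- The coordinates of the standard basis vectors of `ℤⁿ` with respect to the splitting. -/
def coeff (j : Fin n) (k : Fin 2 ⊕ Fin (n - 2)) : ℤ := B.repr (Pi.single j 1) k

theorem sum_coeff_mul (j l : Fin n) :
    ∑ k, B.coeff j k * B k l = if l = j then 1 else 0 := by
  have := congrFun (B.sum_repr (Pi.single j 1)) l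
  rw [Finset.sum_apply] at this
  simpa [Pi.single_apply, coeff] using this

theorem sum_mul_coeff (k l : Fin 2 ⊕ Fin (n - 2)) :
    ∑ j, B k j * B.coeff j l = if l = k then 1 else 0 := by
  have h : B k = ∑ j, B k j • (Pi.single j 1 : Fin n → ℤ) := by
    ext i
    simp [Finset.sum_apply, Pi.single_apply]
  have h2 : B.repr (B k) l = ∑ j, B k j * B.coeff j l := by
    conv_lhs => rw [h]
    rw [map_sum, Finsupp.finsetSum_apply]
    exact Finset.sum_congr rfl fun j _ => by rw [map_smul]; rfl
  rw [← h2, B.repr_self, Finsupp.single_apply]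
  simp only [eq_comm]

/-- The fibre coordinates `p ↦ (⟨p, b_k⟩)_k` dual to the splitting, for fibres `Gⁿ` over an
arbitrary abelian group `G`. -/
def fibreCoord (G : Type) [AddCommGroup G] : (Fin n → G) ≃ (Fin 2 ⊕ Fin (n - 2) → G) where
  toFun p k := ∑ j, B k j • p j
  invFun s j := ∑ k, B.coeff j k • s k
  left_inv p := by
    funext l
    simp only [Finset.smul_sum, smul_smul]
    rw [Finset.sum_comm]
    simp only [← Finset.sum_smul, B.sum_coeff_mul]
    simp
  right_inv s := by
    funext k
    simp only [Finset.smul_sum, smul_smul]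
    rw [Finset.sum_comm]
    simp only [← Finset.sum_smul, B.sum_mul_coeff]
    simp

theorem fibreCoord_map {G H : Type} [AddCommGroup G] [AddCommGroup H] (φ : G →+ H)
    (p : Fin n → G) (k : Fin 2 ⊕ Fin (n - 2)) :
    B.fibreCoord H (fun j => φ (p j)) k = φ (B.fibreCoord G p k) := by
  simp [fibreCoord, map_sum, map_zsmul]

theorem continuous_fibreCoord {G : Type} [AddCommGroup G] [TopologicalSpace G]
    [IsTopologicalAddGroup G] : Continuous (B.fibreCoord G) :=
  continuous_pi fun k =>
    (continuous_finsetSum _ fun j _ => (continuous_apply j).zsmul (B k j) :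
      Continuous fun p : Fin n → G => ∑ j, B k j • p j)

theorem continuous_fibreCoord_symm {G : Type} [AddCommGroup G] [TopologicalSpace G]
    [IsTopologicalAddGroup G] : Continuous (B.fibreCoord G).symm :=
  continuous_pi fun j =>
    (continuous_finsetSum _ fun k _ => (continuous_apply k).zsmul (B.coeff j k) :
      Continuous fun s : Fin 2 ⊕ Fin (n - 2) → G => ∑ k, B.coeff j k • s k)

/-- The linear part of the integral affine embedding of the plane. -/
def planeDir : BaseSpace 2 →ₗ[ℝ] BaseSpace n where
  toFun x := WithLp.toLp 2 fun j => ∑ i : Fin 2, x i * (B (Sum.inl i) j : ℝ)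
  map_add' x y := by
    ext j
    simp [add_mul, Finset.sum_add_distrib]
  map_smul' c x := by
    ext j
    simp [mul_assoc, mul_add]

theorem planeEmbedding_eq (v : BaseSpace n) (x : BaseSpace 2) :
    planeEmbedding v B x = v + B.planeDir x := by
  ext j
  rfl

/-- A linear retraction of `planeDir`. -/
def planeCoord : BaseSpace n →ₗ[ℝ] BaseSpace 2 where
  toFun q := WithLp.toLp 2 fun i => ∑ j, q j * (B.coeff j (Sum.inl i) : ℝ)
  map_add' x y := by
    ext j
    simp [add_mul, Finset.sum_add_distrib]
  map_smul' c x := by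
    ext j
    simp [mul_assoc, Finset.mul_sum]

theorem planeCoord_planeDir (x : BaseSpace 2) : B.planeCoord (B.planeDir x) = x := by
  ext i
  change ∑ j, (∑ i' : Fin 2, x i' * (B (Sum.inl i') j : ℝ)) * (B.coeff j (Sum.inl i) : ℝ) = x i
  simp only [Finset.sum_mul, mul_assoc]
  rw [Finset.sum_comm]
  have h : ∀ i', ∑ j, (B (Sum.inl i') j : ℝ) * (B.coeff j (Sum.inl i) : ℝ) =
      if i = i' then 1 else 0 := by
    intro i'
    have := B.sum_mul_coeff (Sum.inl i') (Sum.inl i)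
    simp only [Sum.inl.injEq] at this
    exact_mod_cast this
  simp only [← Finset.mul_sum, h]
  simp

theorem continuous_planeDir : Continuous B.planeDir := B.planeDir.continuous_of_finiteDimensional

theorem continuous_planeCoord : Continuous B.planeCoord :=
  B.planeCoord.continuous_of_finiteDimensional

theorem planeDir_injective : Function.Injective B.planeDir :=
  Function.LeftInverse.injective B.planeCoord_planeDir

theorem sum_mul_planeDir (p : Fin n → ℝ) (x : BaseSpace 2) :
    ∑ j, p j * B.planeDir x j = ∑ i, B.fibreCoord ℝ p (Sum.inl i) * x i := by
  change ∑ j, p j * ∑ i : Fin 2, x i * (B (Sum.inl i) j : ℝ) =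
    ∑ i, (∑ j, B (Sum.inl i) j • p j) * x i
  simp only [Finset.mul_sum, Finset.sum_mul, zsmul_eq_mul]
  rw [Finset.sum_comm]
  refine Finset.sum_congr rfl fun i _ => Finset.sum_congr rfl fun j _ => by ring

/-- The unit vector in the direction of the `i`-th ray of the embedded pair of pants. -/
def legDir (i : Fin 3) : BaseSpace n := ‖B.planeDir (pantsDir i)‖⁻¹ • B.planeDir (pantsDir i)

theorem norm_planeDir_pos (i : Fin 3) : 0 < ‖B.planeDir (pantsDir i)‖ := by
  rw [norm_pos_iff, ← B.planeDir.map_zero]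
  exact B.planeDir_injective.ne (pantsDir_ne_zero i)

theorem norm_legDir (i : Fin 3) : ‖B.legDir i‖ = 1 := by
  rw [legDir, norm_smul, norm_inv, norm_norm, inv_mul_cancel₀ (B.norm_planeDir_pos i).ne']

theorem legDir_injective : Function.Injective B.legDir := by
  intro i j h
  have hi := inv_pos.2 (B.norm_planeDir_pos i)
  have hj := inv_pos.2 (B.norm_planeDir_pos j)
  rw [legDir, legDir, ← map_smul, ← map_smul] at h
  exact eq_of_smul_pantsDir hi hj (B.planeDir_injective h)

theorem planeDir_smul_pantsDir (i : Fin 3) (t : ℝ) :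
    B.planeDir (t • pantsDir i) = (t * ‖B.planeDir (pantsDir i)‖) • B.legDir i := by
  rw [map_smul, legDir, smul_smul, mul_assoc, mul_inv_cancel₀ (B.norm_planeDir_pos i).ne', mul_one]

theorem legDir_eq (i : Fin 3) : B.legDir i =
    B.planeDir (‖B.planeDir (pantsDir i)‖⁻¹ • pantsDir i) := by
  rw [legDir, map_smul]

theorem planeEmbedding_mem_ray_iff (v : BaseSpace n) (i : Fin 3) (x : BaseSpace 2) :
    x ∈ pantsRay i ↔ planeEmbedding v B x =
      v + dist (planeEmbedding v B x) v • B.legDir i := by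
  constructor
  · rintro ⟨t, ht, hx⟩
    have hx : x = t • pantsDir i := hx
    rw [planeEmbedding_eq, hx, planeDir_smul_pantsDir,
      dist_add_smul (B.norm_legDir i) _ (mul_nonneg ht (norm_nonneg _))]
  · intro h
    rw [planeEmbedding_eq] at h
    have h := add_left_cancel h
    rw [legDir_eq, ← map_smul] at h
    rw [B.planeDir_injective h, smul_smul]
    exact ⟨_, mul_nonneg dist_nonneg (inv_nonneg.2 (norm_nonneg _)), rfl⟩

theorem exists_mem_ray_iff (v : BaseSpace n) (i : Fin 3) (q : BaseSpace n) :
    (∃ x ∈ pantsRay i, q = planeEmbedding v B x) ↔ q = v + dist q v • B.legDir i := by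
  constructor
  · rintro ⟨x, hx, rfl⟩
    exact (B.planeEmbedding_mem_ray_iff v i x).1 hx
  · intro h
    have : q = planeEmbedding v B ((dist q v * ‖B.planeDir (pantsDir i)‖⁻¹) • pantsDir i) := by
      rw [planeEmbedding_eq, ← smul_smul, map_smul, ← legDir_eq, ← h]
    exact ⟨_, ⟨_, mul_nonneg dist_nonneg (inv_nonneg.2 (norm_nonneg _)), rfl⟩, this⟩

end IntegralSplitting

/-! ### Conormal fibres -/

/-- The fibre of the periodized conormal bundle of `e`, a subtorus of `(ℝ/ℤ)ⁿ`. -/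
def conormalFibre {n : ℕ} (e : Set (BaseSpace n)) : Set (Fin n → UnitAddCircle) :=
  {s | ∃ p : Fin n → ℝ, (∀ y ∈ vectorSpan ℝ e, ∑ i, p i * y i = 0) ∧
    s = fun i => ((p i : ℝ) : UnitAddCircle)}

theorem isPreconnected_conormalFibre {n : ℕ} (e : Set (BaseSpace n)) :
    IsPreconnected (conormalFibre e) := by
  have : conormalFibre e = (fun (p : Fin n → ℝ) i => ((p i : ℝ) : UnitAddCircle)) ''
      {p | ∀ y ∈ vectorSpan ℝ e, ∑ i, p i * y i = 0} := by
    ext s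
    constructor
    · rintro ⟨p, hp, rfl⟩; exact ⟨p, hp, rfl⟩
    · rintro ⟨p, hp, rfl⟩; exact ⟨p, hp, rfl⟩
  rw [this]
  refine IsPreconnected.image (Convex.isPreconnected ?_) _ (Continuous.continuousOn ?_)
  · intro p hp p' hp' a b _ _ _ y hy
    have h1 : ∑ i, p i * y i = 0 := hp y hy
    have h2 : ∑ i, p' i * y i = 0 := hp' y hy
    simp only [Pi.add_apply, Pi.smul_apply, smul_eq_mul, add_mul, mul_assoc,
      Finset.sum_add_distrib, ← Finset.mul_sum, h1, h2]
    simp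
  · exact continuous_pi fun i => continuous_quotient_mk'.comp (continuous_apply i)

theorem conormalFibre_nonempty {n : ℕ} (e : Set (BaseSpace n)) : (conormalFibre e).Nonempty :=
  ⟨_, 0, by simp, rfl⟩

theorem mem_conormalFibre_iff_of_span {n : ℕ} {e : Set (BaseSpace n)} {u : BaseSpace n}
    (h : vectorSpan ℝ e = ℝ ∙ u) {s : Fin n → UnitAddCircle} : s ∈ conormalFibre e ↔
      ∃ p : Fin n → ℝ, ∑ i, p i * u i = 0 ∧ s = fun i => ((p i : ℝ) : UnitAddCircle) := by
  refine exists_congr fun p => and_congr_left fun _ => ⟨fun hp => hp u ?_, fun hp y hy => ?_⟩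
  · rw [h]; exact Submodule.mem_span_singleton_self u
  · rw [h, Submodule.mem_span_singleton] at hy
    obtain ⟨c, rfl⟩ := hy
    simp only [PiLp.smul_apply, smul_eq_mul, mul_left_comm _ c, ← Finset.mul_sum, hp, mul_zero]

theorem zero_mem_pantsRay (i : Fin 3) : (0 : BaseSpace 2) ∈ pantsRay i :=
  ⟨0, le_rfl, by rw [zero_smul]⟩

theorem vectorSpan_pantsRay (i : Fin 3) : vectorSpan ℝ (pantsRay i) = ℝ ∙ pantsDir i := by
  rw [vectorSpan_eq_span_vsub_set_right ℝ (zero_mem_pantsRay i)]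
  apply le_antisymm
  · rw [Submodule.span_le]
    rintro _ ⟨q, ⟨t, ht, rfl⟩, rfl⟩
    simp only [vsub_eq_sub, sub_zero]
    exact Submodule.smul_mem _ _ (Submodule.mem_span_singleton_self _)
  · rw [Submodule.span_singleton_le_iff_mem]
    exact Submodule.subset_span ⟨pantsDir i, ⟨1, zero_le_one, by rw [one_smul]; rfl⟩, by simp⟩

/-- In the dual fibre coordinates of a splitting, the conormal fibre of a ray in the embedded plane is
the product of the conormal fibre of the ray in `ℝ²` with `(ℝ/ℤ)ⁿ⁻²`. -/
theorem mem_conormalFibre_iff {n : ℕ} (B : IntegralSplitting n) {e : Set (BaseSpace n)} (i : Fin 3)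
    (h : vectorSpan ℝ e = ℝ ∙ B.legDir i) (s : Fin n → UnitAddCircle) :
    s ∈ conormalFibre e ↔
      (fun k => B.fibreCoord UnitAddCircle s (Sum.inl k)) ∈ conormalFibre (pantsRay i) := by
  have h' : vectorSpan ℝ e = ℝ ∙ B.planeDir (pantsDir i) := by
    rw [h, IntegralSplitting.legDir]
    exact Submodule.span_singleton_smul_eq
      (isUnit_iff_ne_zero.2 (inv_ne_zero (B.norm_planeDir_pos i).ne')) _
  rw [mem_conormalFibre_iff_of_span h', mem_conormalFibre_iff_of_span (vectorSpan_pantsRay i)]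
  have hcoe : ∀ p : Fin n → ℝ, ∀ k,
      B.fibreCoord UnitAddCircle (fun j => ((p j : ℝ) : UnitAddCircle)) k =
        ((B.fibreCoord ℝ p k : ℝ) : UnitAddCircle) := fun p k =>
    B.fibreCoord_map (QuotientAddGroup.mk' (AddSubgroup.zmultiples (1 : ℝ))) p k
  constructor
  · rintro ⟨p, hp, rfl⟩
    refine ⟨fun k => B.fibreCoord ℝ p (Sum.inl k), ?_, funext fun k => hcoe p _⟩
    rw [← hp, B.sum_mul_planeDir]
  · rintro ⟨p, hp, hs⟩
    choose r hr using fun k => QuotientAddGroup.mk_surjective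
      (s := AddSubgroup.zmultiples (1 : ℝ)) (B.fibreCoord UnitAddCircle s (Sum.inr k))
    refine ⟨(B.fibreCoord ℝ).symm (Sum.elim p r), ?_, ?_⟩
    · rw [B.sum_mul_planeDir, Equiv.apply_symm_apply]
      exact hp
    · apply (B.fibreCoord UnitAddCircle).injective
      funext k
      rw [hcoe, Equiv.apply_symm_apply]
      cases k with
      | inl k => exact congrFun hs k
      | inr k => exact (hr k).symm

/-! ### The Lagrangian pair of pants near a vertex -/

namespace IntegralSplitting

variable {n : ℕ}

/-- The first two fibre coordinates. -/
def planeFibre (B : IntegralSplitting n) (s : Fin n → UnitAddCircle) : Fin 2 → UnitAddCircle :=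
  fun k => B.fibreCoord UnitAddCircle s (Sum.inl k)

theorem continuous_planeFibre (B : IntegralSplitting n) : Continuous B.planeFibre :=
  continuous_pi fun _ => (continuous_apply _).comp B.continuous_fibreCoord

/-- The part of the `i`-th ray at distance more than `R` from `v`. -/
def farRay (v : BaseSpace n) (B : IntegralSplitting n) (i : Fin 3) (R : ℝ) : Set (BaseSpace n) :=
  {q | q = v + dist q v • B.legDir i ∧ R < dist q v}

/-- The part of the `i`-th end of the product model over the points at distance more than `R`
from `v`. -/
def legEnd (v : BaseSpace n) (B : IntegralSplitting n) (i : Fin 3) (R : ℝ) :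
    Set (TorusBundle n) :=
  farRay v B i R ×ˢ {s | B.planeFibre s ∈ conormalFibre (pantsRay i)}

variable (v : BaseSpace n) (B : IntegralSplitting n)

theorem farRay_eq (i : Fin 3) {R : ℝ} (hR : 0 ≤ R) :
    farRay v B i R = (fun t : ℝ => v + t • B.legDir i) '' Set.Ioi R := by
  ext q
  constructor
  · rintro ⟨h1, h2⟩
    exact ⟨dist q v, h2, h1.symm⟩
  · rintro ⟨t, ht, rfl⟩
    have ht : R < t := ht
    have h0 := dist_add_smul (B.norm_legDir i) v (hR.trans ht.le)
    exact ⟨by rw [h0], by rw [h0]; exact ht⟩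

theorem convex_farRay (i : Fin 3) {R : ℝ} (hR : 0 ≤ R) : Convex ℝ (farRay v B i R) := by
  have : farRay v B i R =
      (fun x => v + x) '' ((LinearMap.toSpanSingleton ℝ _ (B.legDir i)) '' Set.Ioi R) := by
    rw [farRay_eq v B i hR, Set.image_image]
    rfl
  rw [this]
  exact ((convex_Ioi R).linear_image _).translate v

theorem farRay_nonempty (i : Fin 3) {R : ℝ} (hR : 0 ≤ R) : (farRay v B i R).Nonempty := by
  rw [farRay_eq v B i hR]
  exact Set.nonempty_Ioi.image _

theorem farRay_anti (i : Fin 3) {R R' : ℝ} (h : R' ≤ R) : farRay v B i R ⊆ farRay v B i R' :=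
  fun _ hq => ⟨hq.1, h.trans_lt hq.2⟩

theorem legEnd_anti (i : Fin 3) {R R' : ℝ} (h : R' ≤ R) : legEnd v B i R ⊆ legEnd v B i R' :=
  Set.prod_mono (farRay_anti v B i h) le_rfl

theorem planeCoord_planeEmbedding_sub (x : BaseSpace 2) :
    B.planeCoord (planeEmbedding v B x - v) = x := by
  rw [planeEmbedding_eq, add_sub_cancel_left, planeCoord_planeDir]

theorem isClosed_pantsRay {n : ℕ} (B : IntegralSplitting n) (i : Fin 3) : IsClosed (pantsRay i) := by
  have : pantsRay i = {x | planeEmbedding 0 B x =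
      0 + dist (planeEmbedding 0 B x) 0 • B.legDir i} :=
    Set.ext fun x => B.planeEmbedding_mem_ray_iff 0 i x
  rw [this]
  have hc : Continuous (planeEmbedding 0 B) := by
    rw [funext (B.planeEmbedding_eq 0)]
    exact continuous_const.add B.continuous_planeDir
  exact isClosed_eq hc (continuous_const.add ((hc.dist continuous_const).smul continuous_const))

theorem eq_zero_of_mem_pantsRay {i j : Fin 3} (hij : i ≠ j) {x : BaseSpace 2}
    (hi : x ∈ pantsRay i) (hj : x ∈ pantsRay j) : x = 0 := by
  obtain ⟨t, ht, hx⟩ := mem_pantsRay.1 hi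
  obtain ⟨t', ht', hx'⟩ := mem_pantsRay.1 hj
  rcases ht.eq_or_lt with rfl | ht
  · rw [hx, zero_smul]
  rcases ht'.eq_or_lt with rfl | ht'
  · rw [hx', zero_smul]
  exact absurd (eq_of_smul_pantsDir ht ht' (hx.symm.trans hx')) hij

variable {v B} {P : Set (TorusBundle 2)} {r m : ℝ} (hP : IsLagrangianPants r P)
  (hr : ∀ x ∈ Metric.closedBall (0 : BaseSpace 2) r, dist (planeEmbedding v B x) v < m)

include hP hr in
theorem mem_pants_iff {x : TorusBundle 2} (hx : m ≤ dist (planeEmbedding v B x.1) v) :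
    x ∈ P ↔ ∃ i, x.1 ∈ pantsRay i ∧ x.2 ∈ conormalFibre (pantsRay i) :=
  hP.conormal x fun h => (hr _ h).not_ge hx

include hP hr in
theorem mem_productModel_iff {y : TorusBundle n} (hy : m ≤ dist y.1 v) :
    y ∈ productModel v B P ↔ ∃ i, y.1 = v + dist y.1 v • B.legDir i ∧
      B.planeFibre y.2 ∈ conormalFibre (pantsRay i) := by
  constructor
  · rintro ⟨x, hx, hxP⟩
    obtain ⟨i, hi, hF⟩ := (mem_pants_iff hP hr (by rw [← hx]; exact hy)).1 hxP
    exact ⟨i, by rw [hx]; exact (B.planeEmbedding_mem_ray_iff v i x).1 hi, hF⟩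
  · rintro ⟨i, hi, hF⟩
    obtain ⟨x, hx, hyx⟩ := (B.exists_mem_ray_iff v i y.1).2 hi
    exact ⟨x, hyx, (mem_pants_iff hP hr (x := (x, B.planeFibre y.2))
      (by rw [← hyx]; exact hy)).2 ⟨i, hx, hF⟩⟩

include hP hr in
theorem legEnd_subset (i : Fin 3) {R : ℝ} (hR : m ≤ R) :
    legEnd v B i R ⊆ productModel v B P := fun _ hy =>
  (mem_productModel_iff hP hr (hR.trans hy.1.2.le)).2 ⟨i, hy.1.1, hy.2⟩

theorem continuous_planeEmbedding : Continuous (planeEmbedding v B) := by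
  rw [funext (B.planeEmbedding_eq v)]
  exact continuous_const.add B.continuous_planeDir

/-- The part of the `i`-th end of the pair of pants at distance more than `R` from `v`. -/
def pantsEnd (v : BaseSpace n) (B : IntegralSplitting n) (P : Set (TorusBundle 2)) (i : Fin 3)
    (R : ℝ) : Set P :=
  {x | x.1.1 ∈ pantsRay i ∧ R < dist (planeEmbedding v B x.1.1) v}

theorem continuous_pantsDist :
    Continuous fun x : P => dist (planeEmbedding v B x.1.1) v :=
  (continuous_planeEmbedding.comp (continuous_fst.comp continuous_subtype_val)).dist
    continuous_const

theorem planeEmbedding_zero : planeEmbedding v B 0 = v := by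
  rw [planeEmbedding_eq, map_zero, add_zero]

theorem disjoint_pantsEnd (hm : 0 < m) {i j : Fin 3} (hij : i ≠ j) {x : BaseSpace 2}
    (hi : x ∈ pantsRay i) (hj : x ∈ pantsRay j) (hx : m ≤ dist (planeEmbedding v B x) v) :
    False := by
  rw [eq_zero_of_mem_pantsRay hij hi hj, planeEmbedding_zero, dist_self] at hx
  exact hx.not_gt hm

include hP hr in
theorem isOpen_pantsEnd (hm : 0 < m) (i : Fin 3) {R : ℝ} (hR : m ≤ R) :
    IsOpen (pantsEnd v B P i R) := by
  have : pantsEnd v B P i R = {x | R < dist (planeEmbedding v B x.1.1) v} ∩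
      ⋂ j : {j // j ≠ i}, {x : P | x.1.1 ∈ pantsRay j.1}ᶜ := by
    ext x
    simp only [Set.mem_inter_iff, Set.mem_iInter]
    constructor
    · rintro ⟨hx, hxR⟩
      exact ⟨hxR, fun j hj => disjoint_pantsEnd hm j.2 hj hx (hR.trans hxR.le)⟩
    · rintro ⟨hxR, hx⟩
      have hxR' : R < dist (planeEmbedding v B x.1.1) v := hxR
      obtain ⟨j, hj, -⟩ := (mem_pants_iff hP hr (hR.trans hxR'.le)).1 x.2
      by_cases hij : j = i
      · subst hij
        exact ⟨hj, hxR⟩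
      · exact absurd hj (hx ⟨j, hij⟩)
  rw [this]
  refine (isOpen_lt continuous_const continuous_pantsDist).inter
    (isOpen_iInter_of_finite fun j => ?_)
  exact ((B.isClosed_pantsRay j.1).preimage
    (continuous_fst.comp continuous_subtype_val)).isOpen_compl

include hP hr in
theorem pantsEnd_image (hm : 0 < m) (i : Fin 3) {R : ℝ} (hR : m ≤ R) :
    Subtype.val '' pantsEnd v B P i R =
      (B.planeCoord '' ((fun q => q - v) '' farRay v B i R)) ×ˢ conormalFibre (pantsRay i) := by
  have key : ∀ x : BaseSpace 2,
      x ∈ B.planeCoord '' ((fun q => q - v) '' farRay v B i R) ↔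
        x ∈ pantsRay i ∧ R < dist (planeEmbedding v B x) v := by
    intro x
    rw [B.planeEmbedding_mem_ray_iff v i x]
    constructor
    · rintro ⟨_, ⟨q, hq, rfl⟩, rfl⟩
      obtain ⟨x, -, hx⟩ := (B.exists_mem_ray_iff v i q).2 hq.1
      simp only
      rw [hx, planeCoord_planeEmbedding_sub, ← hx]
      exact hq
    · intro h
      refine ⟨_, ⟨planeEmbedding v B x, h, rfl⟩, ?_⟩
      simp only
      rw [planeCoord_planeEmbedding_sub]
  ext x
  rw [Set.mem_prod, key]
  constructor
  · rintro ⟨x, ⟨hx, hxR⟩, rfl⟩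
    refine ⟨⟨hx, hxR⟩, ?_⟩
    obtain ⟨j, hj, hF⟩ := (mem_pants_iff hP hr (hR.trans hxR.le)).1 x.2
    by_cases hij : j = i
    · subst hij
      exact hF
    · exact (disjoint_pantsEnd hm hij hj hx (hR.trans hxR.le)).elim
  · rintro ⟨⟨hx, hxR⟩, hF⟩
    exact ⟨⟨x, (mem_pants_iff hP hr (hR.trans hxR.le)).2 ⟨i, hx, hF⟩⟩, ⟨hx, hxR⟩, rfl⟩

include hP hr in
theorem isPreconnected_pantsEnd (hm : 0 < m) (i : Fin 3) {R : ℝ} (hR : m ≤ R) :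
    IsPreconnected (pantsEnd v B P i R) := by
  rw [← Topology.IsInducing.subtypeVal.isPreconnected_image, pantsEnd_image hP hr hm i hR]
  refine IsPreconnected.prod ?_ (isPreconnected_conormalFibre _)
  refine IsPreconnected.image (IsPreconnected.image ?_ _ ?_) _ ?_
  · exact (convex_farRay v B i (hm.le.trans hR)).isPreconnected
  · fun_prop
  · exact B.continuous_planeCoord.continuousOn

include hP hr in
theorem pantsEnd_nonempty (hm : 0 < m) (i : Fin 3) {R : ℝ} (hR : m ≤ R) :
    (pantsEnd v B P i R).Nonempty := by
  rw [← Set.image_nonempty (f := Subtype.val), pantsEnd_image hP hr hm i hR]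
  exact ((((farRay_nonempty v B i (hm.le.trans hR)).image _).image _).prod
    (conormalFibre_nonempty _))

include hP hr in
theorem isCompact_compl_pantsEnd : IsCompact (⋃ i, pantsEnd v B P i m)ᶜ := by
  have : (⋃ i, pantsEnd v B P i m)ᶜ = {x : P | dist (planeEmbedding v B x.1.1) v ≤ m} := by
    ext x
    constructor
    · intro hx
      by_contra hlt
      have hlt : m < dist (planeEmbedding v B x.1.1) v := not_le.1 hlt
      obtain ⟨i, hi, -⟩ := (mem_pants_iff hP hr hlt.le).1 x.2
      exact hx (Set.mem_iUnion.2 ⟨i, hi, hlt⟩)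
    · intro hx hx'
      obtain ⟨i, hi⟩ := Set.mem_iUnion.1 hx'
      exact not_lt.2 hx hi.2
  rw [this, Subtype.isCompact_iff]
  have h2 : Subtype.val '' {x : P | dist (planeEmbedding v B x.1.1) v ≤ m} =
      (planeEmbedding v B ⁻¹' Metric.closedBall v m) ×ˢ Set.univ ∩ P := by
    ext x
    constructor
    · rintro ⟨x, hx, rfl⟩
      exact ⟨⟨hx, trivial⟩, x.2⟩
    · rintro ⟨⟨hx, -⟩, hxP⟩
      exact ⟨⟨x, hxP⟩, hx, rfl⟩
  rw [h2]
  refine IsCompact.inter_right (IsCompact.prod ?_ isCompact_univ) hP.isClosed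
  have h3 : IsCompact ((fun q => B.planeCoord (q - v)) '' Metric.closedBall v m) :=
    (isCompact_closedBall v m).image
      (B.continuous_planeCoord.comp (continuous_id.sub continuous_const))
  refine h3.of_isClosed_subset (Metric.isClosed_closedBall.preimage continuous_planeEmbedding) ?_
  intro x hx
  refine ⟨_, hx, ?_⟩
  simp only
  rw [planeCoord_planeEmbedding_sub]

theorem exists_disjoint_pantsEnd {K : Set P} (hK : IsCompact K) :
    ∃ R ≥ m, ∀ i, Disjoint (pantsEnd v B P i R) K := by
  obtain ⟨C, hC⟩ := (hK.image (continuous_pantsDist (v := v) (B := B))).bddAbove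
  refine ⟨max C m, le_max_right _ _, fun i => Set.disjoint_left.2 fun x hx hxK => ?_⟩
  exact (hC ⟨x, hxK, rfl⟩).not_gt ((le_max_left _ _).trans_lt hx.2)

/-- The product model is the product of the plane minus two points with a torus. -/
def productModelHomeomorph (v : BaseSpace n) (B : IntegralSplitting n) {P : Set (TorusBundle 2)}
    (h : P ≃ₜ PuncturedPlane.plane) : productModel v B P ≃ₜ
      (PuncturedPlane.plane ×ˢ Set.univ : Set (ℂ × (Fin (n - 2) → UnitAddCircle))) where
  toFun y := ⟨(h ⟨(B.planeCoord (y.1.1 - v), B.planeFibre y.1.2), by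
      obtain ⟨x, hx, hxP⟩ := y.2
      rw [hx, planeCoord_planeEmbedding_sub]
      exact hxP⟩, fun k => B.fibreCoord UnitAddCircle y.1.2 (Sum.inr k)),
    (h _).2, trivial⟩
  invFun z := ⟨(planeEmbedding v B (h.symm ⟨z.1.1, z.2.1⟩).1.1,
      (B.fibreCoord UnitAddCircle).symm (Sum.elim (h.symm ⟨z.1.1, z.2.1⟩).1.2 z.1.2)),
    ⟨_, rfl, by
      have := (h.symm ⟨z.1.1, z.2.1⟩).2
      convert this using 1
      refine Prod.ext rfl ?_
      funext k
      exact congrFun ((B.fibreCoord UnitAddCircle).apply_symm_apply _) (Sum.inl k)⟩⟩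
  left_inv y := by
    obtain ⟨y, x, hx, hxP⟩ := y
    apply Subtype.ext
    simp only [Subtype.coe_eta, Homeomorph.symm_apply_apply]
    refine Prod.ext ?_ ?_
    · simp only
      rw [hx]
      congr 1
      rw [planeCoord_planeEmbedding_sub]
    · simp only
      rw [Equiv.symm_apply_eq]
      funext k
      cases k <;> rfl
  right_inv z := by
    obtain ⟨⟨z, t⟩, hz, -⟩ := z
    apply Subtype.ext
    refine Prod.ext ?_ ?_
    · simp only
      have hx := (h.symm ⟨z, hz⟩).1.1
      have : ∀ p hp, p = (h.symm ⟨z, hz⟩).1 → (h ⟨p, hp⟩ : ℂ) = z := by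
        rintro p hp rfl
        rw [Subtype.coe_eta, h.apply_symm_apply]
      apply this
      refine Prod.ext ?_ ?_
      · simp only
        rw [planeCoord_planeEmbedding_sub]
      · funext k
        exact congrFun ((B.fibreCoord UnitAddCircle).apply_symm_apply _) (Sum.inl k)
    · funext k
      exact congrFun ((B.fibreCoord UnitAddCircle).apply_symm_apply _) (Sum.inr k)
  continuous_toFun := by
    refine Continuous.subtype_mk (Continuous.prodMk ?_ ?_) _
    · refine continuous_subtype_val.comp (h.continuous.comp (Continuous.subtype_mk
        (Continuous.prodMk ?_ ?_) _))
      · exact B.continuous_planeCoord.comp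
          ((continuous_fst.comp continuous_subtype_val).sub continuous_const)
      · exact B.continuous_planeFibre.comp (continuous_snd.comp continuous_subtype_val)
    · exact continuous_pi fun k => (continuous_apply _).comp
        (B.continuous_fibreCoord.comp (continuous_snd.comp continuous_subtype_val))
  continuous_invFun := by
    have h1 : Continuous fun z : (PuncturedPlane.plane ×ˢ Set.univ :
        Set (ℂ × (Fin (n - 2) → UnitAddCircle))) => (h.symm ⟨z.1.1, z.2.1⟩).1 :=
      continuous_subtype_val.comp (h.symm.continuous.comp
        (Continuous.subtype_mk (continuous_fst.comp continuous_subtype_val) _))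
    refine Continuous.subtype_mk (Continuous.prodMk ?_ ?_) _
    · exact continuous_planeEmbedding.comp (continuous_fst.comp h1)
    · refine B.continuous_fibreCoord_symm.comp (continuous_pi fun k => ?_)
      cases k with
      | inl k => exact (continuous_apply k).comp (continuous_snd.comp h1)
      | inr k => exact (continuous_apply k).comp (continuous_snd.comp continuous_subtype_val)

end IntegralSplitting

/-! ### Cohomology of the product model -/

namespace IntegralSplitting

variable {n : ℕ} {v : BaseSpace n} {B : IntegralSplitting n} {P : Set (TorusBundle 2)} {r m : ℝ}
  {k : ℕ} {A : Type} [AddCommGroup A]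

/-- The product model is a product of the plane minus two points with a torus such that the preimage
of the neighbourhood of a puncture lies between two neighbourhoods of the corresponding end. -/
theorem exists_sandwich (hP : IsLagrangianPants r P) (hm : 0 < m)
    (hr : ∀ x ∈ Metric.closedBall (0 : BaseSpace 2) r, dist (planeEmbedding v B x) v < m) :
    ∃ (g : productModel v B P ≃ₜ
        (PuncturedPlane.plane ×ˢ Set.univ : Set (ℂ × (Fin (n - 2) → UnitAddCircle))))
      (c : Fin 3 → Fin 3) (δ R : ℝ), Function.Injective c ∧ 0 < δ ∧ δ ≤ 1 / 2 ∧ m ≤ R ∧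
      ∀ i (y : productModel v B P),
        ((g y : ℂ × (Fin (n - 2) → UnitAddCircle)).1 ∈ PuncturedPlane.nbhd (c i) δ →
          (y : TorusBundle n) ∈ legEnd v B i m) ∧
        ((y : TorusBundle n) ∈ legEnd v B i R →
          (g y : ℂ × (Fin (n - 2) → UnitAddCircle)).1 ∈ PuncturedPlane.nbhd (c i) δ) := by
  obtain ⟨h⟩ := hP.pants
  obtain ⟨c, hc, δ, hδ, hδ1, R, hR, H⟩ := PuncturedPlane.exists_end_matching h
    (pantsEnd v B P) (m := m) (fun i R hR x hx => ⟨hx.1, lt_of_le_of_lt hR hx.2⟩)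
    (fun i R hR => isOpen_pantsEnd hP hr hm i hR)
    (fun i j hij => Set.disjoint_left.2 fun x hi hj =>
      disjoint_pantsEnd hm hij hi.1 hj.1 hi.2.le)
    (fun i R hR => isPreconnected_pantsEnd hP hr hm i hR)
    (fun i R hR => pantsEnd_nonempty hP hr hm i hR)
    (isCompact_compl_pantsEnd hP hr) (fun K hK => exists_disjoint_pantsEnd hK)
  refine ⟨productModelHomeomorph v B h, c, δ, R, hc, hδ, hδ1, hR, fun i y => ?_⟩
  -- the point of `P` below a point of the product model
  obtain ⟨y, x, hx, hxP⟩ := y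
  have hg : ((productModelHomeomorph v B h ⟨y, x, hx, hxP⟩ :
      ℂ × (Fin (n - 2) → UnitAddCircle)).1) = h ⟨(x, B.planeFibre y.2), hxP⟩ := by
    change (h ⟨(B.planeCoord (y.1 - v), B.planeFibre y.2), _⟩ : ℂ) = _
    have : B.planeCoord (y.1 - v) = x := by rw [hx, planeCoord_planeEmbedding_sub]
    congr 3
    exact Prod.ext this rfl
  rw [hg]
  have key : ∀ R', m ≤ R' → (y ∈ legEnd v B i R' ↔
      (⟨(x, B.planeFibre y.2), hxP⟩ : P) ∈ pantsEnd v B P i R') := by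
    intro R' hR'
    constructor
    · rintro ⟨⟨h1, h2⟩, -⟩
      rw [hx] at h1 h2
      exact ⟨(B.planeEmbedding_mem_ray_iff v i x).2 h1, h2⟩
    · intro hmem
      have h1 := Set.mem_image_of_mem Subtype.val hmem
      rw [pantsEnd_image hP hr hm i hR'] at h1
      refine ⟨?_, h1.2⟩
      rw [hx]
      exact ⟨(B.planeEmbedding_mem_ray_iff v i x).1 hmem.1, hmem.2⟩
  exact ⟨fun h' => (key m le_rfl).2 ((H i).1 _ h'), fun h' => (H i).2 _ ((key R hR).1 h')⟩

/-- Cohomology classes on an end of the product model extend to the product model. -/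
theorem res_legEnd_surjective (hP : IsLagrangianPants r P) (hm : 0 < m)
    (hr : ∀ x ∈ Metric.closedBall (0 : BaseSpace 2) r, dist (planeEmbedding v B x) v < m)
    (i : Fin 3) : Function.Surjective
      (cohomologyRes k A (legEnd_subset hP hr i le_rfl : legEnd v B i m ⊆ productModel v B P)) := by
  obtain ⟨g, c, δ, R, -, hδ, hδ1, hR, H⟩ := exists_sandwich hP hm hr
  obtain ⟨e, he⟩ := exists_cohomology_transfer (k := k) (A := A) g
  set U : Set (TorusBundle n) := {y | ∃ hy : y ∈ productModel v B P,
    (g ⟨y, hy⟩ : ℂ × (Fin (n - 2) → UnitAddCircle)).1 ∈ PuncturedPlane.nbhd (c i) δ} with hU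
  have hUP : U ⊆ productModel v B P := fun y hy => hy.1
  have hUm : U ⊆ legEnd v B i m := fun y hy => (H i ⟨y, hy.1⟩).1 hy.2
  have hRU : legEnd v B i R ⊆ U := fun y hy =>
    ⟨legEnd_subset hP hr i hR hy, (H i ⟨y, _⟩).2 hy⟩
  obtain ⟨e', he'⟩ := he U _ hUP (PuncturedPlane.prod_subset
    (PuncturedPlane.nbhd_subset hδ hδ1 (c i))) fun y => by
      constructor
      · rintro ⟨_, hy⟩; exact ⟨hy, trivial⟩
      · rintro ⟨hy, -⟩; exact ⟨y.2, hy⟩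
  intro a
  obtain ⟨b, hb⟩ := PuncturedPlane.res_nbhd_surjective (k := k) (A := A)
    (Y := Fin (n - 2) → UnitAddCircle) hδ hδ1 (c i) (e'.symm (cohomologyRes k A hUm a))
  refine ⟨e b, ?_⟩
  have hinj : Function.Injective (cohomologyRes k A (legEnd_anti v B i hR)) :=
    (cohomologyRes_bijective_of_convex
      (convex_farRay v B i (hm.le.trans hR)) (convex_farRay v B i hm.le)
      (farRay_nonempty v B i (hm.le.trans hR)) (farRay_anti v B i hR)
      {s | B.planeFibre s ∈ conormalFibre (pantsRay i)} (legEnd_anti v B i hR)).1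
  apply hinj
  have h1 : cohomologyRes k A hUP (e b) = cohomologyRes k A hUm a := by
    rw [he' b, hb, AddEquiv.apply_symm_apply]
  have h2 := congrArg (cohomologyRes k A hRU) h1
  rw [cohomologyRes_res, cohomologyRes_res] at h2
  rw [cohomologyRes_res]
  exact h2

/-- A class of degree at least two on the product model which vanishes on two ends is zero. -/
theorem eq_zero_of_res_legEnd (hP : IsLagrangianPants r P) (hm : 0 < m)
    (hr : ∀ x ∈ Metric.closedBall (0 : BaseSpace 2) r, dist (planeEmbedding v B x) v < m)
    {i j : Fin 3} (hij : i ≠ j) (a : cohomologyOf (k + 2) A (productModel v B P))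
    (hi : cohomologyRes (k + 2) A (legEnd_subset hP hr i le_rfl) a = 0)
    (hj : cohomologyRes (k + 2) A (legEnd_subset hP hr j le_rfl) a = 0) : a = 0 := by
  obtain ⟨g, c, δ, R, hc, hδ, hδ1, hR, H⟩ := exists_sandwich hP hm hr
  obtain ⟨e, he⟩ := exists_cohomology_transfer (k := k + 2) (A := A) g
  obtain ⟨b, rfl⟩ := e.surjective a
  have key : ∀ i, cohomologyRes (k + 2) A (legEnd_subset hP hr i le_rfl) (e b) = 0 →
      cohomologyRes (k + 2) A (PuncturedPlane.prod_subset
        (PuncturedPlane.nbhd_subset hδ hδ1 (c i))) b = 0 := by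
    intro i hi
    set U : Set (TorusBundle n) := {y | ∃ hy : y ∈ productModel v B P,
      (g ⟨y, hy⟩ : ℂ × (Fin (n - 2) → UnitAddCircle)).1 ∈ PuncturedPlane.nbhd (c i) δ} with hU
    have hUP : U ⊆ productModel v B P := fun y hy => hy.1
    have hUm : U ⊆ legEnd v B i m := fun y hy => (H i ⟨y, hy.1⟩).1 hy.2
    obtain ⟨e', he'⟩ := he U _ hUP (PuncturedPlane.prod_subset
      (PuncturedPlane.nbhd_subset hδ hδ1 (c i))) fun y => by
        constructor
        · rintro ⟨_, hy⟩; exact ⟨hy, trivial⟩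
        · rintro ⟨hy, -⟩; exact ⟨y.2, hy⟩
    apply e'.injective
    rw [← he' b, map_zero, ← cohomologyRes_res hUm (legEnd_subset hP hr i le_rfl), hi, map_zero]
  rw [PuncturedPlane.detects (hc.ne hij) δ hδ hδ1 b (key i hi) (key j hj), map_zero]

end IntegralSplitting

/-! ### Edges and vertices of a tropical curve -/

namespace TropicalCurve

variable {n : ℕ} {V : TropicalCurve n}

theorem isClosed_of_isRationalPolyhedron {s : Set (BaseSpace n)} (h : IsRationalPolyhedron s) :
    IsClosed s := by
  obtain ⟨m, v, c, rfl⟩ := h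
  rw [show {q : BaseSpace n | ∀ i, c i ≤ ∑ j, (v i j : ℝ) * q j} =
    ⋂ i, {q : BaseSpace n | c i ≤ ∑ j, (v i j : ℝ) * q j} by ext; simp]
  exact isClosed_iInter fun i => isClosed_le continuous_const (by fun_prop)

theorem convex_of_isRationalPolyhedron {s : Set (BaseSpace n)} (h : IsRationalPolyhedron s) :
    Convex ℝ s := by
  obtain ⟨m, v, c, rfl⟩ := h
  intro x hx y hy a b ha hb hab i
  have h1 : ∑ j, (v i j : ℝ) * (a • x + b • y) j =
      a * ∑ j, (v i j : ℝ) * x j + b * ∑ j, (v i j : ℝ) * y j := by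
    simp only [PiLp.add_apply, PiLp.smul_apply, smul_eq_mul, Finset.mul_sum,
      ← Finset.sum_add_distrib]
    exact Finset.sum_congr rfl fun j _ => by ring
  rw [h1]
  calc c i = a * c i + b * c i := by rw [← add_mul, hab, one_mul]
    _ ≤ _ := add_le_add (mul_le_mul_of_nonneg_left (hx i) ha)
      (mul_le_mul_of_nonneg_left (hy i) hb)

theorem isClosed_edge {e : Set (BaseSpace n)} (he : e ∈ V.edges) : IsClosed e :=
  isClosed_of_isRationalPolyhedron (V.rational e he)

theorem convex_edge {e : Set (BaseSpace n)} (he : e ∈ V.edges) : Convex ℝ e :=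
  convex_of_isRationalPolyhedron (V.rational e he)

theorem edge_nonempty {e : Set (BaseSpace n)} (he : e ∈ V.edges) : e.Nonempty := by
  by_contra h
  have := V.one_dimensional e he
  rw [Set.not_nonempty_iff_eq_empty.1 h, vectorSpan_empty] at this
  simp at this

theorem mem_extremePoints_of_mem_inter {e e' : Set (BaseSpace n)} (he : e ∈ V.edges)
    (he' : e' ∈ V.edges) (hne : e ≠ e') {q : BaseSpace n} (hq : q ∈ e) (hq' : q ∈ e') :
    q ∈ e.extremePoints ℝ ∧ q ∈ e'.extremePoints ℝ := by
  rcases V.polyhedral_complex e he e' he' hne with h | ⟨v, h, hv, hv'⟩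
  · exact absurd (show q ∈ e ∩ e' from ⟨hq, hq'⟩) (by rw [h]; exact id)
  · have : q ∈ e ∩ e' := ⟨hq, hq'⟩
    rw [h] at this
    rw [Set.mem_singleton_iff.1 this]
    exact ⟨hv, hv'⟩

theorem eq_of_mem_inter {e e' : Set (BaseSpace n)} (he : e ∈ V.edges)
    (he' : e' ∈ V.edges) {p q : BaseSpace n} (hpq : p ≠ q) (hp : p ∈ e) (hp' : p ∈ e')
    (hq : q ∈ e) (hq' : q ∈ e') : e = e' := by
  by_contra hne
  rcases V.polyhedral_complex e he e' he' hne with h | ⟨v, h, -, -⟩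
  · exact absurd (show q ∈ e ∩ e' from ⟨hq, hq'⟩) (by rw [h]; exact id)
  · have h1 : p ∈ e ∩ e' := ⟨hp, hp'⟩
    have h2 : q ∈ e ∩ e' := ⟨hq, hq'⟩
    rw [h] at h1 h2
    exact hpq (h1.trans h2.symm)

theorem mem_extremePoints_of_mem {e : Set (BaseSpace n)} (he : e ∈ V.edges) {v : BaseSpace n}
    (hv : v ∈ V.vertices) (hve : v ∈ e) : v ∈ e.extremePoints ℝ := by
  obtain ⟨e', he', hv'⟩ := hv
  by_cases h : e = e'
  · rw [h]; exact hv'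
  · exact (mem_extremePoints_of_mem_inter he he' h hve hv'.1).1

theorem finite_vertices (V : TropicalCurve n) : V.vertices.Finite := by
  have : V.vertices = ⋃ e ∈ (V.edges : Set (Set (BaseSpace n))), e.extremePoints ℝ := by
    ext v
    simp [vertices]
  rw [this]
  exact V.edges.finite_toSet.biUnion fun e he =>
    finite_extremePoints (convex_edge he) (V.one_dimensional e he)

instance (V : TropicalCurve n) : Finite V.vertices := V.finite_vertices.to_subtype

theorem exists_emanatesFrom_edge {e : Set (BaseSpace n)} (he : e ∈ V.edges) {v : BaseSpace n}
    (hv : v ∈ V.vertices) (hve : v ∈ e) : ∃ u, EmanatesFrom e v u :=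
  exists_emanatesFrom (convex_edge he) (V.one_dimensional e he)
    (mem_extremePoints_of_mem he hv hve)

/-- A bounded edge has a second end point. -/
theorem exists_ne_vertex {e : Set (BaseSpace n)} (he : e ∈ V.edges) (hb : Bornology.IsBounded e)
    {v : BaseSpace n} (hv : v ∈ V.vertices) (hve : v ∈ e) : ∃ w ∈ V.vertices, w ∈ e ∧ w ≠ v := by
  obtain ⟨u, hu⟩ := exists_emanatesFrom_edge he hv hve
  obtain ⟨w, hw, hmax⟩ := (Metric.isCompact_of_isClosed_isBounded (isClosed_edge he) hb
    ).exists_isMaxOn ⟨v, hve⟩ (continuous_id.dist (continuous_const (y := v))).continuousOn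
  refine ⟨w, ⟨e, he, hu.mem_extremePoints hw fun q hq => hmax hq⟩, hw, ?_⟩
  rintro rfl
  obtain ⟨t, ht, hm⟩ := hu.exists_pos
  have : dist (w + t • u) w ≤ dist w w := hmax hm
  rw [dist_add_smul hu.norm_eq_one _ ht.le, dist_self] at this
  linarith

/-- An unbounded edge has at most one end point. -/
theorem eq_of_not_isBounded {e : Set (BaseSpace n)} (he : e ∈ V.edges)
    (hb : ¬ Bornology.IsBounded e) {v w : BaseSpace n} (hv : v ∈ V.vertices) (hve : v ∈ e)
    (hw : w ∈ V.vertices) (hwe : w ∈ e) : w = v := by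
  by_contra hne
  obtain ⟨u, hu⟩ := exists_emanatesFrom_edge he hv hve
  refine hb ((Metric.isBounded_closedBall (x := v) (r := dist w v)).subset fun q hq => ?_)
  exact hu.dist_le_of_mem_extremePoints (mem_extremePoints_of_mem he hw hwe) hne hq

/-- In a connected curve a nonempty set of vertices which is closed under adjacency meets every
edge. -/
theorem exists_mem_of_adj_closed (hV : IsConnected V.support) {W : Set V.vertices}
    (hW : W.Nonempty) (hadj : ∀ v ∈ W, ∀ w, V.graph.Adj v w → w ∈ W)
    {e : Set (BaseSpace n)} (he : e ∈ V.edges) : ∃ v ∈ W, (v : BaseSpace n) ∈ e := by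
  by_contra hcon
  let T : Set (Set (BaseSpace n)) := {e | e ∈ V.edges ∧ ∃ v ∈ W, (v : BaseSpace n) ∈ e}
  let T' : Set (Set (BaseSpace n)) := {e | e ∈ V.edges ∧ ¬ ∃ v ∈ W, (v : BaseSpace n) ∈ e}
  have hclosed : ∀ S ⊆ (V.edges : Set (Set (BaseSpace n))), IsClosed (⋃ e ∈ S, e) := fun S hS =>
    (V.edges.finite_toSet.subset hS).isClosed_biUnion fun e he => isClosed_edge (hS he)
  have hpre := isPreconnected_closed_iff.1 hV.isPreconnected (⋃ e ∈ T, e) (⋃ e ∈ T', e)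
    (hclosed T fun e he => he.1) (hclosed T' fun e he => he.1) ?_ ?_ ?_
  · obtain ⟨q, -, hq, hq'⟩ := hpre
    simp only [Set.mem_iUnion, exists_prop] at hq hq'
    obtain ⟨e₁, ⟨he₁, v, hvW, hv⟩, hq₁⟩ := hq
    obtain ⟨e₂, ⟨he₂, h₂⟩, hq₂⟩ := hq'
    have hne : e₁ ≠ e₂ := by
      rintro rfl
      exact h₂ ⟨v, hvW, hv⟩
    have hqv : q ∈ V.vertices :=
      ⟨e₁, he₁, (mem_extremePoints_of_mem_inter he₁ he₂ hne hq₁ hq₂).1⟩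
    refine h₂ ⟨⟨q, hqv⟩, ?_, hq₂⟩
    by_cases h : v = ⟨q, hqv⟩
    · rw [← h]; exact hvW
    · exact hadj v hvW _ ⟨h, e₁, he₁, hv, hq₁⟩
  · rintro q ⟨e', he', hq⟩
    by_cases h : ∃ v ∈ W, (v : BaseSpace n) ∈ e'
    · exact Or.inl (Set.mem_biUnion (show e' ∈ T from ⟨he', h⟩) hq)
    · exact Or.inr (Set.mem_biUnion (show e' ∈ T' from ⟨he', h⟩) hq)
  · obtain ⟨v, hv⟩ := hW
    obtain ⟨e', he', hve⟩ := v.2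
    exact ⟨v, ⟨e', he', hve.1⟩, Set.mem_biUnion (show e' ∈ T from ⟨he', v, hv, hve.1⟩) hve.1⟩
  · obtain ⟨q, hq⟩ := edge_nonempty he
    exact ⟨q, ⟨e, he, hq⟩, Set.mem_biUnion (show e ∈ T' from ⟨he, hcon⟩) hq⟩

namespace LiftData

variable (D : V.LiftData)

theorem le_dist (v w : V.vertices) (hvw : v ≠ w) {q : BaseSpace n}
    (hq : dist q v < D.ε) : D.ε ≤ dist q w := by
  by_contra! h
  exact Set.disjoint_left.1 (D.disjoint v w hvw) hq h

theorem mem_support_iff (v : V.vertices) {q : BaseSpace n} (hq : dist q v < D.ε) :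
    q ∈ V.support ↔ ∃ i, q = v + dist q (v : BaseSpace n) • (D.splitting v).legDir i := by
  rw [D.modelled v q hq]
  exact exists_congr fun i => (D.splitting v).exists_mem_ray_iff v i q

/-- An edge which comes near a vertex ends there. -/
theorem vertex_mem {e : Set (BaseSpace n)} (he : e ∈ V.edges) (v : V.vertices) {q : BaseSpace n}
    (hq : q ∈ e) (hqv : dist q v < D.ε) : (v : BaseSpace n) ∈ e := by
  refine mem_of_subset_rays (isClosed_edge he) (D.splitting v).legDir (D.splitting v).norm_legDir
    (D.splitting v).legDir_injective (fun q hq h => (D.mem_support_iff v h).1 ⟨e, he, hq⟩) ?_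
    ⟨q, hq, hqv⟩ (convex_edge he)
  intro q hq h
  by_contra hne
  have := D.le_dist v ⟨q, e, he, hq⟩ (fun h => hne (congrArg Subtype.val h).symm) h
  rw [dist_self] at this
  exact this.not_gt D.ε_pos

/-- Exactly three edges end at each vertex, one for each ray of the standard pair of pants. -/
theorem exists_star (v : V.vertices) : ∃ E : Fin 3 → Set (BaseSpace n), Function.Injective E ∧
    (∀ i, E i ∈ V.edges) ∧
    (∀ i, EmanatesFrom (E i) (v : BaseSpace n) ((D.splitting v).legDir i)) ∧
    (∀ e ∈ V.edges, (v : BaseSpace n) ∈ e → ∃ i, e = E i) ∧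
    ∀ i q, dist q (v : BaseSpace n) < D.ε →
      q = v + dist q (v : BaseSpace n) • (D.splitting v).legDir i → q ∈ E i := by
  have hε := D.ε_pos
  have hdir : ∀ e ∈ V.edges, (v : BaseSpace n) ∈ e →
      ∃ i, EmanatesFrom e (v : BaseSpace n) ((D.splitting v).legDir i) := by
    intro e he hve
    obtain ⟨u, hu⟩ := exists_emanatesFrom_edge he v.2 hve
    obtain ⟨t, ht, hm⟩ := hu.exists_pos
    have hp : 0 < min t (D.ε / 2) := lt_min ht (by linarith)
    have hd := dist_add_smul hu.norm_eq_one (v : BaseSpace n) hp.le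
    have hm' := hu.add_smul_mem hm hp.le
      (by rw [dist_add_smul hu.norm_eq_one _ ht.le]; exact min_le_left _ _)
    obtain ⟨i, hi⟩ := (D.mem_support_iff v (q := v + min t (D.ε / 2) • u)
      (by rw [hd]; exact (min_le_right _ _).trans_lt (by linarith))).1 ⟨e, he, hm'⟩
    rw [hd] at hi
    have hi := smul_right_injective _ hp.ne' (add_left_cancel hi)
    exact ⟨i, hi ▸ hu⟩
  have hpt : ∀ (i : Fin 3) (q : BaseSpace n), q ≠ v → dist q (v : BaseSpace n) < D.ε →
      q = v + dist q (v : BaseSpace n) • (D.splitting v).legDir i → ∃ e ∈ V.edges,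
        EmanatesFrom e (v : BaseSpace n) ((D.splitting v).legDir i) ∧ q ∈ e := by
    intro i q hqv hq hqi
    obtain ⟨e, he, hqe⟩ := (D.mem_support_iff v hq).2 ⟨i, hqi⟩
    obtain ⟨j, hj⟩ := hdir e he (D.vertex_mem he v hqe hq)
    have hqj := hj.eq_add_smul q hqe
    conv_lhs at hqj => rw [hqi]
    have := (D.splitting v).legDir_injective
      (smul_right_injective _ (dist_pos.2 hqv).ne' (add_left_cancel hqj))
    exact ⟨e, he, this ▸ hj, hqe⟩
  have huniq : ∀ e ∈ V.edges, ∀ e' ∈ V.edges, ∀ u, EmanatesFrom e (v : BaseSpace n) u →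
      EmanatesFrom e' (v : BaseSpace n) u → e = e' := by
    intro e he e' he' u h h'
    obtain ⟨q, hq, hne⟩ := h.exists_mem_inter h'
    exact eq_of_mem_inter he he' hne hq.1 hq.2 h.mem h'.mem
  have hex : ∀ i, ∃ e ∈ V.edges, EmanatesFrom e (v : BaseSpace n) ((D.splitting v).legDir i) := by
    intro i
    have hd := dist_add_smul ((D.splitting v).norm_legDir i) (v : BaseSpace n)
      (t := D.ε / 2) (by linarith)
    obtain ⟨e, he, h, -⟩ := hpt i (v + (D.ε / 2) • (D.splitting v).legDir i)
      (by rw [← dist_pos, hd]; linarith) (by rw [hd]; linarith) (by rw [hd])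
    exact ⟨e, he, h⟩
  choose E hE hEu using hex
  refine ⟨E, fun i j hij => ?_, hE, hEu, fun e he hve => ?_, fun i q hq hqi => ?_⟩
  · obtain ⟨t, ht, hm⟩ := (hEu i).exists_pos
    have h1 := (hij ▸ hEu j : EmanatesFrom (E i) _ _).eq_add_smul _ hm
    rw [dist_add_smul ((D.splitting v).norm_legDir i) _ ht.le] at h1
    exact (D.splitting v).legDir_injective (smul_right_injective _ ht.ne' (add_left_cancel h1))
  · obtain ⟨i, hi⟩ := hdir e he hve
    exact ⟨i, huniq _ he _ (hE i) _ hi (hEu i)⟩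
  · by_cases hqv : q = v
    · rw [hqv]; exact (hEu i).mem
    · obtain ⟨e, he, h, hqe⟩ := hpt i q hqv hq hqi
      rwa [← huniq _ he _ (hE i) _ h (hEu i)]

/-- A common radius `m < ε` of balls around the vertices outside which the pairs of pants are
conormal. -/
theorem exists_radius : ∃ m, 0 < m ∧ m < D.ε ∧ ∀ v : V.vertices, ∃ r,
    IsLagrangianPants r (D.pants v) ∧ ∀ x ∈ Metric.closedBall (0 : BaseSpace 2) r,
      dist (planeEmbedding v (D.splitting v) x) v < m := by
  have hε := D.ε_pos
  have h : ∀ v : V.vertices, ∃ m : Set.Ioo 0 D.ε, ∃ r, IsLagrangianPants r (D.pants v) ∧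
      ∀ x ∈ Metric.closedBall (0 : BaseSpace 2) r,
        dist (planeEmbedding v (D.splitting v) x) v < m := by
    intro v
    obtain ⟨r, hr, hball⟩ := D.lagrangianPants v
    rcases (Metric.closedBall (0 : BaseSpace 2) r).eq_empty_or_nonempty with h0 | hne
    · exact ⟨⟨D.ε / 2, by constructor <;> linarith⟩, r, hr, fun x hx => by simp [h0] at hx⟩
    · obtain ⟨x₀, hx₀, hmax⟩ := (isCompact_closedBall (0 : BaseSpace 2) r).exists_isMaxOn hne
        ((IntegralSplitting.continuous_planeEmbedding (v := (v : BaseSpace n))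
          (B := D.splitting v)).dist (continuous_const (y := (v : BaseSpace n)))).continuousOn
      have h1 : dist (planeEmbedding v (D.splitting v) x₀) v < D.ε := hball x₀ hx₀
      obtain ⟨m, hm, hmε⟩ := exists_between h1
      exact ⟨⟨m, dist_nonneg.trans_lt hm, hmε⟩, r, hr, fun x hx => (hmax hx).trans_lt hm⟩
  choose m h using h
  have : Nonempty (Set.Ioo 0 D.ε) := ⟨⟨D.ε / 2, by constructor <;> linarith⟩⟩
  obtain ⟨M, hM⟩ := Finite.exists_le m
  refine ⟨M, M.2.1, M.2.2, fun v => ?_⟩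
  obtain ⟨r, hr, hx⟩ := h v
  exact ⟨r, hr, fun x hxr => (hx x hxr).trans_le (hM v)⟩

end LiftData
end TropicalCurve

/-! ### The Lagrangian lift near a vertex -/

section

variable {E F : Type} [NormedAddCommGroup E] [NormedSpace ℝ E] [TopologicalSpace F] {k : ℕ}
  {A : Type} [AddCommGroup A]

theorem cohomologyRes_bijective_of_eq_prod {S T : Set (E × F)} (h : S ⊆ T) {C C' : Set E}
    {Φ : Set F} (hS : S = C ×ˢ Φ) (hT : T = C' ×ˢ Φ) (hC : Convex ℝ C) (hC' : Convex ℝ C')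
    (hne : C.Nonempty) (hCC' : C ⊆ C') : Function.Bijective (cohomologyRes k A h) := by
  subst hS hT
  exact cohomologyRes_bijective_of_convex hC hC' hne hCC' Φ h

theorem cohomologyRes_bijective_of_ball {S T : Set (E × F)} (h : S ⊆ T) (v : E) {m ε : ℝ}
    (hm : 0 < m) (hmε : m < ε)
    (hT : ∀ y ∈ T, ∀ c ∈ Set.Icc (0 : ℝ) 1, m ≤ c * ‖y.1 - v‖ → (v + c • (y.1 - v), y.2) ∈ T)
    (hS : ∀ y, y ∈ S ↔ y ∈ T ∧ dist y.1 v < ε) : Function.Bijective (cohomologyRes k A h) := by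
  obtain rfl : S = {y | y ∈ T ∧ dist y.1 v < ε} := Set.ext hS
  exact cohomologyRes_bijective_of_radial v hm hmε hT h

/-- Moving towards `v` increases the distance to the other extreme point. -/
theorem EmanatesFrom.dist_le_dist {e : Set E} {v u w q : E} (h : EmanatesFrom e v u)
    (hw : w ∈ e.extremePoints ℝ) (hwv : w ≠ v) (hq : q ∈ e) {c : ℝ} (hc : c ∈ Set.Icc (0 : ℝ) 1) :
    dist q w ≤ dist (v + c • (q - v)) w := by
  have hle := h.dist_le_of_mem_extremePoints hw hwv hq
  have e1 := h.eq_add_smul q hq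
  have e2 := h.eq_add_smul w hw.1
  have h0 : 0 ≤ dist q v := dist_nonneg
  generalize dist w v = t at *
  generalize dist q v = s at *
  have h1 : c * s ≤ s := mul_le_of_le_one_left h0 hc.2
  rw [e1, e2, add_sub_cancel_left, smul_smul, dist_eq_norm, dist_eq_norm,
    add_sub_add_left_eq_sub, add_sub_add_left_eq_sub, ← sub_smul, ← sub_smul, norm_smul, norm_smul,
    h.norm_eq_one, mul_one, mul_one, Real.norm_eq_abs, Real.norm_eq_abs, abs_sub_comm,
    abs_of_nonneg (by linarith), abs_sub_comm, abs_of_nonneg (by linarith)]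
  linarith

end

namespace TropicalCurve.LiftData

variable {n : ℕ} {V : TropicalCurve n} (D : V.LiftData)

/-- The pairs of pants are conormal over the complement of the open `m`-balls around the vertices,
where `m < ε`. -/
structure IsCoreRadius (m : ℝ) : Prop where
  pos : 0 < m
  lt : m < D.ε
  pants : ∀ v : V.vertices, ∃ r, IsLagrangianPants r (D.pants v) ∧
    ∀ x ∈ Metric.closedBall (0 : BaseSpace 2) r,
      dist (planeEmbedding v (D.splitting v) x) v < m

/-- The points of `e` whose distances to the vertices lie in `I`. -/
def edgePart (V : TropicalCurve n) (e : Set (BaseSpace n)) (I : Set ℝ) : Set (BaseSpace n) :=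
  {q | q ∈ e ∧ ∀ v : V.vertices, dist q v ∈ I}

/-- The part of `L_e` at distance more than `m` from the vertices. -/
def outerLift (V : TropicalCurve n) (m : ℝ) (e : Set (BaseSpace n)) : Set (TorusBundle n) :=
  edgePart V e (Set.Ioi m) ×ˢ conormalFibre e

/-- An open neighbourhood of the closed star of `v` in `V`, away from the other vertices and from
the edges which do not end at `v`. -/
def starRegion (V : TropicalCurve n) (m : ℝ) (v : V.vertices) : Set (BaseSpace n) :=
  {q | (∀ w : V.vertices, w ≠ v → m < dist q w) ∧ ∀ e ∈ V.edges, (v : BaseSpace n) ∉ e → q ∉ e}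

/-- The part of the Lagrangian lift over the stars of the vertices in `W`. -/
def starLift (m : ℝ) (W : Set V.vertices) : Set (TorusBundle n) :=
  {y | y ∈ D.lift ∧ ∃ v ∈ W, y.1 ∈ starRegion V m v}

theorem convex_edgePart {e : Set (BaseSpace n)} (he : e ∈ V.edges) {I : Set ℝ}
    (hI : I.OrdConnected) (hεI : Set.Ici D.ε ⊆ I) : Convex ℝ (edgePart V e I) := by
  intro x hx y hy a b ha hb hab
  refine ⟨convex_edge he hx.1 hy.1 ha hb hab, fun v => ?_⟩
  by_cases hv : (v : BaseSpace n) ∈ e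
  · obtain ⟨u, hu⟩ := exists_emanatesFrom_edge he v.2 hv
    exact (hu.convex_inter hI ⟨hx.1, hx.2 v⟩ ⟨hy.1, hy.2 v⟩ ha hb hab).2
  · apply hεI
    by_contra h
    exact hv (D.vertex_mem he v (convex_edge he hx.1 hy.1 ha hb hab) (not_le.1 h))

theorem edgeLift_eq (e : Set (BaseSpace n)) :
    D.edgeLift e = edgePart V e (Set.Ici D.ε) ×ˢ conormalFibre e := by
  ext y
  constructor
  · rintro ⟨⟨h1, h2⟩, h3⟩
    exact ⟨⟨h1, fun v => not_lt.1 (show ¬ dist _ _ < _ from h3 v)⟩, h2⟩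
  · rintro ⟨⟨h1, h3⟩, h2⟩
    exact ⟨⟨h1, h2⟩, fun v hv => not_lt.2 (show _ ≤ dist _ _ from h3 v) hv⟩

theorem isOpen_starRegion (m : ℝ) (v : V.vertices) : IsOpen (starRegion V m v) := by
  have : starRegion V m v = (⋂ w : {w : V.vertices // w ≠ v}, {q : BaseSpace n | m < dist q w}) ∩
      ⋂ e : {e : V.edges // (v : BaseSpace n) ∉ (e : Set (BaseSpace n))},
        ((e : V.edges) : Set (BaseSpace n))ᶜ := by
    ext q
    simp [starRegion]
  rw [this]
  refine (isOpen_iInter_of_finite fun w => ?_).inter (isOpen_iInter_of_finite fun e => ?_)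
  · exact isOpen_lt continuous_const (continuous_id.dist continuous_const)
  · exact (isClosed_edge e.1.2).isOpen_compl

theorem relOpen_starLift (m : ℝ) (W W' : Set V.vertices) :
    SingCochain.RelOpen (D.starLift m W) (D.starLift m W') := by
  have hopen : ∀ W : Set V.vertices,
      IsOpen {y : TorusBundle n | ∃ v ∈ W, y.1 ∈ starRegion V m v} := by
    intro W
    have : {y : TorusBundle n | ∃ v ∈ W, y.1 ∈ starRegion V m v} =
        Prod.fst ⁻¹' ⋃ v ∈ W, starRegion V m v := by
      ext y; simp
    rw [this]
    exact (isOpen_biUnion fun v _ => isOpen_starRegion m v).preimage continuous_fst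
  refine ⟨_, _, hopen W, hopen W', ?_, ?_⟩
  · ext y
    exact ⟨fun h => ⟨Or.inl h, h.2⟩, fun h => ⟨h.1.elim And.left And.left, h.2⟩⟩
  · ext y
    exact ⟨fun h => ⟨Or.inr h, h.2⟩, fun h => ⟨h.1.elim And.left And.left, h.2⟩⟩

theorem starLift_union (m : ℝ) (W W' : Set V.vertices) :
    D.starLift m W ∪ D.starLift m W' = D.starLift m (W ∪ W') := by
  ext y
  constructor
  · rintro (⟨h, v, hv, hy⟩ | ⟨h, v, hv, hy⟩)
    · exact ⟨h, v, Or.inl hv, hy⟩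
    · exact ⟨h, v, Or.inr hv, hy⟩
  · rintro ⟨h, v, hv | hv, hy⟩
    · exact Or.inl ⟨h, v, hv, hy⟩
    · exact Or.inr ⟨h, v, hv, hy⟩

theorem starLift_mono (m : ℝ) {W W' : Set V.vertices} (h : W ⊆ W') :
    D.starLift m W ⊆ D.starLift m W' := fun _ hy =>
  ⟨hy.1, hy.2.imp fun _ hv => ⟨h hv.1, hv.2⟩⟩

theorem mem_lift_iff_productModel (v : V.vertices) {y : TorusBundle n}
    (hy : dist y.1 (v : BaseSpace n) < D.ε) :
    y ∈ D.lift ↔ y ∈ productModel (v : BaseSpace n) (D.splitting v) (D.pants v) := by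
  constructor
  · rintro (⟨e, -, -, h⟩ | ⟨w, hw, h⟩)
    · exact absurd hy (h v)
    · by_cases hvw : v = w
      · rw [hvw]; exact h
      · exact absurd hw (D.le_dist v w hvw hy).not_gt
  · exact fun h => Or.inr ⟨v, hy, h⟩

variable {D} {m : ℝ} (h : D.IsCoreRadius m)

include h in
/-- Between the spheres of radius `m` and `ε` around a vertex the lift is conormal. -/
theorem IsCoreRadius.mem_productModel_iff (v : V.vertices) {y : TorusBundle n}
    (hm : m ≤ dist y.1 (v : BaseSpace n)) (hy : dist y.1 (v : BaseSpace n) < D.ε) :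
    y ∈ productModel (v : BaseSpace n) (D.splitting v) (D.pants v) ↔
      ∃ e ∈ V.edges, (v : BaseSpace n) ∈ e ∧ y ∈ periodizedConormal e := by
  obtain ⟨r, hr, hx⟩ := h.pants v
  rw [IntegralSplitting.mem_productModel_iff hr hx hm]
  obtain ⟨E, -, hE, hEu, hEall, hEmem⟩ := D.exists_star v
  constructor
  · rintro ⟨i, hi, hF⟩
    exact ⟨E i, hE i, (hEu i).mem, hEmem i _ hy hi,
      (mem_conormalFibre_iff (D.splitting v) i (hEu i).vectorSpan_eq _).2 hF⟩
  · rintro ⟨e, he, hve, hye, hF⟩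
    obtain ⟨i, rfl⟩ := hEall e he hve
    exact ⟨i, (hEu i).eq_add_smul _ hye,
      (mem_conormalFibre_iff (D.splitting v) i (hEu i).vectorSpan_eq _).1 hF⟩

include h in
theorem IsCoreRadius.outerLift_subset_lift {e : Set (BaseSpace n)} (he : e ∈ V.edges) :
    outerLift V m e ⊆ D.lift := by
  rintro y ⟨⟨hye, hm⟩, hF⟩
  by_cases hb : ∃ v : V.vertices, dist y.1 (v : BaseSpace n) < D.ε
  · obtain ⟨v, hv⟩ := hb
    rw [D.mem_lift_iff_productModel v hv, h.mem_productModel_iff v (hm v).le hv]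
    exact ⟨e, he, D.vertex_mem he v hye hv, hye, hF⟩
  · exact Or.inl ⟨e, he, ⟨hye, hF⟩, fun v hv => hb ⟨v, hv⟩⟩

include h in
theorem IsCoreRadius.mem_starRegion_of_dist_lt (v : V.vertices) {q : BaseSpace n}
    (hq : dist q (v : BaseSpace n) < D.ε) : q ∈ starRegion V m v :=
  ⟨fun w hw => h.lt.trans_le (D.le_dist v w hw.symm hq),
    fun _ he hve hqe => hve (D.vertex_mem he v hqe hq)⟩

include h in
theorem IsCoreRadius.mem_starRegion_of_mem_edge {e : Set (BaseSpace n)} (he : e ∈ V.edges)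
    {v : V.vertices} (hv : (v : BaseSpace n) ∈ e) {q : BaseSpace n}
    (hq : q ∈ edgePart V e (Set.Ioi m)) : q ∈ starRegion V m v := by
  refine ⟨fun w _ => hq.2 w, fun e' he' hv' hqe' => ?_⟩
  have hne : e ≠ e' := fun h => hv' (h ▸ hv)
  have := hq.2 ⟨q, e, he, (mem_extremePoints_of_mem_inter he he' hne hq.1 hqe').1⟩
  rw [dist_self] at this
  exact (lt_asymm h.pos this)

include h in
theorem IsCoreRadius.mem_starRegion_iff {v : V.vertices} {y : TorusBundle n} (hy : y ∈ D.lift) :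
    y.1 ∈ starRegion V m v ↔ dist y.1 (v : BaseSpace n) < D.ε ∨
      ∃ e ∈ V.edges, (v : BaseSpace n) ∈ e ∧ y ∈ outerLift V m e := by
  constructor
  · intro hs
    by_cases hv : dist y.1 (v : BaseSpace n) < D.ε
    · exact Or.inl hv
    refine Or.inr ?_
    have hall : ∀ w : V.vertices, m < dist y.1 (w : BaseSpace n) := by
      intro w
      by_cases hwv : w = v
      · rw [hwv]; exact h.lt.trans_le (not_lt.1 hv)
      · exact hs.1 w hwv
    have hmem : ∀ e ∈ V.edges, y.1 ∈ e → (v : BaseSpace n) ∈ e := fun e he hye => by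
      by_contra hve
      exact hs.2 e he hve hye
    rcases hy with ⟨e, he, ⟨hye, hF⟩, -⟩ | ⟨w, hw, hyw⟩
    · exact ⟨e, he, hmem e he hye, ⟨hye, hall⟩, hF⟩
    · obtain ⟨e, he, -, hye, hF⟩ := (h.mem_productModel_iff w (hall w).le hw).1 hyw
      exact ⟨e, he, hmem e he hye, ⟨hye, hall⟩, hF⟩
  · rintro (hd | ⟨e, he, hve, hye⟩)
    · exact h.mem_starRegion_of_dist_lt v hd
    · exact h.mem_starRegion_of_mem_edge he hve hye.1

include h in
theorem IsCoreRadius.outerLift_subset_starLift {e : Set (BaseSpace n)} (he : e ∈ V.edges)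
    {v : V.vertices} (hv : (v : BaseSpace n) ∈ e) {W : Set V.vertices} (hW : v ∈ W) :
    outerLift V m e ⊆ D.starLift m W := fun _ hy =>
  ⟨h.outerLift_subset_lift he hy, v, hW, h.mem_starRegion_of_mem_edge he hv hy.1⟩

include h in
/-- The parts of the lift over the stars of two vertices meet over the edge joining them. -/
theorem IsCoreRadius.exists_edge_of_mem_starRegion {v w : V.vertices} (hvw : v ≠ w)
    {y : TorusBundle n} (hy : y ∈ D.lift) (hv : y.1 ∈ starRegion V m v)
    (hw : y.1 ∈ starRegion V m w) :
    ∃ e ∈ V.edges, (v : BaseSpace n) ∈ e ∧ (w : BaseSpace n) ∈ e ∧ y ∈ outerLift V m e := by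
  have hin : ∀ e ∈ V.edges, y.1 ∈ e → (v : BaseSpace n) ∈ e ∧ (w : BaseSpace n) ∈ e := by
    intro e he hye
    constructor
    · by_contra hve
      exact hv.2 e he hve hye
    · by_contra hve
      exact hw.2 e he hve hye
  have hall : ∀ u : V.vertices, m < dist y.1 (u : BaseSpace n) := by
    intro u
    by_cases huv : u = v
    · rw [huv]; exact hw.1 v hvw
    · exact hv.1 u huv
  rcases hy with ⟨e, he, ⟨hye, hF⟩, -⟩ | ⟨u, hu, hyu⟩
  · exact ⟨e, he, (hin e he hye).1, (hin e he hye).2, ⟨hye, hall⟩, hF⟩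
  · obtain ⟨e, he, -, hye, hF⟩ := (h.mem_productModel_iff u (hall u).le hu).1 hyu
    exact ⟨e, he, (hin e he hye).1, (hin e he hye).2, ⟨hye, hall⟩, hF⟩

include h in
theorem IsCoreRadius.starLift_univ (hV : ∀ e ∈ V.edges, ∃ v : V.vertices, (v : BaseSpace n) ∈ e) :
    D.starLift m Set.univ = D.lift := by
  ext y
  refine ⟨fun hy => hy.1, fun hy => ⟨hy, ?_⟩⟩
  have hy' := hy
  rcases hy with ⟨e, he, ⟨hye, hF⟩, hd⟩ | ⟨v, hv, -⟩
  · obtain ⟨v, hv⟩ := hV e he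
    exact ⟨v, trivial, h.mem_starRegion_of_mem_edge he hv
      ⟨hye, fun w => h.lt.trans_le (not_lt.1 (hd w))⟩⟩
  · exact ⟨v, trivial, h.mem_starRegion_of_dist_lt v hv⟩

variable {k : ℕ} {A : Type} [AddCommGroup A]

theorem contract_mem_productModel {v : BaseSpace n} {B : IntegralSplitting n}
    {P : Set (TorusBundle 2)} {r : ℝ} (hP : IsLagrangianPants r P)
    (hr : ∀ x ∈ Metric.closedBall (0 : BaseSpace 2) r, dist (planeEmbedding v B x) v < m)
    {y : TorusBundle n} (hy : y ∈ productModel v B P) {c : ℝ} (hc : c ∈ Set.Icc (0 : ℝ) 1)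
    (hm : m ≤ c * ‖y.1 - v‖) : (v + c • (y.1 - v), y.2) ∈ productModel v B P := by
  have hm' : m ≤ dist y.1 v := by
    rw [dist_eq_norm]
    exact hm.trans (mul_le_of_le_one_left (norm_nonneg _) hc.2)
  obtain ⟨i, hi, hF⟩ := (IntegralSplitting.mem_productModel_iff hP hr hm').1 hy
  have hd : dist (v + c • (y.1 - v)) v = c * ‖y.1 - v‖ := by
    rw [dist_eq_norm, add_sub_cancel_left, norm_smul, Real.norm_of_nonneg hc.1]
  refine (IntegralSplitting.mem_productModel_iff hP hr
    (y := (v + c • (y.1 - v), y.2)) (by rw [hd]; exact hm)).2 ⟨i, ?_, hF⟩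
  simp only
  rw [hd, sub_eq_of_eq_add' hi, norm_smul, IntegralSplitting.norm_legDir, mul_one,
    Real.norm_of_nonneg dist_nonneg, smul_smul]

include h in
/-- Outside the ball of radius `m`, the part of the lift over the star of `v` is invariant under
moving radially towards `v`. -/
theorem IsCoreRadius.contract_mem_star (v : V.vertices) {y : TorusBundle n}
    (hy : y ∈ D.starLift m {v}) {c : ℝ} (hc : c ∈ Set.Icc (0 : ℝ) 1)
    (hm : m ≤ c * ‖y.1 - v‖) :
    ((v : BaseSpace n) + c • (y.1 - v), y.2) ∈ D.starLift m {v} := by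
  obtain ⟨hyL, w, hw, hs⟩ := hy
  rw [Set.mem_singleton_iff.1 hw] at hs
  have hm' : m ≤ dist y.1 (v : BaseSpace n) := by
    rw [dist_eq_norm]
    exact hm.trans (mul_le_of_le_one_left (norm_nonneg _) hc.2)
  have hd : dist ((v : BaseSpace n) + c • (y.1 - v)) v = c * ‖y.1 - v‖ := by
    rw [dist_eq_norm, add_sub_cancel_left, norm_smul, Real.norm_of_nonneg hc.1]
  -- in both cases `y` is conormal to an edge which ends at `v`
  have hconormal : ∃ e ∈ V.edges, (v : BaseSpace n) ∈ e ∧ y ∈ periodizedConormal e := by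
    rcases (h.mem_starRegion_iff hyL).1 hs with hy | ⟨e, he, hve, hye⟩
    · exact (h.mem_productModel_iff v hm' hy).1 ((D.mem_lift_iff_productModel v hy).1 hyL)
    · exact ⟨e, he, hve, hye.1.1, hye.2⟩
  obtain ⟨e, he, hve, hye, hF⟩ := hconormal
  obtain ⟨u, hu⟩ := exists_emanatesFrom_edge he v.2 hve
  have hmem : (v : BaseSpace n) + c • (y.1 - v) ∈ e :=
    hu.convex.add_smul_sub_mem hu.mem hye hc
  by_cases hball : dist ((v : BaseSpace n) + c • (y.1 - v)) v < D.ε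
  · have hP := (h.mem_productModel_iff v (y := ((v : BaseSpace n) + c • (y.1 - v), y.2))
      (hd.symm ▸ hm) hball).2 ⟨e, he, hve, hmem, hF⟩
    exact ⟨(D.mem_lift_iff_productModel v (y := ((v : BaseSpace n) + c • (y.1 - v), y.2))
      hball).2 hP, v, rfl, h.mem_starRegion_of_dist_lt v hball⟩
  · suffices hall : ∀ w : V.vertices, m < dist ((v : BaseSpace n) + c • (y.1 - v)) w from
      h.outerLift_subset_starLift he hve (Set.mem_singleton v) ⟨⟨hmem, hall⟩, hF⟩
    intro w
    by_cases hwv : w = v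
    · rw [hwv]
      exact h.lt.trans_le (not_lt.1 hball)
    · by_cases hwe : (w : BaseSpace n) ∈ e
      · exact (hs.1 w hwv).trans_le (hu.dist_le_dist (mem_extremePoints_of_mem he w.2 hwe)
          (fun h => hwv (Subtype.ext h)) hye hc)
      · by_contra hlt
        exact hwe (D.vertex_mem he w hmem ((not_lt.1 hlt).trans_lt h.lt))

include h in
/-- The conormal bundle of an edge at `v` agrees near `v` with an end of the product model. -/
theorem IsCoreRadius.exists_edge_model (v : V.vertices) {e : Set (BaseSpace n)} (he : e ∈ V.edges)
    {i : Fin 3} (hu : EmanatesFrom e (v : BaseSpace n) ((D.splitting v).legDir i))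
    (hmem : ∀ q, dist q (v : BaseSpace n) < D.ε →
      q = v + dist q (v : BaseSpace n) • (D.splitting v).legDir i → q ∈ e) :
    ∃ (K : Set (TorusBundle n)) (_ : K ⊆ {y | y ∈ D.lift ∧ dist y.1 (v : BaseSpace n) < D.ε})
      (hK : K ⊆ IntegralSplitting.legEnd (v : BaseSpace n) (D.splitting v) i m)
      (hK' : K ⊆ outerLift V m e),
      (∀ k, Function.Bijective (cohomologyRes k A hK)) ∧
      (∀ k, Function.Bijective (cohomologyRes k A hK')) := by
  have hΦ : conormalFibre e = {s | (D.splitting v).planeFibre s ∈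
      conormalFibre (pantsRay i)} :=
    Set.ext fun s => mem_conormalFibre_iff (D.splitting v) i hu.vectorSpan_eq s
  have hC : IntegralSplitting.farRay (v : BaseSpace n) (D.splitting v) i m ∩
      Metric.ball (v : BaseSpace n) D.ε ⊆ edgePart V e (Set.Ioi m) := by
    rintro q ⟨⟨hq, hqm⟩, hqε⟩
    refine ⟨hmem q hqε hq, fun w => ?_⟩
    by_cases hwv : w = v
    · rw [hwv]; exact hqm
    · exact h.lt.trans_le (D.le_dist v w (Ne.symm hwv) hqε)
  have hconv := (IntegralSplitting.convex_farRay (v : BaseSpace n) (D.splitting v) i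
    h.pos.le).inter (convex_ball (v : BaseSpace n) D.ε)
  have hne : (IntegralSplitting.farRay (v : BaseSpace n) (D.splitting v) i m ∩
      Metric.ball (v : BaseSpace n) D.ε).Nonempty := by
    obtain ⟨t, ht, ht'⟩ := exists_between h.lt
    have hd := dist_add_smul ((D.splitting v).norm_legDir i) (v : BaseSpace n)
      (h.pos.trans ht).le
    exact ⟨(v : BaseSpace n) + t • (D.splitting v).legDir i, ⟨by rw [hd], by rw [hd]; exact ht⟩,
      by rw [Metric.mem_ball, hd]; exact ht'⟩
  refine ⟨(IntegralSplitting.farRay (v : BaseSpace n) (D.splitting v) i m ∩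
      Metric.ball (v : BaseSpace n) D.ε) ×ˢ conormalFibre e, fun y hy => ?_,
      fun y hy => ⟨hy.1.1, hΦ ▸ hy.2⟩, Set.prod_mono hC le_rfl, fun k => ?_, fun k => ?_⟩
  · exact ⟨h.outerLift_subset_lift he ⟨hC hy.1, hy.2⟩, hy.1.2⟩
  · exact cohomologyRes_bijective_of_eq_prod _ rfl (by rw [hΦ]; rfl) hconv
      (IntegralSplitting.convex_farRay _ _ i h.pos.le) hne Set.inter_subset_left
  · exact cohomologyRes_bijective_of_eq_prod _ rfl rfl hconv
      (D.convex_edgePart he Set.ordConnected_Ioi fun t ht => h.lt.trans_le ht) hne hC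

include h in
/-- Near a vertex `v`, the parts of the lift and of the product model over the `ε`-ball agree, and
the inclusions of this common part `M` into the star and into the product model are homotopy
equivalences. The same holds for each edge, with a common part `K ⊆ M` of the lift of the edge and
of an end of the product model. Hence the star and the product model have the same restriction maps
to the three edges. -/
theorem IsCoreRadius.exists_local_model (v : V.vertices) : ∃ r : ℝ,
    IsLagrangianPants r (D.pants v) ∧
    (∀ x ∈ Metric.closedBall (0 : BaseSpace 2) r,
      dist (planeEmbedding v (D.splitting v) x) v < m) ∧
    ∃ E : Fin 3 → Set (BaseSpace n), Function.Injective E ∧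
    (∀ e, (e ∈ V.edges ∧ (v : BaseSpace n) ∈ e) ↔ ∃ i, e = E i) ∧
    ∃ (M : Set (TorusBundle n))
      (hM : M ⊆ productModel (v : BaseSpace n) (D.splitting v) (D.pants v))
      (hM' : M ⊆ D.starLift m {v}),
      (∀ k, Function.Bijective (cohomologyRes k A hM)) ∧
      (∀ k, Function.Bijective (cohomologyRes k A hM')) ∧
      ∀ i, ∃ (K : Set (TorusBundle n)) (_ : K ⊆ M)
        (hK : K ⊆ IntegralSplitting.legEnd (v : BaseSpace n) (D.splitting v) i m)
        (hK' : K ⊆ outerLift V m (E i)),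
        (∀ k, Function.Bijective (cohomologyRes k A hK)) ∧
        (∀ k, Function.Bijective (cohomologyRes k A hK')) := by
  obtain ⟨r, hP, hr⟩ := h.pants v
  obtain ⟨E, hEinj, hE, hEu, hEall, hEmem⟩ := D.exists_star v
  refine ⟨r, hP, hr, E, hEinj, fun e => ⟨fun he => hEall e he.1 he.2, ?_⟩,
    {y | y ∈ D.lift ∧ dist y.1 (v : BaseSpace n) < D.ε},
    fun y hy => (D.mem_lift_iff_productModel v hy.2).1 hy.1,
    fun y hy => ⟨hy.1, v, rfl, h.mem_starRegion_of_dist_lt v hy.2⟩, fun k => ?_, fun k => ?_,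
    fun i => ?_⟩
  · rintro ⟨i, rfl⟩
    exact ⟨hE i, (hEu i).mem⟩
  · refine cohomologyRes_bijective_of_ball _ (v : BaseSpace n) h.pos h.lt ?_ fun y => ?_
    · exact fun y hy c hc hm => contract_mem_productModel hP hr hy hc hm
    · exact ⟨fun hy => ⟨(D.mem_lift_iff_productModel v hy.2).1 hy.1, hy.2⟩,
        fun hy => ⟨(D.mem_lift_iff_productModel v hy.2).2 hy.1, hy.2⟩⟩
  · refine cohomologyRes_bijective_of_ball _ (v : BaseSpace n) h.pos h.lt ?_ fun y => ?_
    · exact fun y hy c hc hm => h.contract_mem_star v hy hc hm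
    · exact ⟨fun hy => ⟨⟨hy.1, v, rfl, h.mem_starRegion_of_dist_lt v hy.2⟩, hy.2⟩,
        fun hy => ⟨hy.1.1, hy.2⟩⟩
  · exact h.exists_edge_model v (hE i) (hEu i) (hEmem i)

include h in
/-- Classes on an edge at `v` extend to the star of `v`. -/
theorem IsCoreRadius.res_star_surjective (v : V.vertices) {e : Set (BaseSpace n)}
    (he : e ∈ V.edges) (hv : (v : BaseSpace n) ∈ e) : Function.Surjective
      (cohomologyRes k A (h.outerLift_subset_starLift he hv (Set.mem_singleton v))) := by
  obtain ⟨r, hP, hr, E, -, hE, M, hM, hM', hMb, hMb', hK⟩ := h.exists_local_model (A := A) v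
  obtain ⟨i, rfl⟩ := (hE e).1 ⟨he, hv⟩
  obtain ⟨K, hKM, hKl, hKo, hKlb, hKob⟩ := hK i
  intro a
  obtain ⟨a', ha'⟩ := (hKlb k).2 (cohomologyRes k A hKo a)
  obtain ⟨b, hb⟩ := IntegralSplitting.res_legEnd_surjective (k := k) (A := A) hP h.pos hr i a'
  obtain ⟨c, hc⟩ := (hMb' k).2 (cohomologyRes k A hM b)
  refine ⟨c, (hKob k).1 ?_⟩
  rw [← ha', ← hb, cohomologyRes_res, cohomologyRes_res, ← cohomologyRes_res hKM hM', hc,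
    cohomologyRes_res]

include h in
/-- A class of degree at least two on the star of `v` which vanishes on two edges is zero. -/
theorem IsCoreRadius.eq_zero_of_res_star (v : V.vertices) {e e' : Set (BaseSpace n)}
    (hee' : e ≠ e') (he : e ∈ V.edges) (hv : (v : BaseSpace n) ∈ e) (he' : e' ∈ V.edges)
    (hv' : (v : BaseSpace n) ∈ e') (a : cohomologyOf (k + 2) A (D.starLift m {v}))
    (h1 : cohomologyRes (k + 2) A (h.outerLift_subset_starLift he hv (Set.mem_singleton v)) a = 0)
    (h2 : cohomologyRes (k + 2) A
      (h.outerLift_subset_starLift he' hv' (Set.mem_singleton v)) a = 0) : a = 0 := by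
  obtain ⟨r, hP, hr, E, -, hE, M, hM, hM', hMb, hMb', hK⟩ := h.exists_local_model (A := A) v
  obtain ⟨i, rfl⟩ := (hE e).1 ⟨he, hv⟩
  obtain ⟨j, rfl⟩ := (hE e').1 ⟨he', hv'⟩
  obtain ⟨b, hb⟩ := (hMb (k + 2)).2 (cohomologyRes (k + 2) A hM' a)
  have key : ∀ i (hi : outerLift V m (E i) ⊆ D.starLift m {v}),
      cohomologyRes (k + 2) A hi a = 0 →
      cohomologyRes (k + 2) A (IntegralSplitting.legEnd_subset hP hr i le_rfl) b = 0 := by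
    intro i hi h0
    obtain ⟨K, hKM, hKl, hKo, hKlb, hKob⟩ := hK i
    apply (hKlb (k + 2)).1
    rw [map_zero, cohomologyRes_res, ← cohomologyRes_res hKM hM, hb, cohomologyRes_res,
      ← cohomologyRes_res hKo hi, h0, map_zero]
  have hb0 := IntegralSplitting.eq_zero_of_res_legEnd hP h.pos hr (fun hij => hee' (congrArg E hij)) b
    (key i _ h1) (key j _ h2)
  apply (hMb' (k + 2)).1
  rw [← hb, hb0, map_zero, map_zero]

end TropicalCurve.LiftData

/-! ### Subtrees -/

/-- In an acyclic graph, a vertex outside a connected set `W` has at most one neighbour in `W`. -/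
theorem SimpleGraph.IsAcyclic.eq_of_adj {U : Type*} {G : SimpleGraph U} (hG : G.IsAcyclic)
    {W : Set U} (hW : ∀ x ∈ W, ∀ y ∈ W, ∃ p : G.Walk x y, ∀ z ∈ p.support, z ∈ W) {w x y : U}
    (hw : w ∉ W) (hx : x ∈ W) (hy : y ∈ W) (hxw : G.Adj x w) (hyw : G.Adj y w) : x = y := by
  classical
  by_contra hne
  obtain ⟨p, hp⟩ := hW x hx y hy
  let q : G.Walk x y := .cons hxw (.cons hyw.symm .nil)
  have hq : q.IsPath := by
    simp [q, hxw.ne, hyw.ne', hne]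
  have := (hG.subsingleton_path x y).elim p.toPath ⟨q, hq⟩
  have hwq : w ∈ (p.toPath : G.Walk x y).support := by
    rw [this]
    simp [q]
  exact hw (hp w (SimpleGraph.Walk.support_toPath_subset_support p hwq))

namespace TropicalCurve.LiftData

variable {n : ℕ} {V : TropicalCurve n} {D : V.LiftData} {m : ℝ} {A : Type} [AddCommGroup A]

/-- At every vertex there are at least two edges apart from a given one. -/
theorem exists_two_edges (D : V.LiftData) (v : V.vertices) (e : Set (BaseSpace n)) :
    ∃ e₁ ∈ V.edges, ∃ e₂ ∈ V.edges, (v : BaseSpace n) ∈ e₁ ∧ (v : BaseSpace n) ∈ e₂ ∧ e₁ ≠ e₂ ∧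
      e₁ ≠ e ∧ e₂ ≠ e := by
  obtain ⟨E, hinj, hE, hEu, -, -⟩ := D.exists_star v
  have h3 : ∃ i j : Fin 3, i ≠ j ∧ E i ≠ e ∧ E j ≠ e := by
    by_cases h : ∃ i, E i = e
    · obtain ⟨i, rfl⟩ := h
      obtain ⟨j, k, hjk, hj, hk⟩ : ∃ j k : Fin 3, j ≠ k ∧ j ≠ i ∧ k ≠ i := by
        revert i; decide
      exact ⟨j, k, hjk, hinj.ne hj, hinj.ne hk⟩
    · push Not at h
      exact ⟨0, 1, by decide, h 0, h 1⟩
  obtain ⟨i, j, hij, hi, hj⟩ := h3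
  exact ⟨E i, hE i, E j, hE j, (hEu i).mem, (hEu j).mem, hinj.ne hij, hi, hj⟩

/-- The two halves of the result for the part of the lift over the stars of the vertices of a
subtree `W`: classes on `f` extend, and a class of degree two is detected on the edges other than
`f` which leave the subtree. -/
structure IsDetecting (D : V.LiftData) (m : ℝ) (A : Type) [AddCommGroup A]
    (f : Set (BaseSpace n)) (v₀ : V.vertices) (W : Set V.vertices) : Prop where
  mem : v₀ ∈ W
  connected : ∀ x ∈ W, ∀ y ∈ W, ∃ p : V.graph.Walk x y, ∀ z ∈ p.support, z ∈ W
  surjective : ∀ hs : outerLift V m f ⊆ D.starLift m W,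
    Function.Surjective (cohomologyRes 1 A hs)
  eq_zero : ∀ a : cohomologyOf 2 A (D.starLift m W),
    (∀ v ∈ W, ∀ g ∈ V.edges, (v : BaseSpace n) ∈ g → g ≠ f →
      (∀ w ∈ W, (w : BaseSpace n) ∈ g → w = v) → ∀ hs : outerLift V m g ⊆ D.starLift m W,
        cohomologyRes 2 A hs a = 0) → a = 0

theorem IsCoreRadius.isDetecting_singleton (h : D.IsCoreRadius m) {f : Set (BaseSpace n)}
    (hf : f ∈ V.edges) {v₀ : V.vertices} (hv₀ : (v₀ : BaseSpace n) ∈ f) :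
    IsDetecting D m A f v₀ {v₀} where
  mem := rfl
  connected := by
    rintro x rfl y rfl
    exact ⟨SimpleGraph.Walk.nil, by simp⟩
  surjective _ := h.res_star_surjective v₀ hf hv₀
  eq_zero a ha := by
    obtain ⟨e₁, he₁, e₂, he₂, h₁, h₂, h12, h1f, h2f⟩ := D.exists_two_edges v₀ f
    have h0 : ∀ e ∈ V.edges, (v₀ : BaseSpace n) ∈ e → e ≠ f →
        ∀ hs : outerLift V m e ⊆ D.starLift m {v₀}, cohomologyRes 2 A hs a = 0 :=
      fun e he hv hef => ha v₀ rfl e he hv hef fun w hw _ => hw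
    exact h.eq_zero_of_res_star (k := 0) v₀ h12 he₁ h₁ he₂ h₂ a (h0 e₁ he₁ h₁ h1f _)
      (h0 e₂ he₂ h₂ h2f _)

/-- Attaching the star of a neighbouring vertex `w`. It meets the part over `W` only over the edge
`e` joining them, and classes on `e` extend to the star of `w`. -/
theorem IsCoreRadius.isDetecting_insert (h : D.IsCoreRadius m) (hV : V.graph.IsAcyclic)
    {f : Set (BaseSpace n)} (hf : f ∈ V.edges) {v₀ : V.vertices} (hv₀ : (v₀ : BaseSpace n) ∈ f)
    (hfv₀ : ∀ w : V.vertices, (w : BaseSpace n) ∈ f → w = v₀) {W : Set V.vertices}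
    (hW : IsDetecting D m A f v₀ W) {x w : V.vertices} (hx : x ∈ W) (hw : w ∉ W)
    (hxw : V.graph.Adj x w) : IsDetecting D m A f v₀ ({w} ∪ W) := by
  obtain ⟨hne, e, he, hxe, hwe⟩ := hxw
  have huniq : ∀ x' ∈ W, ∀ e' ∈ V.edges, (x' : BaseSpace n) ∈ e' → (w : BaseSpace n) ∈ e' →
      x' = x ∧ e' = e := by
    intro x' hx' e' he' hxe' hwe'
    have hne' : x' ≠ w := fun h => hw (h ▸ hx')
    obtain rfl : x' = x := hV.eq_of_adj hW.connected hw hx' hx ⟨hne', e', he', hxe', hwe'⟩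
      ⟨hne, e, he, hxe, hwe⟩
    exact ⟨rfl, eq_of_mem_inter he' he (fun h => hne (Subtype.ext h)) hxe' hxe hwe' hwe⟩
  have hew : outerLift V m e ⊆ D.starLift m {w} :=
    h.outerLift_subset_starLift he hwe (Set.mem_singleton w)
  have heW : outerLift V m e ⊆ D.starLift m W := h.outerLift_subset_starLift he hxe hx
  have hinter : D.starLift m {w} ∩ D.starLift m W = outerLift V m e := by
    apply Set.Subset.antisymm _ (Set.subset_inter hew heW)
    rintro y ⟨⟨hy, w', hw', hyw⟩, -, x', hx', hyx⟩
    rw [Set.mem_singleton_iff.1 hw'] at hyw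
    obtain ⟨e', he', hxe', hwe', hye⟩ :=
      h.exists_edge_of_mem_starRegion (v := x') (w := w) (fun h => hw (h ▸ hx')) hy hyx hyw
    rwa [← (huniq x' hx' e' he' hxe' hwe').2]
  have hsurj : Function.Surjective (cohomologyRes 1 A
      (Set.inter_subset_left : D.starLift m {w} ∩ D.starLift m W ⊆ D.starLift m {w})) := by
    have : ∀ I (hI : I ⊆ D.starLift m {w}), I = outerLift V m e →
        Function.Surjective (cohomologyRes 1 A hI) := by
      rintro I hI rfl
      exact h.res_star_surjective w he hwe
    exact this _ _ hinter
  have hopen := D.relOpen_starLift m {w} W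
  have hunion := D.starLift_union m {w} W
  have hwU := D.starLift_mono m (Set.subset_union_left : {w} ⊆ {w} ∪ W)
  have hWU := D.starLift_mono m (Set.subset_union_right : W ⊆ {w} ∪ W)
  have hfW := h.outerLift_subset_starLift hf hv₀ hW.mem
  refine ⟨Or.inr hW.mem, ?_, fun hs a => ?_, fun a ha => ?_⟩
  · have hadj : V.graph.Adj x w := ⟨hne, e, he, hxe, hwe⟩
    have hto : ∀ y ∈ W, ∃ p : V.graph.Walk y w, ∀ z ∈ p.support, z ∈ ({w} ∪ W : Set _) := by
      intro y hy
      obtain ⟨p, hp⟩ := hW.connected y hy x hx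
      refine ⟨p.concat hadj, fun z hz => ?_⟩
      rw [SimpleGraph.Walk.support_concat, List.mem_append] at hz
      rcases hz with hz | hz
      · exact Or.inr (hp z hz)
      · exact Or.inl (List.mem_singleton.1 hz)
    rintro y (rfl | hy) z (rfl | hz)
    · exact ⟨.nil, by simp⟩
    · obtain ⟨p, hp⟩ := hto z hz
      exact ⟨p.reverse, fun u hu => hp u (by simpa using hu)⟩
    · exact hto y hy
    · obtain ⟨p, hp⟩ := hW.connected y hy z hz
      exact ⟨p, fun u hu => Or.inr (hp u hu)⟩
  · obtain ⟨b, hb⟩ := hW.surjective hfW a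
    obtain ⟨b', hb'⟩ := hsurj (cohomologyRes 1 A Set.inter_subset_right b)
    obtain ⟨c, -, hc⟩ := exists_cohomology_glue (k := 0) hopen hunion hwU hWU b' b hb'
    exact ⟨c, by rw [← cohomologyRes_res hfW hWU, hc, hb]⟩
  · have hfw : ∀ g : Set (BaseSpace n), (w : BaseSpace n) ∈ g → g ≠ f := by
      rintro g hwg rfl
      exact hw (hfv₀ w hwg ▸ hW.mem)
    -- the edges at `w` other than `e` leave `W ∪ {w}`
    have hwz : cohomologyRes 2 A hwU a = 0 := by
      obtain ⟨e₁, he₁, e₂, he₂, h₁, h₂, h12, h1e, h2e⟩ := D.exists_two_edges w e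
      have h0 : ∀ g ∈ V.edges, (w : BaseSpace n) ∈ g → g ≠ e →
          ∀ hs : outerLift V m g ⊆ D.starLift m {w},
            cohomologyRes 2 A hs (cohomologyRes 2 A hwU a) = 0 := by
        intro g hg hwg hge hs
        rw [cohomologyRes_res]
        refine ha w (Or.inl rfl) g hg hwg (hfw g hwg) ?_ _
        rintro w' (hw' | hw') hwg'
        · exact hw'
        · exact absurd (huniq w' hw' g hg hwg' hwg).2 hge
      exact h.eq_zero_of_res_star (k := 0) w h12 he₁ h₁ he₂ h₂ _ (h0 e₁ he₁ h₁ h1e _)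
        (h0 e₂ he₂ h₂ h2e _)
    refine cohomology_eq_zero_of_res (k := 0) hopen hunion hwU hWU hsurj a hwz
      (hW.eq_zero _ fun v hv g hg hvg hgf hall hs => ?_)
    rw [cohomologyRes_res]
    by_cases hge : g = e
    · subst hge
      rw [← cohomologyRes_res hew hwU, hwz, map_zero]
    · refine ha v (Or.inr hv) g hg hvg hgf ?_ _
      rintro w' (rfl | hw') hwg'
      · exact absurd (huniq v hv g hg hvg hwg').2 hge
      · exact hall w' hw' hwg'

theorem IsCoreRadius.isDetecting_univ (h : D.IsCoreRadius m) (hV : V.IsGenusZero)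
    {f : Set (BaseSpace n)} (hf : f ∈ V.edges) {v₀ : V.vertices} (hv₀ : (v₀ : BaseSpace n) ∈ f)
    (hfv₀ : ∀ w : V.vertices, (w : BaseSpace n) ∈ f → w = v₀) :
    IsDetecting D m A f v₀ Set.univ := by
  obtain ⟨W, hW, hmax⟩ := (Set.toFinite {W | IsDetecting D m A f v₀ W}).exists_maximal
    ⟨_, h.isDetecting_singleton hf hv₀⟩
  have hadj : ∀ v ∈ W, ∀ w, V.graph.Adj v w → w ∈ W := by
    intro v hv w hvw
    by_contra hw
    exact hw (hmax (h.isDetecting_insert hV.2 hf hv₀ hfv₀ hW hv hw hvw)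
      Set.subset_union_right (Or.inl rfl))
  suffices W = Set.univ from this ▸ hW
  refine Set.eq_univ_of_forall fun w => ?_
  obtain ⟨e, he, hwe⟩ := w.2
  obtain ⟨v, hv, hve⟩ := exists_mem_of_adj_closed hV.1 ⟨v₀, hW.mem⟩ hadj he
  by_cases hvw : v = w
  · exact hvw ▸ hv
  · exact hadj v hv w ⟨hvw, e, he, hve, hwe.1⟩

theorem IsCoreRadius.edgeLift_subset_outerLift (h : D.IsCoreRadius m) (e : Set (BaseSpace n)) :
    D.edgeLift e ⊆ outerLift V m e := by
  rw [edgeLift_eq]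
  exact Set.prod_mono (fun q hq => ⟨hq.1, fun v => h.lt.trans_le (hq.2 v)⟩) le_rfl

theorem edgePart_nonempty (D : V.LiftData) {e : Set (BaseSpace n)}
    (hb : ¬ Bornology.IsBounded e) : (edgePart V e (Set.Ici D.ε)).Nonempty := by
  by_contra hne
  refine hb ((Bornology.isBounded_iUnion (s := fun v : V.vertices =>
    Metric.ball (v : BaseSpace n) D.ε)).2 (fun v => Metric.isBounded_ball) |>.subset fun q hq => ?_)
  by_contra hq'
  refine hne ⟨q, hq, fun v => ?_⟩
  by_contra hv
  exact hq' (Set.mem_iUnion.2 ⟨v, show dist _ _ < _ from not_le.1 hv⟩)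

theorem IsCoreRadius.res_edgeLift_bijective (h : D.IsCoreRadius m) {e : Set (BaseSpace n)}
    (he : e ∈ V.edges) (hb : ¬ Bornology.IsBounded e) {k : ℕ} :
    Function.Bijective (cohomologyRes k A (h.edgeLift_subset_outerLift e)) :=
  cohomologyRes_bijective_of_eq_prod _ (D.edgeLift_eq e) rfl
    (D.convex_edgePart he Set.ordConnected_Ici le_rfl)
    (D.convex_edgePart he Set.ordConnected_Ioi fun _ ht => h.lt.trans_le ht)
    (D.edgePart_nonempty hb) fun _ hq => ⟨hq.1, fun v => h.lt.trans_le (hq.2 v)⟩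

end TropicalCurve.LiftData

/-! ### The Lagrangian lift of a genus zero curve -/

theorem mainTheorem8 (n : ℕ) (V : TropicalCurve n) (hsmooth : V.IsSmooth)
    (hgenus : V.IsGenusZero) (D : V.LiftData) (A : Type) [AddCommGroup A]
    (f : Set (BaseSpace n)) (hf : V.IsSemiInfinite f) :
    Function.Surjective (D.res 1 A hf.1) ∧ Function.Injective (D.resOther 2 A f) := by
  obtain ⟨hfe, hfb, v₀, hv₀⟩ := hf
  have hfv₀ : ∀ w : V.vertices, (w : BaseSpace n) ∈ f → w = ⟨v₀, f, hfe, hv₀⟩ := fun w hw =>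
    Subtype.ext (TropicalCurve.eq_of_not_isBounded hfe hfb ⟨f, hfe, hv₀⟩ hv₀.1 w.2 hw)
  obtain ⟨m, hm, hmε, hpants⟩ := D.exists_radius
  have h : D.IsCoreRadius m := ⟨hm, hmε, hpants⟩
  have hdet := h.isDetecting_univ (A := A) hgenus hfe (v₀ := ⟨v₀, f, hfe, hv₀⟩) hv₀.1 hfv₀
  have huniv : D.starLift m Set.univ = D.lift := h.starLift_univ fun e he => by
    obtain ⟨v, -, hv⟩ := TropicalCurve.exists_mem_of_adj_closed hgenus.1
      (W := Set.univ) ⟨⟨v₀, f, hfe, hv₀⟩, trivial⟩ (fun _ _ _ _ => trivial) he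
    exact ⟨v, hv⟩
  have hsub : D.starLift m Set.univ ⊆ D.lift := fun y hy => hy.1
  have hbij : ∀ k, Function.Bijective (cohomologyRes k A hsub) := by
    have : ∀ S (hS : S ⊆ D.lift), S = D.lift → ∀ k, Function.Bijective (cohomologyRes k A hS) := by
      rintro S hS rfl k
      have : ⇑(cohomologyRes k A hS) = id := funext fun a => cohomologyMap_id a
      rw [this]
      exact Function.bijective_id
    exact this _ _ huniv
  have hstar : ∀ g ∈ V.edges, TropicalCurve.LiftData.outerLift V m g ⊆ D.starLift m Set.univ :=
    fun g hg => huniv ▸ h.outerLift_subset_lift hg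
  constructor
  · intro a
    obtain ⟨b, rfl⟩ := (h.res_edgeLift_bijective (A := A) (k := 1) hfe hfb).2 a
    obtain ⟨c, rfl⟩ := hdet.surjective (hstar f hfe) b
    obtain ⟨d, rfl⟩ := (hbij 1).2 c
    refine ⟨d, ?_⟩
    rw [cohomologyRes_res, cohomologyRes_res]
    rfl
  · rw [injective_iff_map_eq_zero]
    intro a ha
    apply (hbij 2).1
    rw [map_zero]
    refine hdet.eq_zero _ fun v _ g hg hvg hgf hall hs => ?_
    -- an edge with a single end point is semi-infinite
    have hgb : ¬ Bornology.IsBounded g := fun hgb => by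
      obtain ⟨w, hw, hwg, hwv⟩ := TropicalCurve.exists_ne_vertex hg hgb v.2 hvg
      exact hwv (congrArg Subtype.val (hall ⟨w, hw⟩ trivial hwg))
    have hg0 : D.res 2 A hg a = 0 := congrFun ha ⟨g, ⟨hg, hgb, v,
      TropicalCurve.mem_extremePoints_of_mem hg v.2 hvg⟩, hgf⟩
    apply (h.res_edgeLift_bijective (A := A) hg hgb).1
    rw [map_zero, cohomologyRes_res, cohomologyRes_res]
    exact hg0

end
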